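/- Let $n,k\ge 1$ and let $W$ be the reflection group of type $B_n/C_n$, realised as the hyperoctahedral group of permutations $w$ of $\pm[n]=\{\pm1,\dots,\pm n\}$ with $w(-i)=-w(i)$. It acts on its reflection representation $V=\mathbb C^n$ by $w e_i=e_{w(i)}$, where $e_{-i}=-e_i$, and on $\mathbb C[V]=\mathbb C[x_1,\dots,x_n]$ by $(w.f)(v)=f(w^{-1}v)$. Let $T=\{((i,j)):i\ne\pm j\}\cup\{[i]\}$ be its set of reflections, where $((i,j))$ is the permutation $(i\;j)(-i\;{-j})$ and $[i]$ is $(i\;{-i})$, let $\ell_T$ be the reflection length and let $u\le_T v$ mean $\ell_T(v)=\ell_T(u)+\ell_T(u^{-1}v)$. Let $c=[1,2,\dots,n]$ be the Coxeter element $1\mapsto2\mapsto\cdots\mapsto n\mapsto-1\mapsto\cdots\mapsto-n\mapsto1$, let $h$ be its order, let $g$ be a generator of $\mathbb Z_{kh}$ and let $\omega\in\mathbb C$ be any primitive $(2nk)$-th root of unity. *The noncrossing parking space.* A noncrossing $k$-flat is a sequence $X=(X_1,\dots,X_k)=(V^{u_1},\dots,V^{u_k})$ of fixed spaces with $u_1\le_T\cdots\le_T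 u_k\le_T c$ (the $u_i$ are determined by the $X_i$). Put $w_0=u_1$, $w_i=u_i^{-1}u_{i+1}$ for $0<i<k$, $w_k=u_k^{-1}c$, and $y=cw_kc^{-1}$; then $g.X$ is the noncrossing $k$-flat whose $i$-th term is the fixed space of the product of the first $i$ terms of $(yw_0y^{-1},\,y,\,w_1,\dots,w_{k-1})$. Let $\mathsf{Park}^{NC}_W(k)$ be the set of classes $[w,X]$, $w\in W$, $X$ a noncrossing $k$-flat, where $[w,X]=[w',X']$ iff $X=X'$ and $wW_{X_1}=w'W_{X_1}$ ($W_{X_1}$ is the pointwise stabiliser of $X_1$). Let $v.[w,X]=[vw,X]$ for $v\in W$ and $g.[w,X]=[wu_kc^{-1},\,g.X]$. *The labelled partition of $[w,X]$.* Place $1,\dots,n,-1,\dots,-n$ clockwise on a circle and identify them in this order with $[2n]=\{1,\dots,2n\}$; identify $\pm[kn]$ with $[2kn]$ in the same way. Let $\pi_i$ be the partition of $\pm[n]$ with $a\sim b$ iff $x_a=x_b$ on $X_i$ (where $x_{-a}=-x_a$), and let $\sigma_i$ be the permutation whose cycles are the blocks of $\pi_i$ read clockwise. Let $\tau_i=\sigma_i^{-1}\sigma_{i+1}$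 for $i<k$ and $\tau_k=\sigma_k^{-1}(1,2,\dots,2n)$. Let $\rho$ be the partition of $[2kn]$ in which, for each $i\in\{1,\dots,k\}$, the points $(a-1)k+i$ and $(b-1)k+i$ are equivalent iff $a,b$ lie in the same cycle of $\tau_i$, and points with different residues modulo $k$ are not equivalent. Let $\pi=\nabla(X)$ be the Kreweras complement of $\rho$ (points placed clockwise as $1',1,2',2,\dots$), a $k$-divisible centrally symmetric noncrossing partition of $\pm[kn]$. Label each block $B$ of $\pi$ by $f(B)=w(B')$, where $B'=\{\pm i\in\pm[n]:\pm((i-1)k+1)\in B\}$ (same sign on both sides). The zero block is the block $Z$ with $Z=-Z$, if there is one; the opener of a block $B\ne -B$ is the $j\in B$ such that, reading clockwise from $j$, all of $B$ is met before any element of $-B$. *Theorem.* One has $h=2n$. Put $\theta_i=x_i^{2nk+1}$, let $(\Theta-\mathbf x)$ be the ideal generated by $\theta_1-x_1,\dots,\theta_n-x_n$, and let $V^\Theta\subset V$ be its zero locus. Then: 1. $\theta_1,\dots,\theta_n$ is a homogeneous system of parameters of degree $kh+1$ (homogeneous of degree $kh+1$ with the origin as only common zero) carrying $V^*$: its span is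 $W$-stable and $x_i\mapsto\theta_i$ induces a $W$-equivariant isomorphism from $V^*$ onto the span. 2. $V^\Theta=\{v\in\mathbb C^n: v_i=0\text{ or }v_i^{2nk}=1\text{ for all }i\}$ consists of exactly $(kh+1)^n$ points, each of multiplicity one, i.e. $\dim_{\mathbb C}\mathbb C[V]/I_v=1$ where $I_v$ is the primary component of $(\Theta-\mathbf x)$ at the maximal ideal of $v$. 3. The permutation module $\mathbb C[V^\Theta]$ (with $g$ acting on $V^\Theta$ as multiplication by $\omega$) is isomorphic as a $W\times\mathbb Z_{kh}$-module to $\mathsf{Park}^{alg}_W(k)=\mathbb C[V]/(\Theta-\mathbf x)$, where $g$ scales by $\omega^d$ in degree $d$. 4. The above formulas define an action of $W\times\mathbb Z_{kh}$ on $\mathsf{Park}^{NC}_W(k)$, and there is a $W\times\mathbb Z_{kh}$-equivariant bijection $\Phi:\mathsf{Park}^{NC}_W(k)\to V^\Theta$ given explicitly (and well defined) by $\Phi([w,X])=(v_1,\dots,v_n)$, where, for $(\pi,f)$ the labelled partition of $[w,X]$, $v_i=0$ if $i\in f(Z)$ for the zero block $Z$; $v_i=\omega^j$ if $i\in f(B)$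 for a nonzero block $B$ with opener $+j$; and $v_i=-\omega^j$ if $i\in f(B)$ for a nonzero block $B$ with opener $-j$. -/

import Mathlib

/-! ### Signed indices, the hyperoctahedral group and its reflection representation -/

/-- The set `±[n] = {1, …, n, -1, …, -n}`: `Sum.inl i` is the index `i + 1` and
`Sum.inr i` is the index `-(i + 1)`, for `i = 0, …, n - 1`. -/
abbrev SignedIdx (n : ℕ) : Type := Fin n ⊕ Fin n

namespace SignedIdx

/-- The map `i ↦ -i` on `±[n]`. -/
def neg {n : ℕ} (i : SignedIdx n) : SignedIdx n := Sum.swap i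

@[simp] theorem neg_neg {n : ℕ} (i : SignedIdx n) : neg (neg i) = i := Sum.swap_swap i

/-- The identification of `±[n]` with the positions `0, …, 2n - 1` on the circle, on which
`1, 2, …, n, -1, -2, …, -n` are read clockwise. -/
def pos (n : ℕ) : SignedIdx n ≃ Fin (2 * n) := finSumFinEquiv.trans (finCongr (two_mul n).symm)

theorem pos_inl {n : ℕ} (i : Fin n) : ((pos n (Sum.inl i) : Fin (2 * n)) : ℕ) = i := by
  simp [pos]

theorem pos_inr {n : ℕ} (i : Fin n) : ((pos n (Sum.inr i) : Fin (2 * n)) : ℕ) = n + i := by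
  simp [pos, add_comm]

theorem pos_neg {n : ℕ} (x : SignedIdx n) :
    ((pos n (neg x) : Fin (2 * n)) : ℕ) = ((pos n x : Fin (2 * n)) + n) % (2 * n) := by
  rcases x with i | i
  · have hi := i.2
    change ((pos n (Sum.inr i) : Fin (2 * n)) : ℕ) = _
    rw [pos_inl, pos_inr, Nat.mod_eq_of_lt (by omega)]; omega
  · have hi := i.2
    change ((pos n (Sum.inl i) : Fin (2 * n)) : ℕ) = _
    rw [pos_inl, pos_inr, show n + (i : ℕ) + n = i + 2 * n by omega, Nat.add_mod_right,
      Nat.mod_eq_of_lt (by omega)]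

/-- The number of clockwise steps from `a` to `b` on the circle labelled by `±[n]`. -/
def clockwiseDist {n : ℕ} (a b : SignedIdx n) : ℕ := ((pos n b - pos n a : Fin (2 * n)) : ℕ)

/-- The signed coordinate `v_i`, `i ∈ ±[n]`, of a vector, with the convention `v_{-i} = -v_i`. -/
def coord {n : ℕ} (v : Fin n → ℂ) : SignedIdx n → ℂ := Sum.elim v (fun i => -v i)

theorem coord_add {n : ℕ} (u v : Fin n → ℂ) (i : SignedIdx n) :
    coord (u + v) i = coord u i + coord v i := by
  rcases i with i | i <;> simp [coord, add_comm]

theorem coord_smul {n : ℕ} (a : ℂ) (v : Fin n → ℂ) (i : SignedIdx n) :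
    coord (a • v) i = a * coord v i := by
  rcases i with i | i <;> simp [coord]

theorem coord_neg {n : ℕ} (v : Fin n → ℂ) (i : SignedIdx n) :
    coord v (neg i) = -coord v i := by
  rcases i with i | i <;> simp [coord, neg]

/-- The signed coordinate function `x_i`, `i ∈ ±[n]`, with the convention `x_{-i} = -x_i`. -/
noncomputable def var {n : ℕ} : SignedIdx n → MvPolynomial (Fin n) ℂ :=
  Sum.elim MvPolynomial.X (fun i => -MvPolynomial.X i)

theorem eval_var {n : ℕ} (v : Fin n → ℂ) (i : SignedIdx n) :
    MvPolynomial.eval v (var i) = coord v i := by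
  rcases i with i | i <;> simp [coord, var]

end SignedIdx

open SignedIdx in
/-- The hyperoctahedral group `W`: permutations `w` of `±[n]` with `w(-i) = -w(i)`. -/
def Hyperoct (n : ℕ) : Subgroup (Equiv.Perm (SignedIdx n)) where
  carrier := {w | ∀ i, w (neg i) = neg (w i)}
  mul_mem' := by
    intro a b ha hb i
    simp only [Set.mem_ofPred_eq] at ha hb
    simp [ha, hb]
  one_mem' := by intro i; simp
  inv_mem' := by
    intro a ha i
    simp only [Set.mem_ofPred_eq] at ha
    rw [Equiv.Perm.inv_eq_iff_eq, ha]
    simp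

namespace Hyperoct

open SignedIdx

variable {n : ℕ}

theorem apply_neg (w : Hyperoct n) (i : SignedIdx n) : w.1 (neg i) = neg (w.1 i) := w.2 i

theorem coord_apply (w : Hyperoct n) (v : Fin n → ℂ) (i : SignedIdx n) :
    coord (fun j => coord v (w.1 (Sum.inl j))) i = coord v (w.1 i) := by
  rcases i with i | i
  · rfl
  · change -coord v (w.1 (Sum.inl i)) = coord v (w.1 (neg (Sum.inl i)))
    rw [apply_neg, coord_neg]

/-- The reflection representation of `W` on `V = ℂⁿ`: `w` sends the standard basis vector `e_i`
to `e_{w(i)}`, where `e_{-i} = -e_i`; in coordinates, `(w v)_i = v_{w⁻¹(i)}`. -/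
def reflRep (n : ℕ) : Representation ℂ (Hyperoct n) (Fin n → ℂ) where
  toFun w :=
    { toFun := fun v i => coord v (w⁻¹.1 (Sum.inl i))
      map_add' := fun u v => funext fun i => coord_add u v _
      map_smul' := fun a v => funext fun i => coord_smul a v _ }
  map_one' := by
    ext v i; simp [coord]
  map_mul' := by
    intro a b
    refine LinearMap.ext fun v => funext fun i => ?_
    change coord v ((a * b)⁻¹.1 (Sum.inl i)) =
      coord (fun j => coord v (b⁻¹.1 (Sum.inl j))) (a⁻¹.1 (Sum.inl i))
    rw [coord_apply, mul_inv_rev]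
    rfl

/-- The reflections of `W`: `((i,j))` for `i ≠ ±j`, and `[i]`. -/
def IsRefl (t : Hyperoct n) : Prop :=
  (∃ i j : SignedIdx n, i ≠ j ∧ i ≠ neg j ∧
    t.1 = Equiv.swap i j * Equiv.swap (neg i) (neg j)) ∨
  (∃ i : SignedIdx n, t.1 = Equiv.swap i (neg i))

/-- Reflection length `ℓ_T`. -/
noncomputable def reflLength (w : Hyperoct n) : ℕ :=
  sInf {r | ∃ l : List (Hyperoct n), (∀ t ∈ l, IsRefl t) ∧ l.prod = w ∧ l.length = r}

/-- Absolute order `u ≤_T v`. -/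
def AbsLE (u v : Hyperoct n) : Prop := reflLength v = reflLength u + reflLength (u⁻¹ * v)

/-- The Coxeter element `c = [1, 2, …, n]`, that is
`1 ↦ 2 ↦ ⋯ ↦ n ↦ -1 ↦ -2 ↦ ⋯ ↦ -n ↦ 1`. -/
def coxeter (n : ℕ) : Hyperoct n where
  val := (pos n).symm.permCongr (finRotate (2 * n))
  property := by
    intro x
    have hn : 0 < n := by
      rcases x with i | i <;> exact i.pos
    have : NeZero (2 * n) := ⟨by omega⟩
    have key : ∀ y : Fin (2 * n), ((finRotate (2 * n) y : Fin (2 * n)) : ℕ) = (y + 1) % (2 * n) := by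
      intro y
      rw [finRotate_apply, Fin.val_add, Fin.val_one']
      simp
    apply (pos n).injective
    apply Fin.ext
    rw [pos_neg]
    simp only [Equiv.permCongr_apply, Equiv.symm_symm, Equiv.apply_symm_apply, key, pos_neg]
    simp only [Nat.mod_add_mod]
    congr 1
    omega

/-- The fixed space `V^w`. -/
def fixedSpace (w : Hyperoct n) : Submodule ℂ (Fin n → ℂ) :=
  LinearMap.eqLocus (reflRep n w) LinearMap.id

theorem mem_fixedSpace (w : Hyperoct n) (v : Fin n → ℂ) :
    v ∈ fixedSpace w ↔ reflRep n w v = v := Iff.rfl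

/-- The isotropy subgroup `W_X`. -/
def isotropy (X : Submodule ℂ (Fin n → ℂ)) : Subgroup (Hyperoct n) where
  carrier := {w | ∀ v ∈ X, reflRep n w v = v}
  mul_mem' := by
    intro a b ha hb v hv
    rw [map_mul, Module.End.mul_apply, hb v hv, ha v hv]
  one_mem' := by intro v _; simp
  inv_mem' := by
    intro a ha v hv
    conv_lhs => rw [← ha v hv]
    rw [← Module.End.mul_apply, ← map_mul]
    simp

/-! Elementary facts on reflection length, used to see that the cyclic action is defined. -/

theorem isRefl_conj (x t : Hyperoct n) (ht : IsRefl t) : IsRefl (x * t * x⁻¹) := by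
  have conj : ∀ a b : SignedIdx n,
      x.1 * Equiv.swap a b * x.1⁻¹ = Equiv.swap (x.1 a) (x.1 b) := fun a b => by
    rw [Equiv.mul_swap_eq_swap_mul, mul_inv_cancel_right]
  rcases ht with ⟨i, j, hij, hij', h⟩ | ⟨i, h⟩
  · refine Or.inl ⟨x.1 i, x.1 j, fun e => hij (x.1.injective e), fun e => hij' ?_, ?_⟩
    · rw [← apply_neg] at e; exact x.1.injective e
    · rw [← apply_neg, ← apply_neg, ← conj, ← conj]
      change x.1 * t.1 * x.1⁻¹ = _
      rw [h]; group
  · refine Or.inr ⟨x.1 i, ?_⟩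
    rw [← apply_neg, ← conj]
    change x.1 * t.1 * x.1⁻¹ = _
    rw [h]

theorem exists_refl_word (w : Hyperoct n) :
    ∃ l : List (Hyperoct n), (∀ t ∈ l, IsRefl t) ∧ l.prod = w := by
  classical
  suffices H : ∀ (m : ℕ) (w : Hyperoct n),
      (Finset.univ.filter fun i => w.1 i ≠ i).card ≤ m →
        ∃ l : List (Hyperoct n), (∀ t ∈ l, IsRefl t) ∧ l.prod = w from H _ w le_rfl
  intro m
  induction m with
  | zero =>
    intro w hw
    refine ⟨[], by simp, ?_⟩
    have h0 := Finset.card_eq_zero.mp (Nat.le_zero.mp hw)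
    refine Subtype.ext (Equiv.ext fun i => ?_)
    by_contra hi
    have : i ∈ Finset.univ.filter fun i => w.1 i ≠ i := by
      simp only [Finset.mem_filter, Finset.mem_univ, true_and]
      exact fun e => hi e.symm
    rw [h0] at this
    simp at this
  | succ m ih =>
    intro w hw
    by_cases h1 : ∃ i, w.1 i ≠ i
    swap
    · push Not at h1
      exact ⟨[], by simp, Subtype.ext (Equiv.ext fun i => (h1 i).symm)⟩
    obtain ⟨i, hi⟩ := h1
    -- a reflection exchanging `i` and `w i`, and fixing what `w` fixes
    obtain ⟨t, ht, htt, hti, htf⟩ : ∃ t : Hyperoct n, IsRefl t ∧ t * t = 1 ∧ t.1 (w.1 i) = i ∧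
        ∀ j, w.1 j = j → t.1 j = j := by
      have hfix : ∀ j, w.1 j = j → j ≠ i ∧ j ≠ w.1 i ∧ j ≠ neg i ∧ j ≠ neg (w.1 i) := by
        intro j hj
        refine ⟨?_, ?_, ?_, ?_⟩
        · rintro rfl; exact hi hj
        · rintro rfl; exact hi (w.1.injective hj)
        · rintro rfl
          rw [apply_neg] at hj
          exact hi (by simpa using congrArg neg hj)
        · rintro rfl
          rw [apply_neg] at hj
          exact hi (w.1.injective (by simpa using congrArg neg hj))
      have neg_ne : ∀ a : SignedIdx n, a ≠ neg a := by
        rintro (a | a) <;> simp [neg]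
      by_cases hn : w.1 i = neg i
      · refine ⟨⟨Equiv.swap i (neg i), fun a => ?_⟩, Or.inr ⟨i, rfl⟩, ?_, ?_, ?_⟩
        · by_cases h : a = i
          · subst h; simp
          by_cases h' : a = neg i
          · subst h'; simp
          rw [Equiv.swap_apply_of_ne_of_ne h h', Equiv.swap_apply_of_ne_of_ne]
          · intro e; exact h' (by rw [← e, SignedIdx.neg_neg])
          · intro e; exact h (by simpa using congrArg neg e)
        · exact Subtype.ext (Equiv.swap_mul_self _ _)
        · change Equiv.swap i (neg i) (w.1 i) = i
          rw [hn, Equiv.swap_apply_right]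
        · intro j hj
          exact Equiv.swap_apply_of_ne_of_ne (hfix j hj).1 (hfix j hj).2.2.1
      · have hd : ∀ a : SignedIdx n,
            (Equiv.swap i (w.1 i) * Equiv.swap (neg i) (neg (w.1 i))) a =
              if a = i then w.1 i else if a = w.1 i then i else
              if a = neg i then neg (w.1 i) else if a = neg (w.1 i) then neg i else a := by
          intro a
          have e1 := neg_ne i
          have e2 := neg_ne (w.1 i)
          have e3 : neg (w.1 i) ≠ i := fun e => hn (by rw [← SignedIdx.neg_neg (w.1 i), e])
          have e4 : neg i ≠ neg (w.1 i) := fun e => hi (by simpa using (congrArg neg e).symm)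
          simp only [Equiv.Perm.mul_apply, Equiv.swap_apply_def]
          grind
        refine ⟨⟨Equiv.swap i (w.1 i) * Equiv.swap (neg i) (neg (w.1 i)), fun a => ?_⟩,
          Or.inl ⟨i, w.1 i, hi.symm, fun e => hn (by rw [← SignedIdx.neg_neg (w.1 i), ← e]), rfl⟩, ?_, ?_, ?_⟩
        · have e1 := neg_ne i
          have e2 := neg_ne (w.1 i)
          have e3 := SignedIdx.neg_neg i
          have e4 := SignedIdx.neg_neg (w.1 i)
          have e5 := SignedIdx.neg_neg a
          rw [hd, hd]
          generalize w.1 i = b at *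
          clear hd ih
          grind (splits := 30)
        · refine Subtype.ext (Equiv.ext fun a => ?_)
          change (Equiv.swap i (w.1 i) * Equiv.swap (neg i) (neg (w.1 i)))
            ((Equiv.swap i (w.1 i) * Equiv.swap (neg i) (neg (w.1 i))) a) = a
          have e1 := neg_ne i
          have e2 := neg_ne (w.1 i)
          have e3 := SignedIdx.neg_neg i
          have e4 := SignedIdx.neg_neg (w.1 i)
          rw [hd, hd]
          grind
        · change (Equiv.swap i (w.1 i) * Equiv.swap (neg i) (neg (w.1 i))) (w.1 i) = i
          rw [hd]
          grind
        · intro j hj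
          have := hfix j hj
          change (Equiv.swap i (w.1 i) * Equiv.swap (neg i) (neg (w.1 i))) j = j
          rw [hd]
          grind
    obtain ⟨l, hl, hlp⟩ := ih (t * w) (by
      refine Nat.le_of_lt_succ (lt_of_lt_of_le (Finset.card_lt_card ?_) hw)
      rw [Finset.ssubset_iff_of_subset]
      · refine ⟨i, by simpa using hi, ?_⟩
        simp only [Finset.mem_filter, Finset.mem_univ, true_and, not_not]
        exact hti
      · intro j
        simp only [Finset.mem_filter, Finset.mem_univ, true_and]
        intro hj hwj
        refine hj ?_
        change t.1 (w.1 j) = j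
        rw [hwj]; exact htf j hwj)
    refine ⟨t :: l, ?_, ?_⟩
    · intro s hs
      rcases List.mem_cons.mp hs with rfl | hs
      · exact ht
      · exact hl s hs
    · rw [List.prod_cons, hlp, ← mul_assoc, htt, one_mul]

theorem exists_reduced_word (w : Hyperoct n) :
    ∃ l : List (Hyperoct n), (∀ t ∈ l, IsRefl t) ∧ l.prod = w ∧ l.length = reflLength w := by
  obtain ⟨l, hl, hp⟩ := exists_refl_word w
  exact Nat.sInf_mem (s := {r | ∃ l : List (Hyperoct n),
    (∀ t ∈ l, IsRefl t) ∧ l.prod = w ∧ l.length = r}) ⟨_, l, hl, hp, rfl⟩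

theorem reflLength_le (l : List (Hyperoct n)) (hl : ∀ t ∈ l, IsRefl t) :
    reflLength l.prod ≤ l.length := Nat.sInf_le ⟨l, hl, rfl, rfl⟩

theorem reflLength_one : reflLength (1 : Hyperoct n) = 0 :=
  Nat.le_zero.mp (reflLength_le ([] : List (Hyperoct n)) (by simp))

theorem reflLength_mul_le (a b : Hyperoct n) :
    reflLength (a * b) ≤ reflLength a + reflLength b := by
  obtain ⟨l, hl, hp, hc⟩ := exists_reduced_word a
  obtain ⟨l', hl', hp', hc'⟩ := exists_reduced_word b
  rw [← hc, ← hc', ← List.length_append, ← hp, ← hp', ← List.prod_append]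
  refine reflLength_le _ fun t ht => ?_
  rcases List.mem_append.mp ht with h | h
  · exact hl t h
  · exact hl' t h

theorem reflLength_conj_le (x a : Hyperoct n) : reflLength (x * a * x⁻¹) ≤ reflLength a := by
  obtain ⟨l, hl, hp, hc⟩ := exists_reduced_word a
  have h : (l.map fun t => x * t * x⁻¹).prod = x * a * x⁻¹ := by
    rw [← hp]
    exact (map_list_prod (MulAut.conj x) l).symm
  rw [← h, ← hc, ← List.length_map (f := fun t => x * t * x⁻¹)]
  refine reflLength_le _ fun t ht => ?_
  obtain ⟨s, hs, rfl⟩ := List.mem_map.mp ht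
  exact isRefl_conj x s (hl s hs)

theorem reflLength_conj (x a : Hyperoct n) : reflLength (x * a * x⁻¹) = reflLength a := by
  refine le_antisymm (reflLength_conj_le x a) ?_
  have h := reflLength_conj_le x⁻¹ (x * a * x⁻¹)
  rwa [show x⁻¹ * (x * a * x⁻¹) * x⁻¹⁻¹ = a by group] at h

theorem reflLength_prod_le (l : List (Hyperoct n)) :
    reflLength l.prod ≤ (l.map reflLength).sum := by
  induction l with
  | nil => simp [reflLength_one]
  | cons a l ih =>
    rw [List.prod_cons, List.map_cons, List.sum_cons]
    exact (reflLength_mul_le _ _).trans (Nat.add_le_add_left ih _)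

end Hyperoct

/-! ### Noncrossing multichains, additive factorizations and the cyclic action -/

namespace Hyperoct

/-- `NC^k(W)`: the `k`-multichains `u_1 ≤_T ⋯ ≤_T u_k` in `NC(W) = [1, c]_T`. -/
def NCChain (n k : ℕ) : Type :=
  {u : Fin k → Hyperoct n //
    (∀ i, AbsLE (u i) (coxeter n)) ∧ ∀ i j, i ≤ j → AbsLE (u i) (u j)}

/-- `NC_k(W)`: the `ℓ_T`-additive factorizations `(w_0, w_1, …, w_k)` of `c`. -/
def NCFact (n k : ℕ) : Type :=
  {l : List (Hyperoct n) // l.length = k + 1 ∧ l.prod = coxeter n ∧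
    (l.map reflLength).sum = reflLength (coxeter n)}

variable {n k : ℕ}

/-- The successive quotients `(a⁻¹ u_1, u_1⁻¹ u_2, …, u_k⁻¹ b)`. -/
def quotients (a : Hyperoct n) (u : List (Hyperoct n)) (b : Hyperoct n) : List (Hyperoct n) :=
  List.zipWith (fun x y => x⁻¹ * y) (a :: u) (u ++ [b])

theorem quotients_cons (a x : Hyperoct n) (u : List (Hyperoct n)) (b : Hyperoct n) :
    quotients a (x :: u) b = (a⁻¹ * x) :: quotients x u b := rfl

theorem quotients_ne_nil (a : Hyperoct n) (u : List (Hyperoct n)) (b : Hyperoct n) :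
    quotients a u b ≠ [] := by
  cases u <;> simp [quotients]

theorem length_quotients (a : Hyperoct n) (u : List (Hyperoct n)) (b : Hyperoct n) :
    (quotients a u b).length = u.length + 1 := by simp [quotients]

theorem prod_quotients (a : Hyperoct n) (u : List (Hyperoct n)) (b : Hyperoct n) :
    (quotients a u b).prod = a⁻¹ * b := by
  induction u generalizing a with
  | nil => simp [quotients]
  | cons x u ih => rw [quotients_cons, List.prod_cons, ih]; group

theorem sum_quotients (a : Hyperoct n) (u : List (Hyperoct n)) (b : Hyperoct n)
    (h : (a :: (u ++ [b])).Pairwise AbsLE) :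
    reflLength a + ((quotients a u b).map reflLength).sum = reflLength b := by
  induction u generalizing a with
  | nil =>
    have : AbsLE a b := by simpa using h
    simpa [quotients] using this.symm
  | cons x u ih =>
    have h1 : AbsLE a x := (List.pairwise_cons.mp h).1 x (by simp)
    have h2 := ih x (List.pairwise_cons.mp h).2
    rw [quotients_cons, List.map_cons, List.sum_cons, ← h2]
    unfold AbsLE at h1
    omega

theorem getLastD_quotients (a : Hyperoct n) (u : List (Hyperoct n)) (b d : Hyperoct n) :
    (quotients a u b).getLastD d = (u.getLastD a)⁻¹ * b := by
  induction u generalizing a d with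
  | nil => simp [quotients]
  | cons x u ih => rw [quotients_cons, List.getLastD_cons, ih, List.getLastD_cons]

theorem absLE_one (u : Hyperoct n) : AbsLE 1 u := by
  simp [AbsLE, reflLength_one]

theorem AbsLE.refl (u : Hyperoct n) : AbsLE u u := by
  simp [AbsLE, reflLength_one]

/-- The map `∂ : NC^k(W) → NC_k(W)`,
`(u_1 ≤ ⋯ ≤ u_k) ↦ (u_1, u_1⁻¹ u_2, …, u_{k-1}⁻¹ u_k, u_k⁻¹ c)`. -/
def boundary (u : NCChain n k) : NCFact n k :=
  ⟨quotients 1 (List.ofFn u.1) (coxeter n), by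
    refine ⟨by simp [length_quotients], by simp [prod_quotients], ?_⟩
    have h := sum_quotients 1 (List.ofFn u.1) (coxeter n) (by
      refine List.pairwise_cons.mpr ⟨fun x _ => absLE_one x, ?_⟩
      refine List.pairwise_append.mpr ⟨?_, by simp, ?_⟩
      · exact List.pairwise_ofFn.mpr fun i j hij => u.2.2 i j hij.le
      · intro x hx y hy
        obtain ⟨i, rfl⟩ := List.mem_ofFn.mp hx
        rw [List.mem_singleton.mp hy]
        exact u.2.1 i)
    simpa [reflLength_one] using h⟩

theorem absLE_partial (l₁ l₂ l₃ : List (Hyperoct n))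
    (h : ((l₁ ++ l₂ ++ l₃).map reflLength).sum = reflLength (l₁ ++ l₂ ++ l₃).prod) :
    AbsLE l₁.prod (l₁ ++ l₂).prod := by
  have e : l₁.prod⁻¹ * (l₁ ++ l₂).prod = l₂.prod := by simp
  unfold AbsLE
  rw [e]
  have a1 := reflLength_prod_le l₁
  have a2 := reflLength_prod_le l₂
  have a3 := reflLength_prod_le l₃
  have a4 := reflLength_mul_le (l₁ ++ l₂).prod l₃.prod
  have a5 := reflLength_mul_le l₁.prod l₂.prod
  rw [← List.prod_append] at a4 a5
  simp only [List.map_append, List.sum_append] at h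
  omega

/-- The map `∫ : NC_k(W) → NC^k(W)`,
`(w_0, w_1, …, w_k) ↦ (w_0 ≤ w_0 w_1 ≤ ⋯ ≤ w_0 w_1 ⋯ w_{k-1})`. -/
def integral (l : NCFact n k) : NCChain n k :=
  ⟨fun i => (l.1.take (i + 1)).prod, by
    have key : ∀ a b : ℕ, a ≤ b → AbsLE (l.1.take a).prod (l.1.take b).prod := by
      intro a b hab
      have e1 : l.1.take a ++ (l.1.take b).drop a = l.1.take b := by
        conv_rhs => rw [← List.take_append_drop a (l.1.take b)]
        rw [List.take_take, min_eq_left hab]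
      have h := absLE_partial (l.1.take a) ((l.1.take b).drop a) (l.1.drop b) (by
        rw [e1, List.take_append_drop, l.2.2.1, l.2.2.2])
      rwa [e1] at h
    refine ⟨fun i => ?_, fun i j hij => key _ _ (Nat.add_le_add_right hij 1)⟩
    have h := key (i + 1) (k + 1) (by omega)
    rwa [List.take_of_length_le l.2.1.le, l.2.2.1] at h⟩

/-- The list `(v, c w_k c⁻¹, w_1, w_2, …, w_{k-1})` with
`v = (c w_k c⁻¹) w_0 (c w_k c⁻¹)⁻¹`, obtained from `(w_0, w_1, …, w_k)`. -/
def rotList (l : List (Hyperoct n)) : List (Hyperoct n) :=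
  let y := coxeter n * l.getLastD 1 * (coxeter n)⁻¹
  (y * l.headD 1 * y⁻¹) :: y :: l.tail.dropLast

/-- The action of the distinguished generator `g` on `NC_k(W)`, for `k ≥ 1`. -/
def rotFact [NeZero k] (l : NCFact n k) : NCFact n k :=
  ⟨rotList l.1, by
    obtain ⟨l, hl, hp, hs⟩ := l
    have hk : 0 < k := Nat.pos_of_ne_zero (NeZero.ne k)
    obtain ⟨a, m, z, rfl⟩ : ∃ a m z, l = a :: (m ++ [z]) := by
      rcases l with _ | ⟨a, t⟩
      · simp at hl
      · have ht : t ≠ [] := by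
          rintro rfl
          simp at hl
          omega
        exact ⟨a, t.dropLast, t.getLast ht, by rw [List.dropLast_append_getLast]⟩
    have e : rotList (a :: (m ++ [z])) =
        (coxeter n * z * (coxeter n)⁻¹) * a * (coxeter n * z * (coxeter n)⁻¹)⁻¹ ::
          (coxeter n * z * (coxeter n)⁻¹) :: m := by
      have e' : (a :: (m ++ [z])).getLastD 1 = z := by
        rw [List.getLastD_cons, List.getLastD_concat]
      unfold rotList
      rw [e']
      simp
    dsimp only
    rw [e]
    refine ⟨by simpa using hl, ?_, ?_⟩
    · have h' : a * m.prod * z = coxeter n := by simpa [mul_assoc] using hp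
      have h'' : a * m.prod = coxeter n * z⁻¹ := by rw [← h']; group
      rw [List.prod_cons, List.prod_cons]
      calc _ = (coxeter n * z * (coxeter n)⁻¹) * (a * m.prod) := by group
        _ = coxeter n := by rw [h'']; group
    · simp only [List.map_cons, List.sum_cons, reflLength_conj]
      simp only [List.map_cons, List.sum_cons, List.map_append, List.sum_append, List.map_nil,
        List.sum_nil] at hs
      omega⟩

/-- The flats `V^{u_1} ⊇ ⋯ ⊇ V^{u_k}` of a multichain. -/
def flats (u : NCChain n k) (i : Fin k) : Submodule ℂ (Fin n → ℂ) := fixedSpace (u.1 i)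

/-- Noncrossing `k`-flats: the multichains of flats `(X_1 ≤ ⋯ ≤ X_k)` in the image of
`(u_1 ≤_T ⋯ ≤_T u_k) ↦ (V^{u_1} ≤ ⋯ ≤ V^{u_k})`, where flats are ordered by reverse
inclusion. -/
def NCFlat (n k : ℕ) : Type :=
  {X : Fin k → Submodule ℂ (Fin n → ℂ) // ∃ u : NCChain n k, X = flats u}

/-- The multichain of noncrossing group elements `u_i` with `X_i = V^{u_i}`. -/
noncomputable def NCFlat.elements (X : NCFlat n k) : NCChain n k := X.2.choose

theorem NCFlat.flats_elements (X : NCFlat n k) : X.1 = flats X.elements := X.2.choose_spec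

/-- The action of the distinguished generator `g` on noncrossing `k`-flats. -/
noncomputable def NCFlat.rot [NeZero k] (X : NCFlat n k) : NCFlat n k :=
  ⟨flats (integral (rotFact (boundary X.elements))), _, rfl⟩

/-- The index of the last term of a sequence indexed by `Fin k`. -/
def lastIdx (k : ℕ) [NeZero k] : Fin k := ⟨k - 1, Nat.sub_one_lt (NeZero.ne k)⟩

/-! ### The noncrossing parking space -/

/-- The equivalence of pairs `(w, X_1 ≤ ⋯ ≤ X_k)`: `(w, X) ∼ (w', X')` if and only if `X = X'`
and `w W_{X_1} = w' W_{X_1}`. -/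
def parkSetoid (n k : ℕ) [NeZero k] : Setoid (Hyperoct n × NCFlat n k) where
  r p q := p.2 = q.2 ∧ p.1⁻¹ * q.1 ∈ isotropy (p.2.1 0)
  iseqv :=
    { refl := fun p => ⟨rfl, by simp [one_mem]⟩
      symm := by
        rintro ⟨w, X⟩ ⟨w', X'⟩ ⟨rfl, h⟩
        exact ⟨rfl, by simpa using inv_mem h⟩
      trans := by
        rintro ⟨w, X⟩ ⟨w', X'⟩ ⟨w'', X''⟩ ⟨rfl, h⟩ ⟨rfl, h'⟩
        exact ⟨rfl, by simpa [mul_assoc] using mul_mem h h'⟩ }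

/-- The set `Park^NC_W(k)` of `k`-`W`-noncrossing parking functions. -/
def ParkNC (n k : ℕ) [NeZero k] : Type := Quotient (parkSetoid n k)

namespace ParkNC

variable [NeZero k]

/-- The class `[w, X_1 ≤ ⋯ ≤ X_k]`. -/
def mk (w : Hyperoct n) (X : NCFlat n k) : ParkNC n k := Quotient.mk (parkSetoid n k) (w, X)

/-- The action of `W`: `v.[w, X] = [v w, X]`. -/
def act (v : Hyperoct n) : ParkNC n k → ParkNC n k :=
  Quotient.map (fun p => (v * p.1, p.2)) (by
    rintro ⟨w, X⟩ ⟨w', X'⟩ ⟨rfl, h⟩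
    exact ⟨rfl, by simpa [mul_assoc] using h⟩)

theorem rot_isotropy (X : NCFlat n k) (x : Hyperoct n) (hx : x ∈ isotropy (X.1 0)) :
    (coxeter n * (X.elements.1 (lastIdx k))⁻¹) * x *
      (coxeter n * (X.elements.1 (lastIdx k))⁻¹)⁻¹ ∈ isotropy (X.rot.1 0) := by
  obtain ⟨m, rfl⟩ : ∃ m, k = m + 1 := ⟨k - 1, (Nat.succ_pred_eq_of_ne_zero (NeZero.ne k)).symm⟩
  set u := X.elements with hu
  set y := coxeter n * (u.1 (lastIdx (m + 1)))⁻¹ with hy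
  have hlast : (List.ofFn u.1).getLastD 1 = u.1 (lastIdx (m + 1)) := by
    rw [List.ofFn_succ', List.concat_eq_append, List.getLastD_concat]
    rfl
  have hX0 : X.1 0 = fixedSpace (u.1 0) := by rw [X.flats_elements]; rfl
  have hY0 : X.rot.1 0 = fixedSpace (y * u.1 0 * y⁻¹) := by
    change fixedSpace ((List.take 1 (rotList
      (quotients 1 (List.ofFn u.1) (coxeter n)))).prod) = _
    congr 1
    have h1 : (quotients 1 (List.ofFn u.1) (coxeter n)).headD 1 = u.1 0 := by
      rw [List.ofFn_succ, quotients_cons]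
      simp
    simp only [rotList, getLastD_quotients, hlast, h1, List.take_succ_cons, List.take_zero,
      List.prod_cons, List.prod_nil, mul_one]
    rw [show coxeter n * ((u.1 (lastIdx (m + 1)))⁻¹ * coxeter n) * (coxeter n)⁻¹ = y by
      rw [hy]; group]
  rw [hX0] at hx
  rw [hY0]
  intro v hv
  rw [mem_fixedSpace] at hv
  have hv' : reflRep n y⁻¹ v ∈ fixedSpace (u.1 0) := by
    rw [mem_fixedSpace]
    conv_rhs => rw [← hv]
    rw [← Module.End.mul_apply, ← Module.End.mul_apply, ← map_mul, ← map_mul]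
    congr 2
    group
  have h2 := hx _ hv'
  rw [map_mul, map_mul, Module.End.mul_apply, Module.End.mul_apply, h2, ← Module.End.mul_apply,
    ← map_mul]
  simp

/-- The action of the distinguished generator `g` of `ℤ_{kh}`:
`g.[w, X_1 ≤ ⋯ ≤ X_k] = [w u_k c⁻¹, g.(X_1 ≤ ⋯ ≤ X_k)]`, where `X_k = V^{u_k}`. -/
noncomputable def rot : ParkNC n k → ParkNC n k :=
  Quotient.map
    (fun p => (p.1 * p.2.elements.1 (lastIdx k) * (coxeter n)⁻¹, p.2.rot)) (by
    rintro ⟨w, X⟩ ⟨w', X'⟩ ⟨h, h'⟩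
    obtain rfl : X = X' := h
    refine ⟨rfl, ?_⟩
    have := rot_isotropy X _ h'
    convert this using 1
    dsimp only
    group)

end ParkNC

end Hyperoct

/-! ### Set partitions of the circle: `Ω`, `Π`, the boundary map, shuffles, Kreweras complement

Points on a circle with `N` marked points are numbered clockwise by `Fin N`. Set partitions are
equivalence relations. -/

namespace CirclePartition

open scoped Classical in
/-- The elements of the block of `a`, in increasing order. -/
noncomputable def blockList {N : ℕ} (π : Setoid (Fin N)) (a : Fin N) : List (Fin N) :=
  (Finset.univ.filter fun b => π a b).sort (· ≤ ·)

theorem mem_blockList {N : ℕ} (π : Setoid (Fin N)) (a b : Fin N) :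
    b ∈ blockList π a ↔ π a b := by
  classical
  simp [blockList]

theorem blockList_congr {N : ℕ} (π : Setoid (Fin N)) {a b : Fin N} (h : π a b) :
    blockList π a = blockList π b := by
  classical
  unfold blockList
  congr 1
  ext x
  simp only [Finset.mem_filter, Finset.mem_univ, true_and]
  exact ⟨fun hx => π.trans' (π.symm' h) hx, fun hx => π.trans' h hx⟩

/-- The permutation `Ω(π)` whose cycles are the blocks of `π`, read in clockwise order. -/
noncomputable def Omega {N : ℕ} (π : Setoid (Fin N)) : Equiv.Perm (Fin N) where
  toFun a := (blockList π a).formPerm a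
  invFun a := (blockList π a).formPerm⁻¹ a
  left_inv a := by
    have h : π a ((blockList π a).formPerm a) :=
      (mem_blockList π _ _).mp
        (List.formPerm_apply_mem_of_mem ((mem_blockList π _ _).mpr (π.refl' a)))
    dsimp only
    rw [← blockList_congr π h]
    exact Equiv.symm_apply_apply _ _
  right_inv a := by
    have h : π a ((blockList π a).formPerm⁻¹ a) := by
      refine (mem_blockList π _ _).mp (List.mem_of_formPerm_apply_mem ?_)
      have e : (blockList π a).formPerm ((blockList π a).formPerm⁻¹ a) = a :=
        Equiv.apply_symm_apply _ _
      rw [e]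
      exact (mem_blockList π _ _).mpr (π.refl' a)
    dsimp only
    rw [← blockList_congr π h]
    exact Equiv.apply_symm_apply _ _

/-- The partition `Π(w)` into the cycles of the permutation `w`. -/
def cycles {N : ℕ} (w : Equiv.Perm (Fin N)) : Setoid (Fin N) := Equiv.Perm.SameCycle.setoid w

/-- The boundary map `δ(w_1, …, w_k) = (w_1⁻¹ w_2, …, w_{k-1}⁻¹ w_k, w_k⁻¹ c)`, where
`c = (1, 2, …, N)`. -/
def delta {N k : ℕ} (w : Fin k → Equiv.Perm (Fin N)) (i : Fin k) : Equiv.Perm (Fin N) :=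
  (w i)⁻¹ * if h : (i : ℕ) + 1 < k then w ⟨i + 1, h⟩ else finRotate N

/-- The shuffle of partitions `π_1, …, π_k` of `[N]`: the partition of `[N k]` whose restriction
to `{i, i + k, …, i + (N - 1) k}` is order isomorphic to `π_i`, distinct such classes being
unrelated. In zero-based numbering the point `p` is `p.divNat * k + p.modNat`. -/
def shuffle {N k : ℕ} (π : Fin k → Setoid (Fin N)) : Setoid (Fin (N * k)) where
  r p q := p.modNat = q.modNat ∧ π p.modNat p.divNat q.divNat
  iseqv :=
    { refl := fun p => ⟨rfl, (π _).refl' _⟩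
      symm := fun {p q} h => ⟨h.1.symm, h.1 ▸ (π _).symm' h.2⟩
      trans := fun {p q r} h h' => ⟨h.1.trans h'.1, by
        have h2 := h'.2
        rw [← h.1] at h2
        exact (π _).trans' h.2 h2⟩ }

/-- Place points clockwise as `1', 1, 2', 2, …, M', M`. The Kreweras complement of `σ`: the
primed points `i'` and `j'` are in the same block if and only if the chord from `i'` to `j'`
separates no two points of a block of `σ`. -/
def kreweras {M : ℕ} (σ : Setoid (Fin M)) : Setoid (Fin M) where
  r i j := ∀ a b, σ a b → ((a < i ↔ a < j) ↔ (b < i ↔ b < j))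
  iseqv :=
    { refl := fun i a b _ => by tauto
      symm := fun {i j} h a b hab => by have := h a b hab; tauto
      trans := fun {i j l} h h' a b hab => by
        have h1 := h a b hab
        have h2 := h' a b hab
        tauto }

/-- With points placed clockwise as `1', 1, 2', 2, …, M', M`: no block of `τ` (on the primed
points) crosses a block of `σ` (on the unprimed points). -/
def NoCrossing {M : ℕ} (σ τ : Setoid (Fin M)) : Prop :=
  ∀ i j a b, τ i j → σ a b → ¬ (i ≤ a ∧ a < j ∧ (b < i ∨ j ≤ b))

/-- The Kreweras complement is the maximum, under refinement, of the partitions of the primed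
points whose blocks do not cross the blocks of `σ`. -/
theorem kreweras_isGreatest {M : ℕ} (σ : Setoid (Fin M)) :
    IsGreatest {τ | NoCrossing σ τ} (kreweras σ) := by
  constructor
  · intro i j a b h hab hc
    have h : ∀ a b, σ a b → ((a < i ↔ a < j) ↔ (b < i ↔ b < j)) := h
    have := h a b hab
    grind
  · intro τ hτ i j hij
    change ∀ a b, σ a b → ((a < i ↔ a < j) ↔ (b < i ↔ b < j))
    intro a b hab
    have h1 := hτ i j a b hij hab
    have h2 := hτ i j b a hij (σ.symm' hab)
    have h3 := hτ j i a b (τ.symm' hij) hab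
    have h4 := hτ j i b a (τ.symm' hij) (σ.symm' hab)
    grind

end CirclePartition

/-! ### The visualization `∇` and the map to `V` -/

namespace Hyperoct

open SignedIdx CirclePartition

variable {n k : ℕ}

/-- The partition of `±[n]` defined by a subspace `X` of `V`: `i ∼ j` if and only if the
coordinate equality `x_i = x_j` holds on `X`. -/
def flatPartition (X : Submodule ℂ (Fin n → ℂ)) : Setoid (SignedIdx n) where
  r i j := ∀ v ∈ X, coord v i = coord v j
  iseqv :=
    { refl := fun _ _ _ => rfl
      symm := fun h v hv => (h v hv).symm
      trans := fun h h' v hv => (h v hv).trans (h' v hv) }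

/-- The partition `∇(X_1, …, X_k) = K ∘ shuffle ∘ Π ∘ δ ∘ Ω` of `±[kn]`, where `±[n]` is
identified with `[2n]` and `±[kn]` with `[2kn]` through clockwise positions. -/
noncomputable def nabla (X : NCFlat n k) : Setoid (SignedIdx (n * k)) :=
  Setoid.comap ((pos (n * k)).trans (finCongr (mul_assoc 2 n k).symm))
    (kreweras (shuffle fun i => cycles (delta
      (fun j => Omega (Setoid.comap (pos n).symm (flatPartition (X.1 j)))) i)))

/-- The vertex of `±[kn]` corresponding to an element of `±[n]`:
`±i ↦ ±((i - 1) k + 1)`. -/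
def vertex [NeZero k] : SignedIdx n → SignedIdx (n * k) :=
  let f : Fin n → Fin (n * k) := fun i =>
    ⟨i * k, Nat.mul_lt_mul_of_pos_right i.2 (Nat.pos_of_ne_zero (NeZero.ne k))⟩
  Sum.map f f

/-- The label `f(B) = w(B')` of a set `B` of vertices in `±[kn]`, where
`B' ⊆ ±[n]` corresponds to the vertices `±((i - 1) k + 1)` in `B`. -/
def label [NeZero k] (w : Hyperoct n) (B : Set (SignedIdx (n * k))) : Set (SignedIdx n) :=
  w.1 '' (vertex ⁻¹' B)

/-- `j` opens the block `B`: reading clockwise from `j ∈ B`, all of `B` is met before any element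
of `-B`. (For a nonzero block of a centrally symmetric noncrossing partition, `j` is the element
just to the right of the left parenthesis of `B` in the periodic parenthesization.) -/
def Opens {m : ℕ} (j : SignedIdx m) (B : Set (SignedIdx m)) : Prop :=
  j ∈ B ∧ ∀ b ∈ B, ∀ b' ∈ B, clockwiseDist j b < clockwiseDist j (neg b')

/-- The rule assigning the coordinate `v_i` to a labelled partition `(π, f)`: the value is `0` if
`i ∈ f(Z)` for the zero block `Z`, it is `ω^j` if `i ∈ f(B)` for a nonzero block `B` opened by
`+j`, and `-ω^j` if `i ∈ f(B)` for a nonzero block `B` opened by `-j`. -/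
def CoordRule {m : ℕ} (ω : ℂ) (π : Setoid (SignedIdx m))
    (f : Set (SignedIdx m) → Set (SignedIdx n)) (i : Fin n) (z : ℂ) : Prop :=
  (∃ Z ∈ π.classes, neg '' Z = Z ∧ Sum.inl i ∈ f Z ∧ z = 0) ∨
  (∃ B ∈ π.classes, neg '' B ≠ B ∧ Sum.inl i ∈ f B ∧
    ∃ j : Fin m, Opens (Sum.inl j) B ∧ z = ω ^ ((j : ℕ) + 1)) ∨
  (∃ B ∈ π.classes, neg '' B ≠ B ∧ Sum.inl i ∈ f B ∧
    ∃ j : Fin m, Opens (Sum.inr j) B ∧ z = -ω ^ ((j : ℕ) + 1))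

end Hyperoct

/-! ### Systems of parameters and the algebraic parking space -/

namespace AlgPark

open SignedIdx MvPolynomial

variable {n k : ℕ}

/-- The action of `W` on `ℂ[V]`, `(w.f)(v) = f(w⁻¹ v)`, that is `x_i ↦ x_{w(i)}`. -/
noncomputable def polyAct (w : Hyperoct n) :
    MvPolynomial (Fin n) ℂ →ₐ[ℂ] MvPolynomial (Fin n) ℂ :=
  aeval fun i => var (w.1 (Sum.inl i))

theorem eval_polyAct (w : Hyperoct n) (f : MvPolynomial (Fin n) ℂ) (v : Fin n → ℂ) :
    eval v (polyAct w f) = eval (Hyperoct.reflRep n w⁻¹ v) f := by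
  induction f using MvPolynomial.induction_on with
  | C a => simp [polyAct]
  | add p q hp hq => simp [hp, hq]
  | mul_X p i hp =>
    rw [map_mul, map_mul, map_mul, hp]
    congr 1
    simp only [polyAct, aeval_X, eval_var, eval_X]
    change _ = coord v (w⁻¹⁻¹.1 (Sum.inl i))
    rw [inv_inv]

/-- The algebra map of `ℂ[V]` scaling by `a ^ d` in degree `d`. -/
noncomputable def scale (n : ℕ) (a : ℂ) : MvPolynomial (Fin n) ℂ →ₐ[ℂ] MvPolynomial (Fin n) ℂ :=
  aeval fun i => C a * X i

theorem scale_of_isHomogeneous (a : ℂ) (d : ℕ) (f : MvPolynomial (Fin n) ℂ)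
    (hf : f.IsHomogeneous d) : scale n a f = C (a ^ d) * f := by
  conv_lhs => rw [f.as_sum]
  conv_rhs => rw [f.as_sum]
  rw [map_sum, Finset.mul_sum]
  refine Finset.sum_congr rfl fun s hs => ?_
  have hd : s.degree = d := by
    by_contra h
    exact mem_support_iff.mp hs (hf.coeff_eq_zero h)
  rw [scale, aeval_monomial, monomial_eq, ← hd]
  simp only [mul_pow, Finsupp.prod, Finset.prod_mul_distrib, Finset.prod_pow_eq_pow_sum,
    Finsupp.degree_apply, map_pow, algebraMap_eq]
  ring

/-- `θ_1, …, θ_n` is a homogeneous system of parameters of degree `d`: the `θ_i` are homogeneous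
of degree `d` and their only common zero is the origin. -/
def IsHSOP (d : ℕ) (θ : Fin n → MvPolynomial (Fin n) ℂ) : Prop :=
  (∀ i, (θ i).IsHomogeneous d) ∧ {v : Fin n → ℂ | ∀ i, eval v (θ i) = 0} = {0}

/-- `θ_1, …, θ_n` carries `V^*` compatibly with the coordinate basis `x_1, …, x_n` of `V^*`:
the span of the `θ_i` is `W`-stable and `x_i ↦ θ_i` induces a `W`-equivariant linear isomorphism
from `V^*` (the linear forms) onto it. -/
def CarriesDual (θ : Fin n → MvPolynomial (Fin n) ℂ) : Prop :=
  (∀ (w : Hyperoct n), ∀ p ∈ Submodule.span ℂ (Set.range θ),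
    polyAct w p ∈ Submodule.span ℂ (Set.range θ)) ∧
  ∃ L : homogeneousSubmodule (Fin n) ℂ 1 ≃ₗ[ℂ] Submodule.span ℂ (Set.range θ),
    (∀ i, (L ⟨X i, isHomogeneous_X ℂ i⟩ : MvPolynomial (Fin n) ℂ) = θ i) ∧
    ∀ (w : Hyperoct n) (p q : homogeneousSubmodule (Fin n) ℂ 1),
      (q : MvPolynomial (Fin n) ℂ) = polyAct w p →
        (L q : MvPolynomial (Fin n) ℂ) = polyAct w (L p)

/-- The ideal `(Θ - x)` generated by `θ_1 - x_1, …, θ_n - x_n`. -/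
noncomputable def deformIdeal (θ : Fin n → MvPolynomial (Fin n) ℂ) : Ideal (MvPolynomial (Fin n) ℂ) :=
  Ideal.span (Set.range fun i => θ i - X i)

/-- The locus `V^Θ ⊆ V` cut out by `(Θ - x)`. -/
def locus (θ : Fin n → MvPolynomial (Fin n) ℂ) : Set (Fin n → ℂ) :=
  {v | ∀ f ∈ deformIdeal θ, eval v f = 0}

theorem mem_locus (θ : Fin n → MvPolynomial (Fin n) ℂ) (v : Fin n → ℂ) :
    v ∈ locus θ ↔ ∀ i, eval v (θ i) = v i := by
  constructor
  · intro h i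
    have := h _ (Ideal.subset_span ⟨i, rfl⟩)
    simpa [sub_eq_zero] using this
  · intro h
    change deformIdeal θ ≤ RingHom.ker (eval v)
    refine Ideal.span_le.mpr ?_
    rintro _ ⟨i, rfl⟩
    simp [RingHom.mem_ker, h i]

/-- The maximal ideal `𝔪_v` of polynomials vanishing at `v`. -/
noncomputable def pointIdeal (v : Fin n → ℂ) : Ideal (MvPolynomial (Fin n) ℂ) :=
  RingHom.ker (eval v)

instance (v : Fin n → ℂ) : (pointIdeal v).IsPrime := RingHom.ker_isPrime _

/-- The `𝔪_v`-primary component of `I`, for `v` an isolated point of the variety of `I`: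
the contraction of the extension of `I` to the localization at `𝔪_v`. -/
noncomputable def primaryComponent (I : Ideal (MvPolynomial (Fin n) ℂ)) (v : Fin n → ℂ) :
    Ideal (MvPolynomial (Fin n) ℂ) :=
  (I.map (algebraMap _ (Localization.AtPrime (pointIdeal v)))).comap
    (algebraMap _ (Localization.AtPrime (pointIdeal v)))

/-- The multiplicity of the point `v` in the variety of `I`. -/
noncomputable def multiplicity (I : Ideal (MvPolynomial (Fin n) ℂ)) (v : Fin n → ℂ) : ℕ :=
  Module.finrank ℂ (MvPolynomial (Fin n) ℂ ⧸ primaryComponent I v)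

/-- The system `θ_i = x_i^{2nk+1}`. -/
noncomputable def powerTheta (n k : ℕ) (i : Fin n) : MvPolynomial (Fin n) ℂ :=
  X i ^ (2 * n * k + 1)

/-- The group `W × ℤ_{kh}`, where `h = 2n`; the distinguished generator of `ℤ_{kh}` is
`Multiplicative.ofAdd 1`. -/
abbrev SymGroup (n k : ℕ) : Type := Hyperoct n × Multiplicative (ZMod (2 * n * k))

/-- The exponent `d ∈ {0, …, kh - 1}` of an element `g^d` of `ℤ_{kh}`. -/
def expo (γ : SymGroup n k) : ℕ := (Multiplicative.toAdd γ.2).val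

/-- The action of `(w, g^d)` on `V`: `v ↦ ω^d (w v)`. -/
noncomputable def vecAct (ω : ℂ) (γ : SymGroup n k) (v : Fin n → ℂ) : Fin n → ℂ :=
  ω ^ expo γ • Hyperoct.reflRep n γ.1 v

theorem eval_powerTheta_coord (v : Fin n → ℂ) (hv : v ∈ locus (powerTheta n k))
    (i : SignedIdx n) : coord v i ^ (2 * n * k + 1) = coord v i := by
  have h : ∀ i, v i ^ (2 * n * k + 1) = v i := by simpa [mem_locus, powerTheta] using hv
  rcases i with i | i
  · exact h i
  · change (-v i) ^ (2 * n * k + 1) = -v i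
    rw [Odd.neg_pow ⟨n * k, by ring⟩, h i]

/-- The action of `W × ℤ_{kh}` on `V^Θ`, for `θ_i = x_i^{2nk+1}` and `ω` a `kh`-th root of
unity. -/
noncomputable def locusAct {ω : ℂ} (hω : IsPrimitiveRoot ω (2 * n * k)) (γ : SymGroup n k) :
    locus (powerTheta n k) → locus (powerTheta n k) := fun v =>
  ⟨vecAct ω γ v.1, by
    rw [mem_locus]
    intro i
    have h := eval_powerTheta_coord v.1 v.2 (γ.1⁻¹.1 (Sum.inl i))
    have h1 : vecAct ω γ v.1 i = ω ^ expo γ * coord v.1 (γ.1⁻¹.1 (Sum.inl i)) := rfl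
    have h2 : (ω ^ expo γ) ^ (2 * n * k + 1) = ω ^ expo γ := by
      rw [pow_succ, ← pow_mul, mul_comm (expo γ), pow_mul, hω.pow_eq_one, one_pow, one_mul]
    rw [powerTheta, map_pow, eval_X, h1, mul_pow, h, h2]⟩

/-- The algebraic parking space `Park^alg_W(k) = ℂ[V] / (Θ - x)`. -/
abbrev ParkAlg (θ : Fin n → MvPolynomial (Fin n) ℂ) : Type :=
  MvPolynomial (Fin n) ℂ ⧸ deformIdeal θ

theorem deformIdeal_le_comap {ω : ℂ} (hω : IsPrimitiveRoot ω (2 * n * k)) (γ : SymGroup n k) :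
    deformIdeal (powerTheta n k) ≤ (deformIdeal (powerTheta n k)).comap
      ((scale n (ω ^ expo γ)).comp (polyAct γ.1)) := by
  have key : ∀ j : SignedIdx n, (var j ^ (2 * n * k + 1) - var j : MvPolynomial (Fin n) ℂ) ∈
      deformIdeal (powerTheta n k) := by
    rintro (j | j)
    · exact Ideal.subset_span ⟨j, rfl⟩
    · change (-X j) ^ (2 * n * k + 1) - -X j ∈ _
      rw [Odd.neg_pow ⟨n * k, by ring⟩]
      have h : (X j ^ (2 * n * k + 1) - X j : MvPolynomial (Fin n) ℂ) ∈
        deformIdeal (powerTheta n k) := Ideal.subset_span ⟨j, rfl⟩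
      have := neg_mem h
      convert this using 1
      ring
  have hs : ∀ j : SignedIdx n, scale n (ω ^ expo γ) (var j) = C (ω ^ expo γ) * var j := by
    rintro (j | j) <;> simp [scale, var]
  have h2 : (ω ^ expo γ) ^ (2 * n * k + 1) = ω ^ expo γ := by
    rw [pow_succ, ← pow_mul, mul_comm (expo γ), pow_mul, hω.pow_eq_one, one_pow, one_mul]
  have h3 : (C (ω ^ expo γ) : MvPolynomial (Fin n) ℂ) ^ (2 * n * k + 1) = C (ω ^ expo γ) := by
    rw [← map_pow C, h2]
  refine Ideal.span_le.mpr ?_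
  rintro _ ⟨i, rfl⟩
  have e : (scale n (ω ^ expo γ)).comp (polyAct γ.1) (powerTheta n k i - X i) =
      C (ω ^ expo γ) *
        (var (γ.1.1 (Sum.inl i)) ^ (2 * n * k + 1) - var (γ.1.1 (Sum.inl i))) := by
    simp only [powerTheta, polyAct, AlgHom.comp_apply, map_sub, map_pow, aeval_X, hs, mul_pow]
    simp only [map_pow] at h3
    rw [h3]
    ring
  rw [SetLike.mem_coe, Ideal.mem_comap, e]
  exact Ideal.mul_mem_left _ _ (key _)

/-- The action of `W × ℤ_{kh}` on `Park^alg_W(k)`, for `θ_i = x_i^{2nk+1}`: `W` acts by linear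
substitutions and the distinguished generator scales by `ω^d` in degree `d`. -/
noncomputable def parkAlgAct {ω : ℂ} (hω : IsPrimitiveRoot ω (2 * n * k)) (γ : SymGroup n k) :
    ParkAlg (powerTheta n k) →ₐ[ℂ] ParkAlg (powerTheta n k) :=
  Ideal.quotientMapₐ _ ((scale n (ω ^ expo γ)).comp (polyAct γ.1)) (deformIdeal_le_comap hω γ)

end AlgPark

/-! ### Clockwise distances on the circle -/

namespace CirclePartition

open Equiv

variable {M : ℕ}

/-! The class `[w, X]` goes to `w` applied to a single vector attached to `X`, so everything rests
on the permutation whose cycles are the blocks of `∇(X)`.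

Such permutations are controlled by winding. The arcs from `p` to `f p` add up, over a cycle, to a
positive multiple of the circumference. If `P * S` is the rotation by one step, the arcs of `S` and
`P` add up to `M (M + 1)`, whence the genus inequality `numCycles S + numCycles P ≤ M + 1`. Equality
forces every cycle to wind once, and then `P` and `S` are noncrossing and Kreweras complementary
(`kreweras_cycles`). A reflection changes the number of cycles by at most two, so both `u ≤_T c` and
the shuffle of the factors `w_1, …, w_k` meet the bound up to one; parity removes this defect
(`isClockwise_of_le_numCycles`). Hence the blocks of `∇(X)` are the cycles of `nablaPerm`. Each
point of `±[kn]` has a root in `±[n]`, and these blocks are the preimages of the cycles of `u_1`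
(`sameCycle_nablaPerm_iff`).

Injectivity: up to `W`, the coordinates of the vector tell how large a block each point opens. These
sizes determine a centrally symmetric noncrossing partition (`eq_of_openSize_eq`), hence
`nablaPerm`, hence the multichain; and the stabiliser of the vector fixes `V^{u_1}` pointwise.

Surjectivity: induction on the number of nonzero coordinates. A cycle lemma (`exists_record`) finds
a point `p` opening a block such that the blocks opened before `p` never suffice to cover an arc
ending at `p`. After a rotation `p` is a vertex. Erasing the coordinates `±ω^(p+1)` leaves a vector
whose parking function has `p` in its zero block, and multiplying the whole multichain by a
reflection splits a block of the right size, opened by `p`, off that zero block (`exists_split`).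

Equivariance: `g` conjugates `nablaPerm` by the rotation, which multiplies all values by `ω`. The
action on parking functions is transported from `V^Θ` through the bijection, so its relations come
for free.

On the algebraic side, `x^(M+1) - x` has simple roots, so `V^Θ` is a grid of reduced points. The
combinatorial Nullstellensatz and Lagrange interpolation identify `ℂ[V]/(Θ - x)` with the functions
on the grid; complex conjugation reconciles the directions in which `g` acts on the two sides. -/

/-- The number of clockwise steps from `p` to `q` on a circle with `M` points. -/
def cdist (p q : Fin M) : ℕ := if (p : ℕ) ≤ q then q - p else M + q - p

theorem cdist_lt (p q : Fin M) : cdist p q < M := by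
  have := p.2; have := q.2
  unfold cdist; split_ifs <;> omega

theorem cdist_self (p : Fin M) : cdist p p = 0 := by simp [cdist]

theorem cdist_left_injective (p : Fin M) : Function.Injective (cdist p) := by
  intro x y h
  have := p.2; have := x.2; have := y.2
  unfold cdist at h
  apply Fin.ext
  split_ifs at h <;> omega

theorem cdist_eq_zero {p q : Fin M} : cdist p q = 0 ↔ p = q := by
  constructor
  · intro h
    exact cdist_left_injective p (by rw [h, cdist_self])
  · rintro rfl; exact cdist_self p

theorem val_finRotate (p : Fin M) :
    ((finRotate M p : Fin M) : ℕ) = if (p : ℕ) + 1 = M then 0 else (p : ℕ) + 1 := by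
  obtain ⟨m, rfl⟩ : ∃ m, M = m + 1 := ⟨M - 1, by have := p.2; omega⟩
  rw [coe_finRotate]
  by_cases h : p = Fin.last m
  · simp [h]
  · have : (p : ℕ) ≠ m := fun e => h (Fin.ext e)
    simp [h, this]

theorem cdist_finRotate_finRotate (p q : Fin M) :
    cdist (finRotate M p) (finRotate M q) = cdist p q := by
  have := p.2; have := q.2
  simp only [cdist, val_finRotate]
  split_ifs <;> omega

theorem cdist_finRotate_add (p q : Fin M) : cdist (finRotate M p) q + cdist q p + 1 = M := by
  have := p.2; have := q.2
  simp only [cdist, val_finRotate]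
  split_ifs <;> omega

theorem cdist_finRotate_left {p q : Fin M} (h : p ≠ q) :
    cdist (finRotate M p) q + 1 = cdist p q := by
  have := p.2; have := q.2
  have : (p : ℕ) ≠ q := fun e => h (Fin.ext e)
  simp only [cdist, val_finRotate]
  split_ifs <;> omega

theorem perm_inv_apply_self {α : Type*} (f : Perm α) (x : α) : f⁻¹ (f x) = x :=
  f.symm_apply_apply x

theorem perm_apply_inv_self {α : Type*} (f : Perm α) (x : α) : f (f⁻¹ x) = x :=
  f.apply_symm_apply x

/-! ### Counting gaps -/

open scoped Classical in
/-- The points whose last predecessor (weakly, clockwise) in the class of `p` is `p`. -/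
noncomputable def gap (r : Setoid (Fin M)) (p : Fin M) : Finset (Fin M) :=
  Finset.univ.filter fun z => ∀ q, r p q → cdist p z ≤ cdist q z

theorem mem_gap {r : Setoid (Fin M)} {p z : Fin M} :
    z ∈ gap r p ↔ ∀ q, r p q → cdist p z ≤ cdist q z := by
  classical
  simp [gap]

theorem cdist_right_injective (z : Fin M) : Function.Injective fun p => cdist p z := by
  intro x y h
  have := z.2; have := x.2; have := y.2
  simp only [cdist] at h
  apply Fin.ext
  split_ifs at h <;> omega

/-- Double counting: for each point `z`, every class has exactly one member from which the clockwise
distance to `z` is least. -/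
theorem sum_card_gap (r : Setoid (Fin M)) :
    ∑ p, (gap r p).card = M * Nat.card (Quotient r) := by
  classical
  have h1 : ∑ p, (gap r p).card = ∑ z : Fin M, (Finset.univ.filter fun p => z ∈ gap r p).card := by
    simp only [Finset.card_eq_sum_ones, Finset.sum_filter]
    rw [Finset.sum_comm]
    refine Finset.sum_congr rfl fun p _ => ?_
    simp
  have h2 : ∀ z : Fin M, (Finset.univ.filter fun p => z ∈ gap r p).card = Nat.card (Quotient r) := by
    intro z
    rw [← Fintype.card_coe, ← Nat.card_eq_fintype_card]
    refine Nat.card_congr (Equiv.ofBijective (fun p => Quotient.mk r p.1) ⟨?_, ?_⟩)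
    · rintro ⟨p, hp⟩ ⟨q, hq⟩ h
      have hpq : r p q := Quotient.exact h
      simp only [Finset.mem_filter, Finset.mem_univ, true_and, mem_gap] at hp hq
      exact Subtype.ext (cdist_right_injective z (le_antisymm (hp q hpq) (hq p (r.symm' hpq))))
    · intro x
      induction x using Quotient.inductionOn with
      | h q =>
      obtain ⟨p, hp, hmin⟩ := Finset.exists_min_image (Finset.univ.filter fun p => r q p)
        (fun p => cdist p z) ⟨q, by simp⟩
      have hqp : r q p := by simpa using hp
      refine ⟨⟨p, ?_⟩, Quotient.sound (r.symm' hqp)⟩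
      simp only [Finset.mem_filter, Finset.mem_univ, true_and, mem_gap]
      intro q' hq'
      exact hmin q' (by simpa using r.trans' hqp hq')
  rw [h1, Finset.sum_congr rfl fun z _ => h2 z]
  simp

/-- The bound is the length of the arc from `p` to `p'`, counted as a full turn `M` when `p' = p`.
With this convention a fixed point is a cycle that winds once. -/
theorem card_gap_le (r : Setoid (Fin M)) {p p' : Fin M} (h : r p p') :
    (gap r p).card ≤ cdist (finRotate M p) p' + 1 := by
  classical
  rw [← Finset.card_range (cdist (finRotate M p) p' + 1)]
  refine Finset.card_le_card_of_injOn (cdist p) ?_ (cdist_left_injective p).injOn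
  intro z hz
  have h1 := mem_gap.mp hz p' h
  have := p.2; have := p'.2; have := z.2
  simp only [Finset.coe_range, Set.mem_Iio]
  simp only [cdist, val_finRotate] at *
  split_ifs at * <;> omega

/-- If the gap of `p` fills the arc up to `p'`, another class member `q` inside this arc would lie
in the gap of `p`, although it is at distance zero from itself. -/
theorem le_cdist_of_card_gap (r : Setoid (Fin M)) {p p' : Fin M} (h : r p p')
    (hc : cdist (finRotate M p) p' + 1 ≤ (gap r p).card) {q : Fin M} (hq : r p q) (hqp : q ≠ p) :
    cdist p p' ≤ cdist p q := by
  classical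
  by_contra hlt
  have himg : (gap r p).image (cdist p) = Finset.range (cdist (finRotate M p) p' + 1) := by
    refine Finset.eq_of_subset_of_card_le ?_ ?_
    · intro a ha
      obtain ⟨z, hz, rfl⟩ := Finset.mem_image.mp ha
      have h1 := mem_gap.mp hz p' h
      have := p.2; have := p'.2; have := z.2
      simp only [Finset.mem_range]
      simp only [cdist, val_finRotate] at *
      split_ifs at * <;> omega
    · rwa [Finset.card_range, Finset.card_image_of_injective _ (cdist_left_injective p)]
  have hpp : p ≠ p' := by
    rintro rfl
    rw [cdist_self] at hlt
    omega
  have hmem : cdist p q ∈ (gap r p).image (cdist p) := by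
    rw [himg, Finset.mem_range, cdist_finRotate_left hpp]
    omega
  obtain ⟨z, hz, hzq⟩ := Finset.mem_image.mp hmem
  obtain rfl := cdist_left_injective p hzq
  have := mem_gap.mp hz z hq
  rw [cdist_self, Nat.le_zero, cdist_eq_zero] at this
  exact hqp this.symm

/-! ### Permutations whose cycles wind around the circle once -/

/-- Every cycle of `f` is read in clockwise order. -/
def IsClockwise (f : Perm (Fin M)) : Prop :=
  ∀ p q, f.SameCycle p q → q ≠ p → cdist p (f p) ≤ cdist p q

/-- The number of cycles of a permutation, fixed points included. -/
noncomputable def numCycles {α : Type*} (f : Perm α) : ℕ := Nat.card (Quotient (Perm.SameCycle.setoid f))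

/-- The right-hand side is `M` times the total winding number of the cycles, each of which winds at
least once. -/
theorem sum_cdist_ge (f : Perm (Fin M)) :
    M * numCycles f ≤ ∑ p, (cdist (finRotate M p) (f p) + 1) := by
  rw [numCycles, ← sum_card_gap]
  exact Finset.sum_le_sum fun p _ => card_gap_le _ (Perm.sameCycle_apply_right.mpr (Perm.SameCycle.refl f p))

theorem isClockwise_of_sum_le (f : Perm (Fin M))
    (h : ∑ p, (cdist (finRotate M p) (f p) + 1) ≤ M * numCycles f) : IsClockwise f := by
  have hle : ∀ p ∈ Finset.univ, (gap (Perm.SameCycle.setoid f) p).card ≤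
      cdist (finRotate M p) (f p) + 1 :=
    fun p _ => card_gap_le _ (Perm.sameCycle_apply_right.mpr (Perm.SameCycle.refl f p))
  rw [numCycles, ← sum_card_gap] at h
  have heq := (Finset.sum_eq_sum_iff_of_le hle).mp (le_antisymm (Finset.sum_le_sum hle) h)
  intro p q hpq hqp
  exact le_cdist_of_card_gap (Perm.SameCycle.setoid f)
    (Perm.sameCycle_apply_right.mpr (Perm.SameCycle.refl f p)) (heq p (Finset.mem_univ p)).ge hpq hqp

/-- Reindexing by `S` pairs the arc from `p` to `S p` with the arc from `S p` to `P (S p) = p + 1`;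
together they make one turn and one step. -/
theorem sum_cdist_add_sum_cdist {S P : Perm (Fin M)} (h : P * S = finRotate M) :
    ∑ p, (cdist (finRotate M p) (S p) + 1) + ∑ p, (cdist (finRotate M p) (P p) + 1) =
      M * (M + 1) := by
  rw [← Equiv.sum_comp S fun p => cdist (finRotate M p) (P p) + 1, ← Finset.sum_add_distrib]
  rw [Finset.sum_congr rfl fun p _ => ?_, Finset.sum_const, Finset.card_univ, Fintype.card_fin,
    smul_eq_mul]
  have e : P (S p) = finRotate M p := by rw [← h]; rfl
  rw [e, cdist_finRotate_finRotate]
  have := cdist_finRotate_add p (S p)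
  omega

theorem numCycles_add_le {S P : Perm (Fin M)} (hM : 0 < M) (h : P * S = finRotate M) :
    numCycles S + numCycles P ≤ M + 1 := by
  have h1 := sum_cdist_add_sum_cdist h
  have h2 := sum_cdist_ge S
  have h3 := sum_cdist_ge P
  refine Nat.le_of_mul_le_mul_left ?_ hM
  rw [mul_add]
  omega

theorem isClockwise_of_numCycles {S P : Perm (Fin M)} (h : P * S = finRotate M)
    (hc : M + 1 ≤ numCycles S + numCycles P) : IsClockwise S ∧ IsClockwise P := by
  have h1 := sum_cdist_add_sum_cdist h
  have h2 := sum_cdist_ge S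
  have h3 := sum_cdist_ge P
  have h4 := Nat.mul_le_mul_left M hc
  rw [mul_add M (numCycles S)] at h4
  exact ⟨isClockwise_of_sum_le S (by omega), isClockwise_of_sum_le P (by omega)⟩

theorem sameCycle_conj_finRotate {f : Perm (Fin M)} {p q : Fin M} :
    (finRotate M * f * (finRotate M)⁻¹).SameCycle (finRotate M p) (finRotate M q) ↔
      f.SameCycle p q := by
  rw [Perm.sameCycle_conj, perm_inv_apply_self, perm_inv_apply_self]

theorem IsClockwise.conj_finRotate {f : Perm (Fin M)} (hf : IsClockwise f) :
    IsClockwise (finRotate M * f * (finRotate M)⁻¹) := by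
  intro p q
  obtain ⟨p, rfl⟩ := (finRotate M).surjective p
  obtain ⟨q, rfl⟩ := (finRotate M).surjective q
  rw [sameCycle_conj_finRotate]
  intro h hne
  rw [Perm.mul_apply, Perm.mul_apply, perm_inv_apply_self, cdist_finRotate_finRotate,
    cdist_finRotate_finRotate]
  exact hf p q h (fun e => hne (by rw [e]))

end CirclePartition

/-! ### Clockwise factorizations of the rotation are noncrossing and Kreweras complementary. -/

namespace CirclePartition

open Equiv

variable {M : ℕ}

theorem cdist_eq_sub {p x y : Fin M} (h : cdist p x ≤ cdist p y) :
    cdist x y = cdist p y - cdist p x := by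
  have := p.2; have := x.2; have := y.2
  simp only [cdist] at *
  split_ifs at * <;> omega

theorem cdist_eq_add_sub {p x y : Fin M} (h : cdist p y < cdist p x) :
    cdist x y = M + cdist p y - cdist p x := by
  have := p.2; have := x.2; have := y.2
  simp only [cdist] at *
  split_ifs at * <;> omega

theorem cdist_finRotate_right {p x : Fin M} (h : cdist p x + 1 < M) :
    cdist p (finRotate M x) = cdist p x + 1 := by
  have := p.2; have := x.2
  simp only [cdist, val_finRotate] at *
  split_ifs at * <;> omega

theorem cdist_eq_iff {p x y : Fin M} : cdist p x = cdist p y ↔ x = y :=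
  (cdist_left_injective p).eq_iff

theorem sameCycle_apply {α : Type*} (f : Perm α) (x : α) : f.SameCycle x (f x) :=
  Perm.sameCycle_apply_right.mpr (Perm.SameCycle.refl f x)

/-- In the application `q + 1` is the successor of `s` in a clockwise cycle and `z` is another point
of this cycle, which is thereby trapped in the arc after `q` up to `s`. -/
theorem cdist_bounds_of_le {p q s z : Fin M} (h : cdist p q < cdist p s)
    (hz : cdist s (finRotate M q) ≤ cdist s z) (hs : finRotate M q ≠ s) :
    cdist p q < cdist p z ∧ cdist p z ≤ cdist p s := by
  have hs' : ((finRotate M q : Fin M) : ℕ) ≠ s := fun h => hs (Fin.ext h)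
  have := p.2; have := z.2; have := s.2; have := q.2
  simp only [cdist, val_finRotate] at *
  split_ifs at * <;> omega

/-- This lets `P` take over the role of `S`, so that a crossing of `P` can be treated like a
crossing of `S`. -/
theorem conj_mul_eq_finRotate {S P : Perm (Fin M)} (h : P * S = finRotate M) :
    (finRotate M * S * (finRotate M)⁻¹) * P = finRotate M := by
  rw [← h]; group

/-- The consecutive pairs of two clockwise permutations with product `(1, 2, …, M)` do not
cross. -/
theorem not_crossing (m : ℕ) : ∀ {S P : Perm (Fin M)}, P * S = finRotate M →
    IsClockwise S → IsClockwise P → ∀ p q, 0 < cdist p q → cdist p q < cdist p (S p) →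
      cdist p (S p) < cdist p (S q) → cdist p (S q) ≤ m → False := by
  induction m with
  | zero => intro S P _ _ _ p q _ _ _ _; omega
  | succ m ih =>
    intro S P h hS hP p q h1 h2 h3 h4
    have hPS : ∀ x, P (S x) = finRotate M x := fun x => by rw [← h]; rfl
    have hlt := cdist_lt p (S q)
    -- `P` sends `S p` to `p + 1`, so the clockwise `P`-cycle of `S p` stays in the arc after `p` up
    -- to `S p`. Likewise the `P`-cycle of `S q` stays after `q` up to `S q`.
    have hO1 : ∀ z, P.SameCycle (S p) z → 1 ≤ cdist p z ∧ cdist p z ≤ cdist p (S p) := by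
      intro z hz
      by_cases e : z = S p
      · subst e; omega
      have h5 := hP (S p) z hz e
      rw [hPS] at h5
      have := cdist_bounds_of_le (p := p) (by rw [cdist_self]; omega) h5
        (fun e' => e ((hz.eq_of_left ((hPS p).trans e')).symm))
      rw [cdist_self] at this
      omega
    have hO2 : ∀ z, P.SameCycle (S q) z → cdist p q < cdist p z ∧ cdist p z ≤ cdist p (S q) := by
      intro z hz
      by_cases e : z = S q
      · subst e; omega
      have h5 := hP (S q) z hz e
      rw [hPS] at h5
      exact cdist_bounds_of_le (by omega) h5
        (fun e' => e ((hz.eq_of_left ((hPS q).trans e')).symm))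
    have hne : ¬ P.SameCycle (S p) (S q) := fun h => by have := hO1 _ h; omega
    have hp1 : P.SameCycle (S p) (finRotate M p) := hPS p ▸ sameCycle_apply P (S p)
    have hq1 : P.SameCycle (S q) (finRotate M q) := hPS q ▸ sameCycle_apply P (S q)
    have hdp1 : cdist p (finRotate M p) = 1 := by
      rw [cdist_finRotate_right, cdist_self]; rw [cdist_self]; omega
    have hdq1 : cdist p (finRotate M q) = cdist p q + 1 := cdist_finRotate_right (by omega)
    classical
    -- `x` is the last point of the cycle of `S p` not beyond `q`, so `P x` jumps over `q`.
    obtain ⟨x, hx, hxmax⟩ := Finset.exists_max_image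
      (Finset.univ.filter fun z => P.SameCycle (S p) z ∧ cdist p z ≤ cdist p q) (cdist p)
      ⟨finRotate M p, by simp only [Finset.mem_filter, Finset.mem_univ, true_and]; exact ⟨hp1, by omega⟩⟩
    simp only [Finset.mem_filter, Finset.mem_univ, true_and] at hx hxmax
    have hPx : P.SameCycle (S p) (P x) := hx.1.trans (sameCycle_apply P x)
    have hxs : x ≠ S p := by rintro rfl; omega
    have hxP : P x ≠ x := by
      intro e
      exact hxs (((Perm.sameCycle_comm).mp hx.1).eq_of_left e)
    have b1 := hP x (S p) (Perm.sameCycle_comm.mp hx.1) hxs.symm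
    have b2 : cdist p q < cdist p (P x) := by
      by_contra hcon
      have h5 := hxmax (P x) ⟨hPx, by omega⟩
      have h6 : cdist p (P x) ≠ cdist p x := fun e => hxP (cdist_eq_iff.mp e)
      rw [cdist_eq_add_sub (p := p) (by omega), cdist_eq_sub (p := p) (x := x) (y := S p) (by omega)] at b1
      have := cdist_lt p x
      have := cdist_lt p (S p)
      omega
    have b3 : cdist p (P x) ≠ cdist p (finRotate M q) := by
      rw [Ne, cdist_eq_iff]
      intro e
      exact hne (hPx.trans (e ▸ hq1.symm))
    -- `y` is the last point of the cycle of `S q` before `P x`, so `x`, `y`, `P x`, `P y` come in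
    -- this order and cross.
    obtain ⟨y, hy, hymax⟩ := Finset.exists_max_image
      (Finset.univ.filter fun z => P.SameCycle (S q) z ∧ cdist p z < cdist p (P x)) (cdist p)
      ⟨finRotate M q, by simp only [Finset.mem_filter, Finset.mem_univ, true_and]; exact ⟨hq1, by omega⟩⟩
    simp only [Finset.mem_filter, Finset.mem_univ, true_and] at hy hymax
    have hPx' := hO1 _ hPx
    have hPy : P.SameCycle (S q) (P y) := hy.1.trans (sameCycle_apply P y)
    have hys : y ≠ S q := by rintro rfl; omega
    have hyP : P y ≠ y := by
      intro e
      exact hys (((Perm.sameCycle_comm).mp hy.1).eq_of_left e)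
    have c1 := hP y (S q) (Perm.sameCycle_comm.mp hy.1) hys.symm
    have c2 : cdist p (P x) < cdist p (P y) := by
      by_contra hcon
      have h7 : cdist p (P y) ≠ cdist p (P x) := by
        rw [Ne, cdist_eq_iff]
        intro e
        exact hne (hPx.trans (e ▸ hPy.symm))
      have h5 := hymax (P y) ⟨hPy, by omega⟩
      have h6 : cdist p (P y) ≠ cdist p y := fun e => hyP (cdist_eq_iff.mp e)
      rw [cdist_eq_add_sub (p := p) (by omega), cdist_eq_sub (p := p) (x := y) (y := S q) (by omega)] at c1
      have := cdist_lt p y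
      have := cdist_lt p (S q)
      omega
    have hx' := hO1 _ hx.1
    have hy' := hO2 _ hy.1
    have hPy' := hO2 _ hPy
    -- The crossing of `P` starts after `p` and ends no later than `S q`, hence is strictly shorter:
    -- descent.
    refine ih (conj_mul_eq_finRotate h) hP hS.conj_finRotate x y ?_ ?_ ?_ ?_
    · rw [cdist_eq_sub (p := p) (by omega)]; omega
    · rw [cdist_eq_sub (p := p) (by omega), cdist_eq_sub (p := p) (y := P x) (by omega)]; omega
    · rw [cdist_eq_sub (p := p) (by omega), cdist_eq_sub (p := p) (y := P y) (by omega)]; omega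
    · rw [cdist_eq_sub (p := p) (by omega)]; omega

/-- If `p < q < f p` clockwise, then also `f q` is strictly between `p` and `f p`. -/
def IsNoncrossing (f : Perm (Fin M)) : Prop :=
  ∀ p q, 0 < cdist p q → cdist p q < cdist p (f p) →
    0 < cdist p (f q) ∧ cdist p (f q) < cdist p (f p)

theorem isNoncrossing_of_isClockwise {S P : Perm (Fin M)} (h : P * S = finRotate M)
    (hS : IsClockwise S) (hP : IsClockwise P) : IsNoncrossing S := by
  intro p q h1 h2
  have hqp : q ≠ p := by rintro rfl; rw [cdist_self] at h1; omega
  have h3 : S q ≠ p := by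
    intro e
    have := hS p q (e ▸ (sameCycle_apply S q).symm) hqp
    omega
  refine ⟨Nat.pos_of_ne_zero fun e => h3 (cdist_eq_zero.mp e).symm, ?_⟩
  by_contra hcon
  have h4 : cdist p (S p) ≠ cdist p (S q) := by
    rw [Ne, cdist_eq_iff, S.injective.eq_iff]
    exact hqp.symm
  exact not_crossing _ h hS hP p q h1 h2 (by omega) le_rfl

theorem invariant_of_sameCycle {α : Type*} [Finite α] {f : Perm α} {g : α → Prop}
    (hg : ∀ a, g a → g (f a)) {a b : α} (h : f.SameCycle a b) : g a ↔ g b := by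
  have key : ∀ {a b : α}, f.SameCycle a b → g a → g b := by
    intro a b h ha
    obtain ⟨i, -, rfl⟩ := h.exists_pow_eq'
    clear h
    induction i with
    | zero => exact ha
    | succ i ih => rw [pow_succ']; exact hg _ ih
  exact ⟨key h, key h.symm⟩

/-! ### Kreweras complements -/

/-- A rotation-invariant form. The condition `a < i ↔ a < j` describes the arc from `i` to just
before `j` or its complement, according to the order of `i` and `j`; the choice is immaterial for
comparing two points. -/
theorem kreweras_iff (σ : Setoid (Fin M)) (i j : Fin M) :
    kreweras σ i j ↔ ∀ a b, σ a b → (cdist i a < cdist i j ↔ cdist i b < cdist i j) := by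
  have hiff : (∀ a : Fin M, (cdist i a < cdist i j ↔ ¬ (a < i ↔ a < j))) ∨
      ∀ a : Fin M, (cdist i a < cdist i j ↔ (a < i ↔ a < j)) := by
    have := i.2; have := j.2
    rcases le_or_gt i j with hij | hij
    · left
      intro a
      have := a.2
      simp only [cdist, Fin.lt_def, Fin.le_def] at *
      split_ifs <;> omega
    · right
      intro a
      have := a.2
      simp only [cdist, Fin.lt_def] at *
      split_ifs <;> omega
  change (∀ a b, σ a b → ((a < i ↔ a < j) ↔ (b < i ↔ b < j))) ↔ _
  refine forall_congr' fun a => forall_congr' fun b => imp_congr_right fun _ => ?_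
  rcases hiff with h | h
  · rw [h a, h b, not_iff_not]
  · rw [h a, h b]

/-- The arc from `x` to `b` is the intersection of the arcs from `a` to `b` and from `x` to `y`, so
it too is a union of blocks of `σ`. -/
theorem kreweras_noncrossing {σ : Setoid (Fin M)} {a b x y : Fin M} (h1 : kreweras σ a b)
    (h2 : kreweras σ x y) (hx : cdist a x ≤ cdist a b) (hy : cdist a b ≤ cdist a y) :
    kreweras σ x b := by
  rw [kreweras_iff] at *
  have key : ∀ α, cdist x α < cdist x b ↔ (cdist a α < cdist a b ∧ cdist x α < cdist x y) := by
    intro α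
    have := a.2; have := b.2; have := x.2; have := y.2; have := α.2
    rw [cdist_eq_sub hx, cdist_eq_sub (hx.trans hy)]
    rcases le_or_gt (cdist a x) (cdist a α) with h | h
    · rw [cdist_eq_sub h]; omega
    · rw [cdist_eq_add_sub h]
      have := cdist_lt a y
      have := cdist_lt a x
      omega
  intro α β hαβ
  rw [key, key, h1 α β hαβ, h2 α β hαβ]

/-- The Kreweras complement of the cycles of `S` consists of the cycles of `P`, where
`P S = (1, 2, …, M)`. -/
theorem kreweras_cycles {S P : Perm (Fin M)} (h : P * S = finRotate M) (hS : IsNoncrossing S) :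
    kreweras (cycles S) = cycles P := by
  have hPS : ∀ x, P (S x) = finRotate M x := fun x => by rw [← h]; rfl
  -- The arc from `p + 1` to just before `S p` is stable under the noncrossing `S`; if `p` is a
  -- fixed point, this arc is the whole circle without `p`.
  have step : ∀ p, kreweras (cycles S) (finRotate M p) (S p) := by
    intro p
    rw [kreweras_iff]
    intro a b hab
    refine invariant_of_sameCycle (g := fun a => cdist (finRotate M p) a < cdist (finRotate M p) (S p))
      (fun a ha => ?_) hab
    by_cases e : S p = p
    · have hne : ∀ z, z ≠ p → cdist (finRotate M p) z < cdist (finRotate M p) p := by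
        intro z hz
        have h1 := cdist_finRotate_add p p
        rw [cdist_self] at h1
        have h2 := cdist_lt (finRotate M p) z
        have h3 : cdist (finRotate M p) z ≠ cdist (finRotate M p) p := by
          rwa [Ne, cdist_eq_iff]
        omega
      rw [e] at ha ⊢
      refine hne _ fun e' => ?_
      rw [← e] at e'
      rw [S.injective e'] at ha
      omega
    · have h1 := cdist_finRotate_left (Ne.symm e)
      have hap : a ≠ p := by
        rintro rfl
        have h2 := cdist_finRotate_add a a
        have := cdist_lt a (S a)
        rw [cdist_self] at h2
        omega
      have h2 := cdist_finRotate_left hap.symm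
      have h3 := hS p a (by omega) (by omega)
      have h4 := cdist_finRotate_left (p := p) (q := S a) (fun e => by
        rw [← e, cdist_self] at h3; omega)
      omega
  refine Setoid.ext fun i j => ⟨fun hij => ?_, fun hij => ?_⟩
  · by_contra hne
    rw [kreweras_iff] at hij
    -- The arc from `i` to just before `j` is stable under `S⁻¹`, and `P` is `S⁻¹` followed by one
    -- step, so `P` can leave the arc only by landing on `j`. If `j` is in another cycle, the orbit
    -- of `i` stays inside and, ending each move with a step, never returns to `i`, which is absurd.
    have hpos : ∀ m : ℕ, cdist i ((P ^ m) i) < cdist i j ∧ (m ≠ 0 → (P ^ m) i ≠ i) := by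
      intro m
      induction m with
      | zero =>
        refine ⟨?_, by simp⟩
        rw [pow_zero, Perm.one_apply, cdist_self]
        refine Nat.pos_of_ne_zero fun e => hne ?_
        rw [cdist_eq_zero.mp e]
      | succ m ih =>
        set x := (P ^ m) i
        have hx : (P ^ (m + 1)) i = finRotate M (S⁻¹ x) := by
          rw [pow_succ', Perm.mul_apply, ← hPS, perm_apply_inv_self]
        have h1 : cdist i (S⁻¹ x) < cdist i j :=
          (hij _ _ (show S.SameCycle (S⁻¹ x) x by
            conv_rhs => rw [← perm_apply_inv_self S x]
            exact sameCycle_apply S _)).mpr ih.1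
        have h2 := cdist_lt i j
        have h3 := cdist_finRotate_right (p := i) (x := S⁻¹ x) (by omega)
        rw [← hx] at h3
        have h4 : cdist i ((P ^ (m + 1)) i) ≠ cdist i j := by
          rw [Ne, cdist_eq_iff]
          rintro e
          exact hne (e ▸ ⟨(m + 1 : ℕ), by rw [zpow_natCast]⟩)
        refine ⟨by omega, fun _ e => ?_⟩
        rw [e, cdist_self] at h3
        omega
    have := (hpos (orderOf P)).2 (orderOf_pos P).ne'
    rw [pow_orderOf_eq_one] at this
    exact this rfl
  · obtain ⟨m, -, rfl⟩ := Perm.SameCycle.exists_pow_eq' hij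
    clear hij
    induction m with
    | zero => exact (kreweras (cycles S)).refl' _
    | succ m ih =>
      refine (kreweras (cycles S)).trans' ih ?_
      rw [pow_succ', Perm.mul_apply]
      generalize (P ^ m) i = x
      obtain ⟨p, rfl⟩ := S.surjective x
      rw [hPS]
      exact (kreweras (cycles S)).symm' (step p)

end CirclePartition

namespace CirclePartition

open Equiv

variable {M : ℕ}

/-! ### Recovering a clockwise permutation from its cycles -/

/-- The successor in increasing order, wrapping from the last element to the first, is the nearest
other element of the block clockwise, and so is `f a`. -/
theorem Omega_cycles {f : Perm (Fin M)} (hf : IsClockwise f) : Omega (cycles f) = f := by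
  refine Equiv.ext fun a => ?_
  set l := blockList (cycles f) a with hl
  have hmem : ∀ b, b ∈ l ↔ f.SameCycle a b := fun b => mem_blockList (cycles f) a b
  have hsort : l.SortedLT := Finset.sortedLT_sort _
  have hmono : StrictMono l.get := hsort.strictMono_get
  have hnd : l.Nodup := hsort.nodup
  obtain ⟨i, hi, hia⟩ := List.getElem_of_mem ((hmem a).mpr (Perm.SameCycle.refl f a))
  have hO : Omega (cycles f) a = l[(i + 1) % l.length]'(Nat.mod_lt _ (by omega)) := by
    have h1 := List.formPerm_apply_getElem l hnd i hi
    rw [hia] at h1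
    exact h1
  have hOmem : Omega (cycles f) a ∈ l := by rw [hO]; exact List.getElem_mem _
  have lt_of : ∀ (x y : ℕ) (hx : x < l.length) (hy : y < l.length), x < y → (l[x] : ℕ) < l[y] :=
    fun x y hx hy h => hmono (show (⟨x, hx⟩ : Fin l.length) < ⟨y, hy⟩ from h)
  have key : ∀ z ∈ l, z ≠ a → Omega (cycles f) a ≠ a ∧
      cdist a (Omega (cycles f) a) ≤ cdist a z := by
    intro z hz hza
    obtain ⟨j, hj, rfl⟩ := List.getElem_of_mem hz
    have hij : j ≠ i := by rintro rfl; exact hza hia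
    have b0 := a.2
    have b1 := (l[j]).2
    rcases Nat.lt_or_ge (i + 1) l.length with h | h
    · have e : (i + 1) % l.length = i + 1 := Nat.mod_eq_of_lt h
      simp only [e] at hO
      have h1 := lt_of i (i + 1) hi h (by omega)
      have h2 : j < i → (l[j] : ℕ) < l[i] := lt_of j i hj hi
      have h3 : i + 1 < j → (l[i + 1] : ℕ) < l[j] := lt_of (i + 1) j h hj
      have h4 : j = i + 1 → (l[i + 1] : ℕ) = l[j] := by rintro rfl; rfl
      rw [hia] at h1 h2
      rw [hO]
      have b2 := (l[i + 1]).2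
      refine ⟨fun e => by rw [e] at h1; omega, ?_⟩
      simp only [cdist]
      split_ifs <;> omega
    · have e : (i + 1) % l.length = 0 := by
        rw [show i + 1 = l.length by omega, Nat.mod_self]
      simp only [e] at hO
      have h1 := lt_of 0 i (by omega) hi (by omega)
      have h2 : j < i → (l[j] : ℕ) < l[i] := lt_of j i hj hi
      have h3 : 0 < j → (l[0] : ℕ) < l[j] := lt_of 0 j (by omega) hj
      have h4 : j = 0 → (l[0] : ℕ) = l[j] := by rintro rfl; rfl
      rw [hia] at h1 h2
      rw [hO]
      have b2 := (l[0]).2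
      refine ⟨fun e => by rw [e] at h1; omega, ?_⟩
      simp only [cdist]
      split_ifs <;> omega
  by_cases hfa : f a = a
  · have h1 := ((hmem _).mp hOmem).eq_of_left hfa
    rw [hfa, ← h1]
  · have h1 := key (f a) ((hmem _).mpr (sameCycle_apply f a)) hfa
    exact cdist_left_injective a (le_antisymm h1.2 (hf a _ ((hmem _).mp hOmem) h1.1))

theorem eq_of_cycles_eq {f g : Perm (Fin M)} (hf : IsClockwise f) (hg : IsClockwise g)
    (h : cycles f = cycles g) : f = g := by
  rw [← Omega_cycles hf, ← Omega_cycles hg, h]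

/-! ### Counting cycles -/

/-- The relation `r` merges the `f`-cycles of `a` and `b`. It has at most one class fewer than `f`
has cycles, and it is coarser than the cycles of `swap a b * f`. -/
theorem numCycles_le_swap_mul {α : Type*} [Finite α] [DecidableEq α] (f : Perm α) (a b : α) :
    numCycles f ≤ numCycles (swap a b * f) + 1 := by
  let K : α → Prop := fun x => f.SameCycle a x ∨ f.SameCycle b x
  have hK : ∀ {x y}, f.SameCycle x y → (K x ↔ K y) := fun {x y} h =>
    or_congr ⟨fun h' => h'.trans h, fun h' => h'.trans h.symm⟩
      ⟨fun h' => h'.trans h, fun h' => h'.trans h.symm⟩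
  let r : Setoid α :=
    { r := fun x y => f.SameCycle x y ∨ (K x ∧ K y)
      iseqv :=
        { refl := fun x => Or.inl (Perm.SameCycle.refl f x)
          symm := fun h => h.imp Perm.SameCycle.symm And.symm
          trans := by
            rintro x y z (h | h) (h' | h')
            · exact Or.inl (h.trans h')
            · exact Or.inr ⟨(hK h).mpr h'.1, h'.2⟩
            · exact Or.inr ⟨h.1, (hK h').mp h.2⟩
            · exact Or.inr ⟨h.1, h'.2⟩ } }
  have hrK : ∀ {x y}, r x y ↔ f.SameCycle x y ∨ (K x ∧ K y) := Iff.rfl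
  have hswap : ∀ z, r z (swap a b z) := by
    intro z
    have ha : K a := Or.inl (Perm.SameCycle.refl f a)
    have hb : K b := Or.inr (Perm.SameCycle.refl f b)
    by_cases h1 : z = a
    · rw [h1, swap_apply_left]; exact Or.inr ⟨ha, hb⟩
    by_cases h2 : z = b
    · rw [h2, swap_apply_right]; exact Or.inr ⟨hb, ha⟩
    rw [swap_apply_of_ne_of_ne h1 h2]
  have h1 : Nat.card (Quotient r) ≤ numCycles (swap a b * f) := by
    refine Nat.card_le_card_of_surjective
      (Quotient.lift (fun x => Quotient.mk r x) fun x y (h : (swap a b * f).SameCycle x y) => ?_) ?_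
    · refine Quotient.sound ((invariant_of_sameCycle (g := fun z => r x z) (fun z hz => ?_) h).mp
        (r.refl' x))
      exact r.trans' (r.trans' hz (Or.inl (sameCycle_apply f z))) (hswap _)
    · intro q
      induction q using Quotient.inductionOn with
      | h x => exact ⟨Quotient.mk _ x, rfl⟩
  classical
  have h2 : numCycles f ≤ Nat.card (Option (Quotient r)) := by
    refine Nat.card_le_card_of_injective
      (Quotient.lift (fun x => if f.SameCycle a x then none else some (Quotient.mk r x))
        fun x y (h : f.SameCycle x y) => ?_) ?_
    · have : f.SameCycle a x ↔ f.SameCycle a y := ⟨fun h' => h'.trans h, fun h' => h'.trans h.symm⟩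
      simp only [this]
      rw [Quotient.sound (s := r) (a := x) (b := y) (Or.inl h)]
    · intro p q
      induction p using Quotient.inductionOn with
      | h x =>
      induction q using Quotient.inductionOn with
      | h y =>
      intro h
      simp only [Quotient.lift_mk] at h
      refine Quotient.sound (show f.SameCycle x y from ?_)
      split_ifs at h with hx hy hy
      · exact hx.symm.trans hy
      · rcases hrK.mp (Quotient.exact (Option.some_injective _ h)) with h' | ⟨h', h''⟩
        · exact h'
        · exact (h'.resolve_left hx).symm.trans (h''.resolve_left hy)
  rw [Finite.card_option] at h2
  omega

theorem sign_eq_pow_numCycles {α : Type*} [Fintype α] [DecidableEq α] (f : Perm α) :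
    Perm.sign f = (-1) ^ (Fintype.card α + numCycles f) := by
  classical
  -- `φ` takes one value per cycle: the cycle factor for a moved point, the point itself for a fixed
  -- one.
  let φ : α → Perm α ⊕ α := fun x => if f x = x then Sum.inr x else Sum.inl (f.cycleOf x)
  have hφ : ∀ x y, f.SameCycle x y → φ x = φ y := by
    intro x y h
    by_cases hx : f x = x
    · rw [h.eq_of_left hx]
    · have hy : f y ≠ y := fun e => hx (by rw [← h.symm.eq_of_left e] at *; exact e)
      simp only [φ, if_neg hx, if_neg hy, h.cycleOf_eq]
  have hinj : ∀ x y, φ x = φ y → f.SameCycle x y := by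
    intro x y h
    simp only [φ] at h
    split_ifs at h with hx hy hy
    · rw [Sum.inr_injective h]
    · exact (Perm.sameCycle_iff_cycleOf_eq_of_mem_support (Perm.mem_support.mpr hx)
        (Perm.mem_support.mpr hy)).mpr (Sum.inl_injective h)
  have h1 : numCycles f = (Finset.univ.image φ).card := by
    rw [numCycles, ← Fintype.card_coe, ← Nat.card_eq_fintype_card]
    refine Nat.card_congr (Equiv.ofBijective (Quotient.lift
      (fun x => (⟨φ x, Finset.mem_image_of_mem _ (Finset.mem_univ x)⟩ : Finset.univ.image φ))
      fun x y h => Subtype.ext (hφ x y h)) ⟨?_, ?_⟩)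
    · intro p q
      induction p using Quotient.inductionOn with
      | h x =>
      induction q using Quotient.inductionOn with
      | h y => exact fun h => Quotient.sound (hinj x y (congrArg Subtype.val h))
    · rintro ⟨z, hz⟩
      obtain ⟨x, -, rfl⟩ := Finset.mem_image.mp hz
      exact ⟨Quotient.mk _ x, rfl⟩
  have h2 : Finset.univ.image φ = f.cycleFactorsFinset.disjSum f.supportᶜ := by
    ext z
    simp only [Finset.mem_image, Finset.mem_univ, true_and, Finset.mem_disjSum, Finset.mem_compl,
      Perm.notMem_support]
    constructor
    · rintro ⟨x, rfl⟩
      by_cases hx : f x = x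
      · exact Or.inr ⟨x, hx, by simp [φ, hx]⟩
      · exact Or.inl ⟨f.cycleOf x,
          Perm.cycleOf_mem_cycleFactorsFinset_iff.mpr (Perm.mem_support.mpr hx), by simp [φ, hx]⟩
    · rintro (⟨c, hc, rfl⟩ | ⟨x, hx, rfl⟩)
      · obtain ⟨x, hx⟩ := (Perm.mem_cycleFactorsFinset_iff.mp hc).1.nonempty_support
        refine ⟨x, ?_⟩
        have hfx := Perm.mem_cycleFactorsFinset_support_le hc hx
        rw [Perm.mem_support] at hfx
        simp only [φ, if_neg hfx]
        rw [Perm.cycle_is_cycleOf hx hc]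
      · exact ⟨x, by simp [φ, hx]⟩
  have h3 : f.supportᶜ.card + f.support.card = Fintype.card α := by
    rw [Finset.card_compl]
    have := Finset.card_le_univ f.support
    omega
  have h4 : Multiset.card f.cycleType = f.cycleFactorsFinset.card := by
    rw [Perm.cycleType_def, Multiset.card_map, Finset.card_val]
  rw [Perm.sign_of_cycleType, h1, h2, Finset.card_disjSum, ← h3, Perm.sum_cycleType, h4]
  rw [show f.supportᶜ.card + f.support.card + (f.cycleFactorsFinset.card + f.supportᶜ.card) =
    f.support.card + f.cycleFactorsFinset.card + 2 * f.supportᶜ.card by ring,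
    pow_add _ _ (2 * f.supportᶜ.card), pow_mul]
  simp

theorem numCycles_one : numCycles (1 : Perm (Fin M)) = M := by
  rw [numCycles]
  conv_rhs => rw [← Nat.card_fin M]
  exact (Nat.card_congr (Equiv.ofBijective (Quotient.mk _)
    ⟨fun x y h => Perm.sameCycle_one.mp (Quotient.exact h), Quotient.mk_surjective⟩)).symm

theorem numCycles_finRotate (hM : 0 < M) : numCycles (finRotate M) = 1 := by
  have := numCycles_add_le (S := finRotate M) (P := 1) hM (by simp)
  have h1 := numCycles_one (M := M)
  have : 0 < numCycles (finRotate M) := by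
    have : Nonempty (Quotient (Perm.SameCycle.setoid (finRotate M))) := ⟨Quotient.mk _ ⟨0, hM⟩⟩
    exact Nat.card_pos
  omega

/-- The genus inequality holds modulo two, so it is an equality as soon as it is off by at most
one. -/
theorem isClockwise_of_le_numCycles {S P : Perm (Fin M)} (hM : 0 < M) (h : P * S = finRotate M)
    (hc : M ≤ numCycles S + numCycles P) : IsClockwise S ∧ IsClockwise P := by
  refine isClockwise_of_numCycles h ?_
  by_contra hlt
  have he : numCycles S + numCycles P = M := by omega
  -- If the cycle numbers added up to `M`, the product would have sign `(-1)^M`, whereas the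
  -- rotation has sign `(-1)^(M+1)`.
  have h1 := congrArg Perm.sign h
  rw [map_mul, sign_eq_pow_numCycles, sign_eq_pow_numCycles, sign_eq_pow_numCycles,
    numCycles_finRotate hM, ← pow_add, Fintype.card_fin] at h1
  rw [show M + numCycles P + (M + numCycles S) = M + 2 * M by omega, pow_add, pow_add _ M 1,
    pow_mul] at h1
  simp at h1

end CirclePartition

namespace CirclePartition

open Equiv

variable {M : ℕ}

/-! ### Openers of centrally symmetric noncrossing partitions -/

/-- The antipode of a point on a circle with an even number of points. -/
def antipode (p : Fin M) : Fin M := ⟨(p + M / 2) % M, Nat.mod_lt _ (by have := p.2; omega)⟩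

theorem val_antipode (hM : Even M) (p : Fin M) :
    (antipode p : ℕ) = if (p : ℕ) < M / 2 then p + M / 2 else p - M / 2 := by
  obtain ⟨m, hm⟩ := hM
  have := p.2
  simp only [antipode]
  split_ifs
  · rw [Nat.mod_eq_of_lt (by omega)]
  · rw [Nat.mod_eq_sub_mod (by omega), Nat.mod_eq_of_lt (by omega)]; omega

theorem antipode_antipode (hM : Even M) (p : Fin M) : antipode (antipode p) = p := by
  have := p.2
  obtain ⟨m, hm⟩ := id hM
  apply Fin.ext
  simp only [val_antipode hM]
  split_ifs <;> omega

theorem cdist_antipode (hM : Even M) (p q : Fin M) :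
    cdist p (antipode q) = if cdist p q < M / 2 then cdist p q + M / 2 else cdist p q - M / 2 := by
  have := p.2; have := q.2
  obtain ⟨m, hm⟩ := id hM
  simp only [cdist, val_antipode hM]
  split_ifs <;> omega

theorem cdist_antipode_antipode (hM : Even M) (p q : Fin M) :
    cdist (antipode p) (antipode q) = cdist p q := by
  have := p.2; have := q.2
  obtain ⟨m, hm⟩ := id hM
  simp only [cdist, val_antipode hM]
  split_ifs <;> omega

/-- Centrally symmetric noncrossing partitions of a circle with `M` points. -/
structure IsSymmNC (π : Setoid (Fin M)) : Prop where
  even : Even M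
  noncrossing : ∀ {a b x y}, π a b → π x y → cdist a x ≤ cdist a b → cdist a b ≤ cdist a y → π x b
  symm : ∀ {a b}, π a b → π (antipode a) (antipode b)

/-- `p` opens its block if the block is contained in the half circle starting clockwise at `p`. -/
def IsOpener (π : Setoid (Fin M)) (p : Fin M) : Prop := ∀ q, π p q → cdist p q < M / 2

theorem IsOpener.not_antipode {π : Setoid (Fin M)} (hM : Even M) {p : Fin M} (hp : IsOpener π p)
    {q : Fin M} (hq : π p q) : ¬ π q (antipode q) := by
  intro h
  have h1 := hp _ hq
  have h2 := hp _ (π.trans' hq h)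
  rw [cdist_antipode hM, if_pos h1] at h2
  omega

theorem IsOpener.unique {π : Setoid (Fin M)} {p q : Fin M} (hp : IsOpener π p)
    (hq : IsOpener π q) (h : π p q) : p = q := by
  have h1 := hp _ h
  have h2 := hq _ (π.symm' h)
  have := p.2; have := q.2
  apply Fin.ext
  simp only [cdist] at h1 h2
  split_ifs at * <;> omega

open scoped Classical in
/-- The size of the block opened by `p`, and zero if `p` opens no block. -/
noncomputable def openSize (π : Setoid (Fin M)) (p : Fin M) : ℕ :=
  if IsOpener π p then (Finset.univ.filter fun q => π p q).card else 0

/-- The points from `p` clockwise to `q`. -/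
def window (p q : Fin M) : Finset (Fin M) :=
  Finset.univ.filter fun r => cdist p r ≤ cdist p q

theorem mem_window {p q r : Fin M} :
    r ∈ window p q ↔ cdist p r ≤ cdist p q := by
  simp [window]

theorem card_filter_cdist_lt {p : Fin M} {m : ℕ} (hm : m ≤ M) :
    (Finset.univ.filter fun r => cdist p r < m).card = m := by
  refine (Finset.card_bij' (t := Finset.range m) (fun r _ => cdist p r)
    (fun j hj => ⟨if p + j < M then p + j else p + j - M, by
      have := p.2; have := Finset.mem_range.mp hj; split_ifs <;> omega⟩) ?_ ?_ ?_ ?_).trans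
    (Finset.card_range m)
  · intro r hr; simpa using hr
  · intro j hj
    have := p.2; have := Finset.mem_range.mp hj
    refine Finset.mem_filter.mpr ⟨Finset.mem_univ _, ?_⟩
    simp only [cdist]
    split_ifs <;> omega
  · intro r hr
    have := p.2; have := r.2
    apply Fin.ext
    simp only [cdist]
    split_ifs <;> omega
  · intro j hj
    have := p.2; have := Finset.mem_range.mp hj
    simp only [cdist]
    split_ifs <;> omega

theorem card_window (p q : Fin M) : (window p q).card = cdist p q + 1 := by
  rw [← card_filter_cdist_lt (p := p) (m := cdist p q + 1) (cdist_lt p q), window]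
  simp only [Nat.lt_succ_iff]

namespace IsSymmNC

variable {π : Setoid (Fin M)}

/-- The opener is the first element of the block met clockwise from the antipode of `a`. If the
block left the half circle starting there, it would cross its antipodal image and hence coincide
with it. -/
theorem exists_opener (hπ : IsSymmNC π) {a : Fin M} (ha : ¬ π a (antipode a)) :
    ∃ p, π a p ∧ IsOpener π p := by
  classical
  obtain ⟨j, hj, hmin⟩ := Finset.exists_min_image (Finset.univ.filter fun j => π a j)
    (fun j => cdist (antipode a) j) ⟨a, by simp⟩
  simp only [Finset.mem_filter, Finset.mem_univ, true_and] at hj hmin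
  refine ⟨j, hj, fun b hb => ?_⟩
  have hab := π.trans' hj hb
  by_contra hlt
  have h0 : cdist (antipode a) a = M / 2 := by
    have := cdist_antipode hπ.even (antipode a) a
    rw [cdist_self] at this
    have := cdist_lt (antipode a) a
    obtain ⟨m, hm⟩ := hπ.even
    split_ifs at * <;> omega
  have h1 := hmin a (π.refl' a)
  have h2 := hmin b hab
  have h3 := cdist_lt (antipode a) b
  rw [cdist_eq_sub h2] at hlt
  have h4 := cdist_antipode hπ.even (antipode a) b
  rw [if_neg (by omega)] at h4
  obtain ⟨m, hm⟩ := hπ.even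
  have h5 := hπ.noncrossing (hπ.symm hab) (π.symm' hj) (by omega) (by omega)
  exact ha (π.trans' hj (π.trans' h5 (π.symm' (hπ.symm hab))))

/-- Two diameters always cross. -/
theorem zero_unique (hπ : IsSymmNC π) {a b : Fin M} (ha : π a (antipode a))
    (hb : π b (antipode b)) : π a b := by
  have h1 := cdist_antipode hπ.even a a
  rw [cdist_self] at h1
  have h2 := cdist_antipode hπ.even a b
  obtain ⟨m, hm⟩ := id hπ.even
  have := a.2
  have h3 := cdist_lt a b
  rw [if_pos (by omega)] at h1
  rcases lt_or_ge (cdist a b) (M / 2) with h | h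
  · rw [if_pos h] at h2
    have := hπ.noncrossing ha hb (by omega) (by omega)
    exact π.symm' (π.trans' this (π.symm' ha))
  · rw [if_neg (by omega)] at h2
    have := hπ.noncrossing ha (π.symm' hb) (by omega) (by omega)
    exact π.symm' (π.trans' hb (π.trans' this (π.symm' ha)))

/-- The blocks opened in the window from the opener of `q` to `q` fill that window. -/
theorem le_sum_window (hπ : IsSymmNC π) {p q : Fin M} (hp : IsOpener π p) (hpq : π p q) :
    cdist p q + 1 ≤ ∑ r ∈ window p q, openSize π r := by
  classical
  have hlt := hp q hpq
  have hsub : window p q ⊆ (window p q).biUnion fun r =>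
      if IsOpener π r then Finset.univ.filter fun z => π r z else ∅ := by
    intro x hx
    rw [mem_window] at hx
    suffices h : ∃ p' ∈ window p q, IsOpener π p' ∧ π p' x by
      obtain ⟨p', h1, h2, h3⟩ := h
      refine Finset.mem_biUnion.mpr ⟨p', h1, ?_⟩
      rw [if_pos h2]
      simpa using h3
    by_cases hxp : π p x
    · exact ⟨p, mem_window.mpr (by rw [cdist_self]; omega), hp, hxp⟩
    -- By noncrossing, a block other than that of `p` which meets the window is confined to it. The
    -- window is shorter than a half circle, so this block is not the zero block, and its opener
    -- lies in the window as well.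
    have hcls : ∀ z, π x z → cdist p z ≤ cdist p q := by
      intro z hz
      by_contra hcon
      exact hxp (π.trans' hpq (π.symm' (hπ.noncrossing hpq hz hx (by omega))))
    have hx0 : ¬ π x (antipode x) := by
      intro h
      have h1 := hcls _ h
      rw [cdist_antipode hπ.even, if_pos (by omega)] at h1
      omega
    obtain ⟨p', h1, h2⟩ := hπ.exists_opener hx0
    exact ⟨p', mem_window.mpr (hcls _ h1), h2, π.symm' h1⟩
  rw [← card_window]
  refine (Finset.card_le_card hsub).trans (Finset.card_biUnion_le.trans
    (Finset.sum_le_sum fun r _ => ?_))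
  unfold openSize
  split_ifs <;> simp

/-- The blocks opened in a window ending at `q` and not containing the opener of `q` lie in that
window. -/
theorem sum_window_le (hπ : IsSymmNC π) {p q : Fin M} (hlt : cdist p q < M / 2)
    (hno : ∀ r ∈ window p q, IsOpener π r → ¬ π r q) :
    ∑ r ∈ window p q, openSize π r ≤ cdist p q := by
  classical
  have hM := hπ.even
  have hin : ∀ r ∈ window p q, IsOpener π r → ∀ z, π r z → cdist p z < cdist p q := by
    intro r hr hro z hz
    have hrq := hno r hr hro
    rw [mem_window] at hr
    have hz1 := hro z hz
    have hrq' := cdist_eq_sub hr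
    suffices h : cdist r z < cdist r q by
      have := p.2; have := q.2; have := r.2; have := z.2
      simp only [cdist] at *
      split_ifs at * <;> omega
    by_contra hcon
    -- A block opened at `r` and reaching past `q` would cross the block of `q`. The witness beyond
    -- `z` is the antipode of `q` if `q` is in the zero block, and otherwise the opener of `q`,
    -- which lies outside the window.
    obtain ⟨y, hy, hzy⟩ : ∃ y, π q y ∧ cdist r z ≤ cdist r y := by
      by_cases hq : π q (antipode q)
      · refine ⟨_, hq, ?_⟩
        rw [cdist_antipode hM]
        split_ifs <;> omega
      · obtain ⟨p', h1, h2⟩ := hπ.exists_opener hq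
        refine ⟨p', h1, ?_⟩
        have h3 := h2 q (π.symm' h1)
        have h4 : ¬ cdist p p' ≤ cdist p q := fun h => hno p' (mem_window.mpr h) h2 (π.symm' h1)
        obtain ⟨m, hm⟩ := hM
        have := p.2; have := q.2; have := r.2; have := z.2; have := p'.2
        clear hno hrq hz hro h1 h2 hq hπ
        simp only [cdist] at *
        split_ifs at * <;> omega
    exact hrq (π.trans' hz (π.symm' (hπ.noncrossing hz hy (by omega) hzy)))
  have hsum : ∑ r ∈ window p q, openSize π r =
      ((window p q).biUnion fun r =>
        if IsOpener π r then Finset.univ.filter fun z => π r z else ∅).card := by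
    rw [Finset.card_biUnion]
    · refine Finset.sum_congr rfl fun r _ => ?_
      unfold openSize
      split_ifs <;> simp
    · intro r _ r' _ hne
      rw [Function.onFun]
      split_ifs with h1 h2 <;> try simp
      rw [Finset.disjoint_left]
      intro z hz hz'
      simp only [Finset.mem_filter, Finset.mem_univ, true_and] at hz hz'
      exact hne (h1.unique h2 (π.trans' hz (π.symm' hz')))
  rw [hsum, ← card_filter_cdist_lt (p := p) (m := cdist p q) (cdist_lt p q).le]
  refine Finset.card_le_card fun z hz => ?_
  obtain ⟨r, hr, hz⟩ := Finset.mem_biUnion.mp hz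
  split_ifs at hz with hro
  · simp only [Finset.mem_filter, Finset.mem_univ, true_and] at hz ⊢
    exact hin r hr hro z hz
  · simp at hz

/-- The blocks of `π` opened from `p` to `q` fill this window. With the same sizes, `π'` must also
have an opener `r` in the window whose block contains `q`. Exchanging the roles puts `p` in the
window from `r` to `q`, so `r = p`. -/
theorem opener_of_openSize_eq {π' : Setoid (Fin M)} (hπ : IsSymmNC π) (hπ' : IsSymmNC π')
    (h : ∀ p, openSize π p = openSize π' p) {p q : Fin M} (hp : IsOpener π p) (hpq : π p q) :
    IsOpener π' p ∧ π' p q := by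
  have key : ∀ {π π' : Setoid (Fin M)}, IsSymmNC π → IsSymmNC π' →
      (∀ p, openSize π p = openSize π' p) → ∀ {p q : Fin M}, IsOpener π p → π p q →
      ∃ r ∈ window p q, IsOpener π' r ∧ π' r q := by
    intro π π' hπ hπ' h p q hp hpq
    by_contra hno
    have h1 := hπ.le_sum_window hp hpq
    have h2 := hπ'.sum_window_le (hp q hpq) fun r hr hr' hr'' => hno ⟨r, hr, hr', hr''⟩
    simp only [h] at h1
    omega
  obtain ⟨r, hr, h1, h2⟩ := key hπ hπ' h hp hpq
  obtain ⟨p', hp', h3, h4⟩ := key hπ' hπ (fun p => (h p).symm) h1 h2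
  obtain rfl := h3.unique hp (π.trans' h4 (π.symm' hpq))
  have : p' = r := by
    rw [mem_window] at hr hp'
    have := q.2; have := r.2; have := p'.2
    apply Fin.ext
    simp only [cdist] at hr hp'
    split_ifs at * <;> omega
  subst this
  exact ⟨h1, h2⟩

/-- A centrally symmetric noncrossing partition is determined by the sizes of the blocks opened
at the various points. -/
theorem eq_of_openSize_eq {π' : Setoid (Fin M)} (hπ : IsSymmNC π) (hπ' : IsSymmNC π')
    (h : ∀ p, openSize π p = openSize π' p) : π = π' := by
  have key : ∀ {π π' : Setoid (Fin M)}, IsSymmNC π → IsSymmNC π' →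
      (∀ p, openSize π p = openSize π' p) → ∀ {a b : Fin M}, π a b → π' a b := by
    intro π π' hπ hπ' h a b hab
    by_cases ha : π a (antipode a)
    · have hb : π b (antipode b) := π.trans' (π.symm' hab) (π.trans' ha (hπ.symm hab))
      have zero : ∀ {a}, π a (antipode a) → π' a (antipode a) := by
        intro a ha
        by_contra hcon
        obtain ⟨p, h1, h2⟩ := hπ'.exists_opener hcon
        obtain ⟨h3, h4⟩ := hπ'.opener_of_openSize_eq hπ (fun p => (h p).symm) h2 (π'.symm' h1)
        exact h3.not_antipode hπ.even h4 ha
      exact hπ'.zero_unique (zero ha) (zero hb)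
    · obtain ⟨p, h1, h2⟩ := hπ.exists_opener ha
      have h3 := (hπ.opener_of_openSize_eq hπ' h h2 (π.symm' h1)).2
      have h4 := (hπ.opener_of_openSize_eq hπ' h h2 (π.trans' (π.symm' h1) hab)).2
      exact π'.trans' (π'.symm' h3) h4
  exact Setoid.ext fun a b => ⟨key hπ hπ' h, key hπ' hπ fun p => (h p).symm⟩

end IsSymmNC

end CirclePartition

/-! ### Permutations of the circle defined by hyperoctahedral elements -/

namespace Hyperoct

open SignedIdx CirclePartition Equiv

variable {n : ℕ}

/-- The permutation of the circle `0, …, 2n - 1` defined by an element of `W`. -/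
def toPerm (n : ℕ) : Hyperoct n →* Perm (Fin (2 * n)) :=
  (pos n).permCongrHom.toMonoidHom.comp (Hyperoct n).subtype

theorem toPerm_pos (w : Hyperoct n) (a : SignedIdx n) : toPerm n w (pos n a) = pos n (w.1 a) := by
  change pos n (w.1 ((pos n).symm (pos n a))) = _
  rw [Equiv.symm_apply_apply]

theorem toPerm_injective : Function.Injective (toPerm n) := by
  intro u v h
  refine Subtype.ext (Equiv.ext fun a => (pos n).injective ?_)
  rw [← toPerm_pos, ← toPerm_pos, h]

theorem toPerm_coxeter : toPerm n (coxeter n) = finRotate (2 * n) := by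
  refine Equiv.ext fun p => ?_
  obtain ⟨a, rfl⟩ := (pos n).surjective p
  rw [toPerm_pos]
  change pos n ((pos n).symm (finRotate (2 * n) (pos n a))) = _
  rw [Equiv.apply_symm_apply]

theorem pos_neg_eq_antipode (a : SignedIdx n) : pos n (neg a) = antipode (pos n a) := by
  apply Fin.ext
  rw [pos_neg]
  simp [antipode]

theorem toPerm_antipode (w : Hyperoct n) (p : Fin (2 * n)) :
    toPerm n w (antipode p) = antipode (toPerm n w p) := by
  obtain ⟨a, rfl⟩ := (pos n).surjective p
  rw [← pos_neg_eq_antipode, toPerm_pos, toPerm_pos, apply_neg, pos_neg_eq_antipode]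

theorem neg_injective : Function.Injective (neg (n := n)) := fun a b h => by
  simpa using congrArg neg h

theorem neg_ne_self (a : SignedIdx n) : neg a ≠ a := by
  rcases a with a | a <;> simp [neg]

theorem neg_eq_iff {a b : SignedIdx n} : neg a = b ↔ a = neg b :=
  ⟨fun h => by rw [← h, SignedIdx.neg_neg], fun h => by rw [h, SignedIdx.neg_neg]⟩

theorem inv_apply_self (w : Hyperoct n) (a : SignedIdx n) : w⁻¹.1 (w.1 a) = a :=
  w.1.symm_apply_apply a

theorem apply_inv_self (w : Hyperoct n) (a : SignedIdx n) : w.1 (w⁻¹.1 a) = a :=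
  w.1.apply_symm_apply a

theorem coord_reflRep (w : Hyperoct n) (v : Fin n → ℂ) (a : SignedIdx n) :
    coord (reflRep n w v) a = coord v (w⁻¹.1 a) :=
  coord_apply w⁻¹ v a

theorem coord_injective {u v : Fin n → ℂ} (h : ∀ a, coord u a = coord v a) : u = v :=
  funext fun i => h (Sum.inl i)

theorem mem_fixedSpace_iff (w : Hyperoct n) (v : Fin n → ℂ) :
    v ∈ fixedSpace w ↔ ∀ a, coord v (w.1 a) = coord v a := by
  rw [mem_fixedSpace]
  constructor
  · intro h a
    have e := coord_reflRep w v (w.1 a)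
    rwa [h, inv_apply_self] at e
  · intro h
    refine coord_injective fun a => ?_
    rw [coord_reflRep, ← h, apply_inv_self]

/-! ### Reflections -/

/-- The reflection exchanging `a` and `b`, where `b ≠ a`. -/
def reflPerm (a b : SignedIdx n) : Hyperoct n where
  val := if b = neg a then swap a b else swap a b * swap (neg a) (neg b)
  property := by
    intro x
    have e1 := neg_ne_self a
    have e2 := neg_ne_self b
    have e3 := SignedIdx.neg_neg a
    have e4 := SignedIdx.neg_neg b
    have e5 := SignedIdx.neg_neg x
    split_ifs with h
    · subst h
      simp only [swap_apply_def]
      grind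
    · simp only [Perm.mul_apply, swap_apply_def]
      grind (splits := 30)

theorem reflPerm_apply {a b : SignedIdx n} (x : SignedIdx n) :
    (reflPerm a b).1 x = if x = a then b else if x = b then a else
      if x = neg a then neg b else if x = neg b then neg a else x := by
  have e1 := neg_ne_self a
  have e2 := neg_ne_self b
  have e3 := SignedIdx.neg_neg a
  have e4 := SignedIdx.neg_neg b
  change (if b = neg a then swap a b else swap a b * swap (neg a) (neg b)) x = _
  split_ifs with h
  all_goals simp only [Perm.mul_apply, swap_apply_def]
  all_goals grind

theorem reflPerm_mul_self (a b : SignedIdx n) : reflPerm a b * reflPerm a b = 1 := by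
  refine Subtype.ext (Equiv.ext fun x => ?_)
  change (reflPerm a b).1 ((reflPerm a b).1 x) = x
  have e1 := neg_ne_self a
  have e2 := neg_ne_self b
  have e3 := SignedIdx.neg_neg a
  have e4 := SignedIdx.neg_neg b
  rw [reflPerm_apply x]
  split_ifs <;> rw [reflPerm_apply] <;> grind

theorem reflPerm_inv (a b : SignedIdx n) : (reflPerm a b)⁻¹ = reflPerm a b :=
  inv_eq_of_mul_eq_one_left (reflPerm_mul_self a b)

theorem isRefl_reflPerm {a b : SignedIdx n} (h : a ≠ b) : IsRefl (reflPerm a b) := by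
  by_cases hb : b = neg a
  · refine Or.inr ⟨a, ?_⟩
    change (if b = neg a then swap a b else swap a b * swap (neg a) (neg b)) = _
    rw [if_pos hb, hb]
  · refine Or.inl ⟨a, b, h, fun e => hb (by rw [e, SignedIdx.neg_neg]), ?_⟩
    change (if b = neg a then swap a b else swap a b * swap (neg a) (neg b)) = _
    rw [if_neg hb]

theorem IsRefl.exists_eq_reflPerm {t : Hyperoct n} (ht : IsRefl t) :
    ∃ a b, a ≠ b ∧ t = reflPerm a b := by
  rcases ht with ⟨a, b, h1, h2, h3⟩ | ⟨a, h⟩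
  · refine ⟨a, b, h1, Subtype.ext ?_⟩
    change _ = if b = neg a then swap a b else swap a b * swap (neg a) (neg b)
    rw [if_neg (fun e => h2 (by rw [e, SignedIdx.neg_neg])), h3]
  · refine ⟨a, neg a, (neg_ne_self a).symm, Subtype.ext ?_⟩
    change _ = if neg a = neg a then swap a (neg a) else swap a (neg a) * swap (neg a) (neg (neg a))
    rw [if_pos rfl, h]

theorem mem_fixedSpace_reflPerm {a b : SignedIdx n} {v : Fin n → ℂ}
    (h : coord v a = coord v b) : v ∈ fixedSpace (reflPerm a b) := by
  rw [mem_fixedSpace_iff]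
  intro x
  rw [reflPerm_apply]
  split_ifs with h1 h2 h3 h4
  · rw [h1, h]
  · rw [h2, h]
  · rw [h3, coord_neg, coord_neg, h]
  · rw [h4, coord_neg, coord_neg, h]
  · rfl

/-! ### Cycles and reflection length -/

theorem toPerm_reflPerm_of_eq (a : SignedIdx n) :
    toPerm n (reflPerm a (neg a)) = swap (pos n a) (pos n (neg a)) := by
  have : (reflPerm a (neg a)).1 = swap a (neg a) := if_pos rfl
  change ((pos n).symm.trans (reflPerm a (neg a)).1).trans (pos n) = _
  rw [this, Equiv.symm_trans_swap_trans]

theorem toPerm_reflPerm_of_ne {a b : SignedIdx n} (h : b ≠ neg a) :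
    toPerm n (reflPerm a b) = swap (pos n a) (pos n b) * swap (pos n (neg a)) (pos n (neg b)) := by
  have : (reflPerm a b).1 = swap a b * swap (neg a) (neg b) := if_neg h
  refine Equiv.ext fun p => ?_
  obtain ⟨x, rfl⟩ := (pos n).surjective p
  rw [toPerm_pos, this, Perm.mul_apply, Perm.mul_apply, (pos n).injective.map_swap,
    (pos n).injective.map_swap]

/-- On the circle a reflection is one transposition or a product of two. -/
theorem numCycles_le_refl_mul {t : Hyperoct n} (ht : IsRefl t) (w : Hyperoct n) :
    numCycles (toPerm n w) ≤ numCycles (toPerm n (t * w)) + 2 := by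
  obtain ⟨a, b, -, rfl⟩ := ht.exists_eq_reflPerm
  rw [map_mul]
  by_cases h : b = neg a
  · subst h
    rw [toPerm_reflPerm_of_eq]
    have := numCycles_le_swap_mul (toPerm n w) (pos n a) (pos n (neg a))
    omega
  · rw [toPerm_reflPerm_of_ne h, mul_assoc]
    have h1 := numCycles_le_swap_mul (toPerm n w) (pos n (neg a)) (pos n (neg b))
    have h2 := numCycles_le_swap_mul (swap (pos n (neg a)) (pos n (neg b)) * toPerm n w)
      (pos n a) (pos n b)
    omega

/-- Self-opposite cycles make this inequality strict, which is why its later uses end with a parity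
argument. -/
theorem le_numCycles_add (w : Hyperoct n) : 2 * n ≤ numCycles (toPerm n w) + 2 * reflLength w := by
  obtain ⟨l, hl, rfl, hlen⟩ := exists_reduced_word w
  rw [← hlen]
  clear hlen
  induction l with
  | nil => simp [numCycles_one]
  | cons t l ih =>
    have h1 := ih fun s hs => hl s (List.mem_cons_of_mem _ hs)
    have h2 := numCycles_le_refl_mul (hl t (by simp)) l.prod
    rw [List.prod_cons, List.length_cons]
    omega

/-! ### Carter's description of the reflection length -/

theorem reflLength_reflPerm_mul_le {a b : SignedIdx n} (h : a ≠ b) (w : Hyperoct n) :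
    reflLength (reflPerm a b * w) ≤ reflLength w + 1 := by
  refine (reflLength_mul_le _ _).trans ?_
  have := reflLength_le [reflPerm a b] (by simpa using isRefl_reflPerm h)
  simp only [List.prod_cons, List.prod_nil, mul_one, List.length_cons, List.length_nil] at this
  omega

theorem mem_fixedSpace_mul {t w : Hyperoct n} {v : Fin n → ℂ} (ht : v ∈ fixedSpace t)
    (hw : v ∈ fixedSpace w) : v ∈ fixedSpace (t * w) := by
  rw [mem_fixedSpace] at *
  rw [map_mul, Module.End.mul_apply, hw, ht]

/-- The signed coordinate as a linear form. -/
def coordForm (a : SignedIdx n) : (Fin n → ℂ) →ₗ[ℂ] ℂ where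
  toFun v := coord v a
  map_add' u v := coord_add u v a
  map_smul' c v := coord_smul c v a

/-- Within `V^w`, the equation `x_a = x_b` cuts out a subspace of codimension at most one that both
factors fix. -/
theorem finrank_fixedSpace_le (a b : SignedIdx n) (w : Hyperoct n) :
    Module.finrank ℂ (fixedSpace w) ≤ Module.finrank ℂ (fixedSpace (reflPerm a b * w)) + 1 := by
  let φ : fixedSpace w →ₗ[ℂ] ℂ := (coordForm a - coordForm b).domRestrict (fixedSpace w)
  have h1 := φ.finrank_range_add_finrank_ker
  have h2 : Module.finrank ℂ (LinearMap.range φ) ≤ 1 :=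
    (Submodule.finrank_le _).trans (Module.finrank_self ℂ).le
  have h3 : (LinearMap.ker φ).map (fixedSpace w).subtype ≤ fixedSpace (reflPerm a b * w) := by
    rintro _ ⟨v, hv, rfl⟩
    have hv' : coord v.1 a - coord v.1 b = 0 := hv
    exact mem_fixedSpace_mul (mem_fixedSpace_reflPerm (sub_eq_zero.mp hv')) v.2
  have h4 := Submodule.finrank_mono h3
  rw [Submodule.finrank_map_subtype_eq] at h4
  omega

theorem fixedSpace_one : fixedSpace (1 : Hyperoct n) = ⊤ := by
  ext v; simp [mem_fixedSpace]

theorem le_finrank_add_reflLength (w : Hyperoct n) :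
    n ≤ Module.finrank ℂ (fixedSpace w) + reflLength w := by
  obtain ⟨l, hl, rfl, hlen⟩ := exists_reduced_word w
  rw [← hlen]
  clear hlen
  induction l with
  | nil => rw [List.prod_nil, fixedSpace_one]; simp
  | cons t l ih =>
    have h1 := ih fun s hs => hl s (List.mem_cons_of_mem _ hs)
    obtain ⟨a, b, -, rfl⟩ := (hl t (by simp)).exists_eq_reflPerm
    have h2 := finrank_fixedSpace_le a b l.prod
    rw [List.prod_cons, List.length_cons]
    omega

theorem coord_single (i : Fin n) (a : SignedIdx n) (b : SignedIdx n) (hb : b = Sum.inl i) :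
    coord (Pi.single i 1) a = if a = b then 1 else if a = neg b then -1 else 0 := by
  subst hb
  rcases a with j | j <;> simp [coord, neg, Pi.single_apply]
  split_ifs <;> simp

theorem finrank_add_reflLength_le (m : ℕ) : ∀ w : Hyperoct n,
    n ≤ Module.finrank ℂ (fixedSpace w) + m →
      Module.finrank ℂ (fixedSpace w) + reflLength w ≤ n := by
  induction m with
  | zero =>
    intro w hw
    have h1 : fixedSpace w = ⊤ := by
      refine Submodule.eq_top_of_finrank_eq (le_antisymm (Submodule.finrank_le _) ?_)
      simpa using hw
    have h2 : w = 1 := by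
      refine Subtype.ext (Equiv.ext fun x => ?_)
      have key : ∀ i : Fin n, w.1 (Sum.inl i) = Sum.inl i := by
        intro i
        have h3 : (Pi.single i 1 : Fin n → ℂ) ∈ fixedSpace w := by rw [h1]; trivial
        have h4 := (mem_fixedSpace_iff w _).mp h3 (Sum.inl i)
        rw [coord_single i _ _ rfl, coord_single i _ _ rfl, if_pos rfl] at h4
        by_contra hne
        rw [if_neg hne] at h4
        split_ifs at h4
        · norm_num at h4
        · norm_num at h4
      rcases x with i | i
      · exact key i
      · change w.1 (neg (Sum.inl i)) = _
        rw [apply_neg, key]; rfl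
    subst h2
    rw [h1, reflLength_one]
    simp
  | succ m ih =>
    intro w hw
    by_cases hw1 : w = 1
    · subst hw1
      rw [fixedSpace_one, reflLength_one]
      simp
    obtain ⟨i, hi⟩ : ∃ i : Fin n, w.1 (Sum.inl i) ≠ Sum.inl i := by
      by_contra hcon
      push Not at hcon
      refine hw1 (Subtype.ext (Equiv.ext fun x => ?_))
      rcases x with i | i
      · exact hcon i
      · change w.1 (neg (Sum.inl i)) = _
        rw [apply_neg, hcon]; rfl
    -- `t` brings `w(i)` back to `i`, so `t * w` fixes `e_i` in addition to `V^w`, and the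
    -- codimension drops.
    set t := reflPerm (w.1 (Sum.inl i)) (Sum.inl i) with ht
    have hlt : fixedSpace w < fixedSpace (t * w) := by
      refine lt_of_le_of_ne (fun v hv => mem_fixedSpace_mul (mem_fixedSpace_reflPerm
        ((mem_fixedSpace_iff w v).mp hv _)) hv) fun e => ?_
      have h3 : (Pi.single i 1 : Fin n → ℂ) ∈ fixedSpace (t * w) := by
        rw [mem_fixedSpace_iff]
        have h0 : (t * w).1 (Sum.inl i) = Sum.inl i := by
          change t.1 (w.1 (Sum.inl i)) = _
          rw [reflPerm_apply, if_pos rfl]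
        intro x
        rw [coord_single i _ _ rfl, coord_single i _ _ rfl]
        have e1 : (t * w).1 x = Sum.inl i ↔ x = Sum.inl i :=
          ⟨fun h => (t * w).1.injective (h.trans h0.symm), fun h => h ▸ h0⟩
        have e2 : (t * w).1 x = neg (Sum.inl i) ↔ x = neg (Sum.inl i) := by
          have h0' : (t * w).1 (neg (Sum.inl i)) = neg (Sum.inl i) := by rw [apply_neg, h0]
          exact ⟨fun h => (t * w).1.injective (h.trans h0'.symm), fun h => h ▸ h0'⟩
        simp only [e1, e2]
      rw [← e, mem_fixedSpace_iff] at h3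
      have h4 := h3 (Sum.inl i)
      rw [coord_single i _ _ rfl, coord_single i _ _ rfl, if_pos rfl, if_neg hi] at h4
      split_ifs at h4
      · norm_num at h4
      · norm_num at h4
    have h1 := Submodule.finrank_lt_finrank_of_lt hlt
    have h2 := ih (t * w) (by omega)
    have h3 := reflLength_reflPerm_mul_le hi (t * w)
    rw [← mul_assoc, ← ht, reflPerm_mul_self, one_mul] at h3
    omega

/-- Carter: the reflection length is the codimension of the fixed space. -/
theorem finrank_add_reflLength (w : Hyperoct n) :
    Module.finrank ℂ (fixedSpace w) + reflLength w = n :=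
  le_antisymm (finrank_add_reflLength_le n w (by omega)) (le_finrank_add_reflLength w)

/-! ### The parity of the reflection length -/

/-- The absolute value of a signed index. -/
def absIdx : SignedIdx n → Fin n := Sum.elim id id

theorem absIdx_neg (a : SignedIdx n) : absIdx (neg a) = absIdx a := by
  rcases a with a | a <;> rfl

theorem absIdx_apply_congr (w : Hyperoct n) {a b : SignedIdx n} (h : absIdx a = absIdx b) :
    absIdx (w.1 a) = absIdx (w.1 b) := by
  have : a = b ∨ a = neg b := by
    rcases a with a | a <;> rcases b with b | b <;> simpa [absIdx, neg] using h
  rcases this with rfl | rfl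
  · rfl
  · rw [apply_neg, absIdx_neg]

/-- The permutation of `[n]` obtained from a signed permutation by forgetting the signs. -/
def absPerm (n : ℕ) : Hyperoct n →* Perm (Fin n) where
  toFun w :=
    { toFun := fun i => absIdx (w.1 (Sum.inl i))
      invFun := fun i => absIdx (w⁻¹.1 (Sum.inl i))
      left_inv := fun i => by
        change absIdx (w⁻¹.1 (Sum.inl (absIdx (w.1 (Sum.inl i))))) = i
        rw [absIdx_apply_congr w⁻¹ (a := Sum.inl (absIdx (w.1 (Sum.inl i)))) (b := w.1 (Sum.inl i)) rfl, inv_apply_self]; rfl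
      right_inv := fun i => by
        change absIdx (w.1 (Sum.inl (absIdx (w⁻¹.1 (Sum.inl i))))) = i
        rw [absIdx_apply_congr w (a := Sum.inl (absIdx (w⁻¹.1 (Sum.inl i)))) (b := w⁻¹.1 (Sum.inl i)) rfl, apply_inv_self]; rfl }
  map_one' := Equiv.ext fun i => rfl
  map_mul' u v := Equiv.ext fun i => absIdx_apply_congr u (a := v.1 (Sum.inl i)) rfl

/-- The sign character of `W`. -/
noncomputable def signChar (n : ℕ) : Hyperoct n →* ℤˣ :=
  (Perm.sign.comp (absPerm n)) * (Perm.sign.comp (Hyperoct n).subtype)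

/-- A sign change is trivial on absolute values and one transposition on signed indices; `((i,j))`
is one transposition on absolute values and two on signed indices. The product of the two signs is
`-1` in both cases. -/
theorem signChar_reflPerm {a b : SignedIdx n} (h : a ≠ b) : signChar n (reflPerm a b) = -1 := by
  change Perm.sign (absPerm n (reflPerm a b)) * Perm.sign (reflPerm a b).1 = -1
  by_cases hb : b = neg a
  · have h1 : absPerm n (reflPerm a b) = 1 := by
      refine Equiv.ext fun i => ?_
      change absIdx ((reflPerm a b).1 (Sum.inl i)) = i
      rw [reflPerm_apply, hb, SignedIdx.neg_neg]
      split_ifs with h1 h2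
      · rw [absIdx_neg, ← h1]; rfl
      · rw [← absIdx_neg, ← h2]; rfl
      · rfl
    have h2 : (reflPerm a b).1 = swap a b := if_pos hb
    rw [h1, h2, Perm.sign_swap h, map_one, one_mul]
  · have habs : absIdx a ≠ absIdx b := by
      rcases a with a | a <;> rcases b with b | b <;>
        simp only [absIdx, neg, Sum.elim_inl, Sum.elim_inr, id, ne_eq, Sum.inl.injEq, Sum.inr.injEq,
          Sum.swap_inl, Sum.swap_inr] at *
      · exact h
      · exact fun e => hb e.symm
      · exact fun e => hb e.symm
      · exact h
    have h1 : absPerm n (reflPerm a b) = swap (absIdx a) (absIdx b) := by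
      refine Equiv.ext fun i => ?_
      change absIdx ((reflPerm a b).1 (Sum.inl i)) = _
      rw [reflPerm_apply]
      have hi : ∀ {x : SignedIdx n}, Sum.inl i = x → i = absIdx x := fun h => congrArg absIdx h
      split_ifs with h1 h2 h3 h4
      · rw [hi h1, swap_apply_left]
      · rw [hi h2, swap_apply_right]
      · rw [hi h3, absIdx_neg, absIdx_neg, swap_apply_left]
      · rw [hi h4, absIdx_neg, absIdx_neg, swap_apply_right]
      · rw [swap_apply_of_ne_of_ne]
        · rfl
        all_goals
          intro e
          rcases a with a | a <;> rcases b with b | b <;> simp_all [absIdx, neg]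
    have h2 : (reflPerm a b).1 = swap a b * swap (neg a) (neg b) := if_neg hb
    rw [h1, h2, Perm.sign_swap habs, Perm.sign_mul, Perm.sign_swap h,
      Perm.sign_swap (fun e => h (neg_injective e))]
    rfl

theorem signChar_eq (w : Hyperoct n) : signChar n w = (-1) ^ reflLength w := by
  obtain ⟨l, hl, rfl, hlen⟩ := exists_reduced_word w
  rw [← hlen]
  clear hlen
  induction l with
  | nil => simp
  | cons t l ih =>
    have h1 := ih fun s hs => hl s (List.mem_cons_of_mem _ hs)
    obtain ⟨a, b, hab, rfl⟩ := (hl t (by simp)).exists_eq_reflPerm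
    rw [List.prod_cons, List.length_cons, map_mul, h1, signChar_reflPerm hab, pow_succ']

/-- A reflection whose hyperplane contains the fixed space of `w` lies below `w`. -/
theorem reflLength_reflPerm_mul {a b : SignedIdx n} (h : a ≠ b) {w : Hyperoct n}
    (hw : fixedSpace w ≤ fixedSpace (reflPerm a b)) :
    reflLength (reflPerm a b * w) + 1 = reflLength w := by
  have h1 := finrank_add_reflLength w
  have h2 := finrank_add_reflLength (reflPerm a b * w)
  have h3 : fixedSpace w ≤ fixedSpace (reflPerm a b * w) :=
    fun v hv => mem_fixedSpace_mul (hw hv) hv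
  have h4 := Submodule.finrank_mono h3
  -- The fixed space does not shrink, so the length does not grow; parity excludes equality, and one
  -- reflection lowers it by at most one.
  have h5 := signChar_eq (reflPerm a b * w)
  rw [map_mul, signChar_reflPerm h, signChar_eq w] at h5
  have h6 : reflLength (reflPerm a b * w) ≠ reflLength w := by
    intro e
    rw [e] at h5
    simp at h5
  have h7 := reflLength_reflPerm_mul_le h (reflPerm a b * w)
  rw [← mul_assoc, reflPerm_mul_self, one_mul] at h7
  omega

end Hyperoct

/-! ### Shuffles of permutations -/

namespace CirclePartition

open Equiv

/-- The shuffle of permutations: `(a - 1) k + i ↦ (w_i(a) - 1) k + i`. -/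
def shufflePerm {N k : ℕ} (w : Fin k → Perm (Fin N)) : Perm (Fin (N * k)) :=
  finProdFinEquiv.permCongr
    { toFun := fun p => (w p.2 p.1, p.2)
      invFun := fun p => ((w p.2)⁻¹ p.1, p.2)
      left_inv := fun p => by simp
      right_inv := fun p => by simp }

variable {N k : ℕ}

theorem shufflePerm_apply (w : Fin k → Perm (Fin N)) (p : Fin (N * k)) :
    shufflePerm w p = finProdFinEquiv (w p.modNat p.divNat, p.modNat) := rfl

theorem divNat_finProdFinEquiv (x : Fin N × Fin k) : (finProdFinEquiv x).divNat = x.1 :=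
  congrArg Prod.fst (finProdFinEquiv.symm_apply_apply x)

theorem modNat_finProdFinEquiv (x : Fin N × Fin k) : (finProdFinEquiv x).modNat = x.2 :=
  congrArg Prod.snd (finProdFinEquiv.symm_apply_apply x)

theorem finProdFinEquiv_divNat_modNat (p : Fin (N * k)) :
    finProdFinEquiv (p.divNat, p.modNat) = p := finProdFinEquiv.apply_symm_apply p

theorem cycles_shufflePerm (w : Fin k → Perm (Fin N)) :
    cycles (shufflePerm w) = shuffle fun i => cycles (w i) := by
  refine Setoid.ext fun p q => ⟨fun h => ?_, fun h => ?_⟩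
  · have key := invariant_of_sameCycle
      (g := fun z => p.modNat = z.modNat ∧ (w p.modNat).SameCycle p.divNat z.divNat)
      (fun z hz => ?_) h
    · exact key.mp ⟨rfl, Perm.SameCycle.refl _ _⟩
    · rw [shufflePerm_apply, divNat_finProdFinEquiv, modNat_finProdFinEquiv]
      refine ⟨hz.1, hz.2.trans ?_⟩
      rw [← hz.1]
      exact sameCycle_apply _ _
  · obtain ⟨h1, h2⟩ : p.modNat = q.modNat ∧ (w p.modNat).SameCycle p.divNat q.divNat := h
    have key := invariant_of_sameCycle
      (g := fun z => (shufflePerm w).SameCycle p (finProdFinEquiv (z, p.modNat)))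
      (fun z hz => ?_) h2
    · have := key.mp (by rw [finProdFinEquiv_divNat_modNat])
      rwa [h1, finProdFinEquiv_divNat_modNat] at this
    · refine hz.trans ?_
      have := sameCycle_apply (shufflePerm w) (finProdFinEquiv (z, p.modNat))
      rwa [shufflePerm_apply, divNat_finProdFinEquiv, modNat_finProdFinEquiv] at this

theorem sum_numCycles_le (w : Fin k → Perm (Fin N)) :
    ∑ i, numCycles (w i) ≤ numCycles (shufflePerm w) := by
  simp only [numCycles]
  rw [← Nat.card_sigma]
  have hiff : ∀ (i : Fin k) (a b : Fin N), (w i).SameCycle a b ↔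
      (shufflePerm w).SameCycle (finProdFinEquiv (a, i)) (finProdFinEquiv (b, i)) := by
    intro i a b
    have h : (shuffle fun i => cycles (w i)) (finProdFinEquiv (a, i)) (finProdFinEquiv (b, i)) ↔
        (shufflePerm w).SameCycle (finProdFinEquiv (a, i)) (finProdFinEquiv (b, i)) := by
      rw [← cycles_shufflePerm]; rfl
    rw [← h]
    change _ ↔ (finProdFinEquiv (a, i)).modNat = (finProdFinEquiv (b, i)).modNat ∧
      (w (finProdFinEquiv (a, i)).modNat).SameCycle (finProdFinEquiv (a, i)).divNat
        (finProdFinEquiv (b, i)).divNat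
    simp only [divNat_finProdFinEquiv, modNat_finProdFinEquiv, true_and]
  refine Nat.card_le_card_of_injective (fun x => Quotient.lift
    (fun a => Quotient.mk (Perm.SameCycle.setoid (shufflePerm w)) (finProdFinEquiv (a, x.1)))
    (fun a b h => Quotient.sound ((hiff _ _ _).mp h)) x.2) ?_
  rintro ⟨i, x⟩ ⟨j, y⟩
  induction x using Quotient.inductionOn with
  | h a =>
  induction y using Quotient.inductionOn with
  | h b =>
  intro h
  have h1 : (shufflePerm w).SameCycle (finProdFinEquiv (a, i)) (finProdFinEquiv (b, j)) :=
    Quotient.exact h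
  have h2 : (shuffle fun i => cycles (w i)) (finProdFinEquiv (a, i)) (finProdFinEquiv (b, j)) := by
    rw [← cycles_shufflePerm]; exact h1
  have h3 : (finProdFinEquiv (a, i)).modNat = (finProdFinEquiv (b, j)).modNat := h2.1
  rw [modNat_finProdFinEquiv, modNat_finProdFinEquiv] at h3
  subst h3
  congr 1
  exact Quotient.sound ((hiff _ _ _).mpr h1)

theorem modNat_antipode (hN : Even N) (p : Fin (N * k)) : (antipode p).modNat = p.modNat := by
  obtain ⟨m, hm⟩ := hN
  apply Fin.ext
  simp only [Fin.modNat, antipode]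
  rw [Nat.mod_mul_left_mod, show N * k / 2 = m * k by
    rw [hm, ← two_mul, mul_assoc, Nat.mul_div_cancel_left _ two_pos], Nat.add_mul_mod_self_right]

theorem divNat_antipode (hN : Even N) (p : Fin (N * k)) :
    (antipode p).divNat = antipode p.divNat := by
  obtain ⟨m, hm⟩ := hN
  have hk : 0 < k := Nat.pos_of_ne_zero (by rintro rfl; exact absurd p.2 (by simp))
  apply Fin.ext
  simp only [Fin.divNat, antipode]
  rw [show N * k / 2 = m * k by
    rw [hm, ← two_mul, mul_assoc, Nat.mul_div_cancel_left _ two_pos],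
    Nat.mod_mul_left_div_self, Nat.add_mul_div_right _ _ hk, show N / 2 = m by omega]

end CirclePartition

/-! ### The circle permutations of a noncrossing multichain -/

namespace Hyperoct

open SignedIdx CirclePartition Equiv

variable {n k : ℕ}

theorem even_two_mul (n : ℕ) : Even (2 * n) := ⟨n, two_mul n⟩

theorem reflLength_coxeter_le : reflLength (coxeter n) ≤ n := by
  have := finrank_add_reflLength (coxeter n)
  omega

/-- The numbers of cycles of `u⁻¹ c` and `u` add up to at least `4 n - 2 ℓ_T(c) ≥ 2 n`, one less
than the genus bound; parity supplies the missing cycle. -/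
theorem AbsLE.isClockwise [NeZero n] {u : Hyperoct n} (h : AbsLE u (coxeter n)) :
    IsClockwise (toPerm n (u⁻¹ * coxeter n)) ∧ IsClockwise (toPerm n u) := by
  have hn := NeZero.pos n
  refine isClockwise_of_le_numCycles (by omega) ?_ ?_
  · rw [← map_mul, mul_inv_cancel_left, toPerm_coxeter]
  · have h1 := le_numCycles_add u
    have h2 := le_numCycles_add (u⁻¹ * coxeter n)
    have h3 := reflLength_coxeter_le (n := n)
    unfold AbsLE at h
    omega

theorem sameCycle_antipode {u : Hyperoct n} {x y : Fin (2 * n)}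
    (h : (toPerm n u).SameCycle x y) : (toPerm n u).SameCycle (antipode x) (antipode y) := by
  refine (invariant_of_sameCycle (g := fun z => (toPerm n u).SameCycle (antipode x) (antipode z))
    (fun z hz => ?_) h).mp (Perm.SameCycle.refl _ _)
  rw [← toPerm_antipode]
  exact hz.trans (sameCycle_apply _ _)

theorem isSymmNC_of_mul_eq {M : ℕ} (hM : Even M) {S P : Perm (Fin M)} (h : P * S = finRotate M)
    (hS : IsClockwise S) (hP : IsClockwise P)
    (hsymm : ∀ {a b}, P.SameCycle a b → P.SameCycle (antipode a) (antipode b)) :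
    IsSymmNC (cycles P) := by
  have hk := kreweras_cycles h (isNoncrossing_of_isClockwise h hS hP)
  refine ⟨hM, fun {a b x y} h1 h2 h3 h4 => ?_, hsymm⟩
  rw [← hk] at *
  exact kreweras_noncrossing h1 h2 h3 h4

theorem AbsLE.isSymmNC [NeZero n] {u : Hyperoct n} (h : AbsLE u (coxeter n)) :
    IsSymmNC (cycles (toPerm n u)) :=
  isSymmNC_of_mul_eq (S := toPerm n (u⁻¹ * coxeter n)) (even_two_mul n)
    (by rw [← map_mul, mul_inv_cancel_left, toPerm_coxeter]) h.isClockwise.1 h.isClockwise.2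
    sameCycle_antipode

theorem coord_eq_of_sameCycle {u : Hyperoct n} {v : Fin n → ℂ} (hv : v ∈ fixedSpace u)
    {a b : SignedIdx n} (h : (toPerm n u).SameCycle (pos n a) (pos n b)) :
    coord v a = coord v b := by
  have := (invariant_of_sameCycle (g := fun z => coord v a = coord v ((pos n).symm z))
    (fun z hz => ?_) h).mp (by rw [Equiv.symm_apply_apply])
  · rwa [Equiv.symm_apply_apply] at this
  · obtain ⟨x, rfl⟩ := (pos n).surjective z
    rw [toPerm_pos]
    rw [Equiv.symm_apply_apply] at hz ⊢
    rw [(mem_fixedSpace_iff u v).mp hv, hz]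

/-- For a general element of `W`, all self-opposite cycles would be merged, their coordinates being
zero on the fixed space. For noncrossing `u` there is at most one such cycle. -/
theorem AbsLE.flatPartition_iff [NeZero n] {u : Hyperoct n} (h : AbsLE u (coxeter n))
    {a b : SignedIdx n} : flatPartition (fixedSpace u) a b ↔
      (toPerm n u).SameCycle (pos n a) (pos n b) := by
  classical
  refine ⟨fun hab => ?_, fun hab v hv => coord_eq_of_sameCycle hv hab⟩
  have key : ∀ {a b : SignedIdx n}, flatPartition (fixedSpace u) a b →
      (toPerm n u).SameCycle (pos n a) (pos n b) ∨
        (toPerm n u).SameCycle (pos n a) (antipode (pos n a)) := by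
    intro a b hab
    by_contra hcon
    push Not at hcon
    obtain ⟨h1, h2⟩ := hcon
    -- The test vector is the indicator of the cycle of `a` minus that of the opposite cycle. It
    -- lies in `V^u` and separates `a` from `b` when `b` is not in the cycle of `a` and this cycle
    -- is not self-opposite.
    let A : SignedIdx n → Prop := fun x => (toPerm n u).SameCycle (pos n a) (pos n x)
    have hA : ∀ x, A (u.1 x) ↔ A x := fun x => by
      change (toPerm n u).SameCycle _ (pos n (u.1 x)) ↔ _
      rw [← toPerm_pos, Perm.sameCycle_apply_right]
    let v : Fin n → ℂ := fun i => (if A (Sum.inl i) then 1 else 0) - (if A (Sum.inr i) then 1 else 0)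
    have hv : ∀ x, coord v x = (if A x then 1 else 0) - (if A (neg x) then 1 else 0) := by
      rintro (i | i)
      · rfl
      · change -v i = _
        exact neg_sub _ _
    have hvu : v ∈ fixedSpace u := by
      rw [mem_fixedSpace_iff]
      intro x
      rw [hv, hv, ← apply_neg]
      simp only [hA]
    have h3 := hab v hvu
    have ha : A a := Perm.SameCycle.refl _ _
    have hb : ¬ A b := h1
    have ha' : ¬ A (neg a) := by
      change ¬ (toPerm n u).SameCycle _ (pos n (neg a))
      rwa [pos_neg_eq_antipode]
    rw [hv, hv, if_pos ha, if_neg hb, if_neg ha'] at h3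
    split_ifs at h3 <;> norm_num at h3
  rcases key hab with h1 | h1
  · exact h1
  rcases key ((flatPartition (fixedSpace u)).symm' hab) with h2 | h2
  · exact h2.symm
  exact h.isSymmNC.zero_unique h1 h2

/-- This recovers a noncrossing `u` from `V^u`, and turns the partitions entering `nabla` back into
group elements. -/
theorem AbsLE.Omega_flatPartition [NeZero n] {u : Hyperoct n} (h : AbsLE u (coxeter n)) :
    Omega (Setoid.comap (pos n).symm (flatPartition (fixedSpace u))) = toPerm n u := by
  rw [← Omega_cycles h.isClockwise.2]
  congr 1
  refine Setoid.ext fun p q => ?_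
  rw [Setoid.comap_rel, h.flatPartition_iff, Equiv.apply_symm_apply, Equiv.apply_symm_apply]
  rfl

theorem AbsLE.fixedSpace_injective [NeZero n] {u v : Hyperoct n} (hu : AbsLE u (coxeter n))
    (hv : AbsLE v (coxeter n)) (h : fixedSpace u = fixedSpace v) : u = v :=
  toPerm_injective (by rw [← hu.Omega_flatPartition, ← hv.Omega_flatPartition, h])

theorem flats_injective [NeZero n] : Function.Injective (flats (n := n) (k := k)) := by
  intro u v h
  refine Subtype.ext (funext fun i => ?_)
  exact (u.2.1 i).fixedSpace_injective (v.2.1 i) (congrFun h i)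

/-- The noncrossing flat of a multichain of noncrossing elements. -/
def NCChain.toFlat (u : NCChain n k) : NCFlat n k := ⟨flats u, u, rfl⟩

theorem NCChain.elements_toFlat [NeZero n] (u : NCChain n k) : u.toFlat.elements = u :=
  flats_injective u.toFlat.flats_elements.symm

theorem NCFlat.toFlat_elements (X : NCFlat n k) : X.elements.toFlat = X :=
  Subtype.ext X.flats_elements.symm

namespace NCChain

/-- The multichain `u_1 ≤ ⋯ ≤ u_k` continued by `c`. -/
def extend (u : NCChain n k) (j : ℕ) : Hyperoct n :=
  if h : j < k then u.1 ⟨j, h⟩ else coxeter n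

theorem extend_of_lt (u : NCChain n k) {j : ℕ} (h : j < k) : u.extend j = u.1 ⟨j, h⟩ := dif_pos h

theorem extend_of_le (u : NCChain n k) {j : ℕ} (h : k ≤ j) : u.extend j = coxeter n :=
  dif_neg (by omega)

theorem extend_absLE (u : NCChain n k) (j : ℕ) : AbsLE (u.extend j) (u.extend (j + 1)) := by
  rcases lt_or_ge j k with h | h
  · rw [u.extend_of_lt h]
    rcases lt_or_ge (j + 1) k with h' | h'
    · rw [u.extend_of_lt h']
      exact u.2.2 _ _ (Fin.mk_le_mk.mpr (Nat.le_succ j))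
    · rw [u.extend_of_le h']
      exact u.2.1 _
  · rw [u.extend_of_le h, u.extend_of_le (by omega)]
    exact AbsLE.refl _

/-- The factors `w_1, …, w_k` of the factorization `(w_0, w_1, …, w_k)` of a multichain. -/
def factor (u : NCChain n k) (i : Fin k) : Hyperoct n := (u.extend i)⁻¹ * u.extend (i + 1)

theorem sum_reflLength_factor (u : NCChain n k) :
    reflLength (u.extend 0) + ∑ i, reflLength (u.factor i) = reflLength (coxeter n) := by
  have key : ∀ m, reflLength (u.extend 0) +
      ∑ j ∈ Finset.range m, reflLength ((u.extend j)⁻¹ * u.extend (j + 1)) =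
        reflLength (u.extend m) := by
    intro m
    induction m with
    | zero => simp
    | succ m ih =>
      rw [Finset.sum_range_succ, ← add_assoc, ih]
      exact (u.extend_absLE m).symm
  have := key k
  rw [u.extend_of_le le_rfl] at this
  rw [← this]
  congr 1
  exact Fin.sum_univ_eq_sum_range
    (fun j => reflLength ((u.extend j)⁻¹ * u.extend (j + 1))) k

/-- The shuffle of the factors `w_1, …, w_k`. -/
def shuffled (u : NCChain n k) : Perm (Fin (2 * n * k)) :=
  shufflePerm fun i => toPerm n (u.factor i)

/-- The permutation whose cycles are the blocks of the labelled partition. -/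
def nablaPerm (u : NCChain n k) : Perm (Fin (2 * n * k)) :=
  finRotate (2 * n * k) * u.shuffled⁻¹

theorem nablaPerm_mul (u : NCChain n k) : u.nablaPerm * u.shuffled = finRotate (2 * n * k) := by
  rw [nablaPerm, inv_mul_cancel_right]

/-- The element of the circle `±[n]` that a point of the circle `±[kn]` stands for. -/
def root (u : NCChain n k) (p : Fin (2 * n * k)) : Fin (2 * n) :=
  toPerm n (u.extend p.modNat) p.divNat

/-- Points on the circle `±[kn]` are determined by their root and their residue modulo `k`. -/
def rootEquiv (u : NCChain n k) : Fin (2 * n * k) ≃ Fin (2 * n) × Fin k where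
  toFun p := (u.root p, p.modNat)
  invFun x := finProdFinEquiv ((toPerm n (u.extend x.2))⁻¹ x.1, x.2)
  left_inv p := by
    simp only [root, perm_inv_apply_self, finProdFinEquiv_divNat_modNat]
  right_inv x := by
    simp only [root, divNat_finProdFinEquiv, modNat_finProdFinEquiv, perm_apply_inv_self]

theorem root_finProdFinEquiv (u : NCChain n k) (a : Fin (2 * n)) (i : Fin k) :
    u.root (finProdFinEquiv (a, i)) = toPerm n (u.extend i) a := by
  rw [root, divNat_finProdFinEquiv, modNat_finProdFinEquiv]

theorem finRotate_finProdFinEquiv_of_lt {N : ℕ} (a : Fin N) {i : Fin k} (h : (i : ℕ) + 1 < k) :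
    finRotate (N * k) (finProdFinEquiv (a, i)) = finProdFinEquiv (a, ⟨i + 1, h⟩) := by
  apply Fin.ext
  have h1 : (a : ℕ) + 1 ≤ N := a.2
  have h2 := Nat.mul_le_mul_right k h1
  rw [val_finRotate]
  simp only [finProdFinEquiv_apply_val]
  rw [mul_comm k (a : ℕ)]
  rw [add_mul] at h2
  rw [if_neg (by omega)]
  omega

theorem finRotate_finProdFinEquiv_of_eq {N : ℕ} (a : Fin N) {i : Fin k} (h : (i : ℕ) + 1 = k) :
    finRotate (N * k) (finProdFinEquiv (a, i)) =
      finProdFinEquiv (finRotate N a, ⟨0, by omega⟩) := by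
  apply Fin.ext
  have h1 : (a : ℕ) + 1 ≤ N := a.2
  have h2 := Nat.mul_le_mul_right k h1
  rw [val_finRotate]
  simp only [finProdFinEquiv_apply_val, val_finRotate]
  rw [mul_comm k (a : ℕ)]
  rw [add_mul] at h2
  by_cases h3 : (a : ℕ) + 1 = N
  · have h4 : ((a : ℕ) + 1) * k = N * k := by rw [h3]
    rw [add_mul] at h4
    rw [if_pos h3, if_pos (by omega)]
    simp
  · have h4 : (a : ℕ) + 1 + 1 ≤ N := by omega
    have h5 := Nat.mul_le_mul_right k h4
    rw [add_mul, add_mul] at h5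
    rw [if_neg h3, if_neg (by omega), mul_add, mul_comm k (a : ℕ)]
    omega

theorem nablaPerm_shuffled (u : NCChain n k) (p : Fin (2 * n * k)) :
    u.nablaPerm (u.shuffled p) = finRotate (2 * n * k) p := by
  rw [← u.nablaPerm_mul]; rfl

/-- If `p` is the image of `(a, i)` under the shuffle, then `nablaPerm` sends it to `(a, i + 1)`.
The roots agree because `u.extend i * u.factor i = u.extend (i + 1)`. -/
theorem nablaPerm_of_lt (u : NCChain n k) {p : Fin (2 * n * k)} (h : (p.modNat : ℕ) + 1 < k) :
    u.root (u.nablaPerm p) = u.root p ∧ ((u.nablaPerm p).modNat : ℕ) = p.modNat + 1 := by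
  obtain ⟨q, rfl⟩ := u.shuffled.surjective p
  rw [nablaPerm_shuffled]
  obtain ⟨⟨a, i⟩, rfl⟩ := finProdFinEquiv.surjective q
  rw [shuffled, shufflePerm_apply, divNat_finProdFinEquiv, modNat_finProdFinEquiv] at *
  rw [modNat_finProdFinEquiv] at h
  rw [finRotate_finProdFinEquiv_of_lt a h, modNat_finProdFinEquiv, modNat_finProdFinEquiv,
    root_finProdFinEquiv, root_finProdFinEquiv]
  refine ⟨?_, rfl⟩
  rw [← Perm.mul_apply, ← map_mul, factor, mul_inv_cancel_left]

/-- At the last residue the point goes to `(c a, 0)`. The old root is `u.extend k` of `a`, that is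
`c a`, and the new one is `u_1` applied to it. -/
theorem nablaPerm_of_eq (u : NCChain n k) {p : Fin (2 * n * k)} (h : (p.modNat : ℕ) + 1 = k) :
    u.root (u.nablaPerm p) = toPerm n (u.extend 0) (u.root p) ∧
      ((u.nablaPerm p).modNat : ℕ) = 0 := by
  obtain ⟨q, rfl⟩ := u.shuffled.surjective p
  rw [nablaPerm_shuffled]
  obtain ⟨⟨a, i⟩, rfl⟩ := finProdFinEquiv.surjective q
  rw [shuffled, shufflePerm_apply, divNat_finProdFinEquiv, modNat_finProdFinEquiv] at *
  rw [modNat_finProdFinEquiv] at h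
  rw [finRotate_finProdFinEquiv_of_eq a h, modNat_finProdFinEquiv,
    root_finProdFinEquiv, root_finProdFinEquiv]
  refine ⟨?_, rfl⟩
  rw [← Perm.mul_apply (toPerm n (u.extend i)), ← map_mul, factor, mul_inv_cancel_left,
    u.extend_of_le (j := i + 1) h.ge, toPerm_coxeter]

/-- A cycle of `nablaPerm` climbs through the residues above one root and then passes to the next
root by `u_1`. Every block thus consists of full sets of `k` points over the roots in a cycle of
`u_1`, whence `k`-divisibility. -/
theorem sameCycle_nablaPerm_iff (u : NCChain n k) {p q : Fin (2 * n * k)} :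
    u.nablaPerm.SameCycle p q ↔ (toPerm n (u.extend 0)).SameCycle (u.root p) (u.root q) := by
  have hk : 0 < k := Nat.pos_of_ne_zero (by rintro rfl; exact absurd p.2 (by simp))
  constructor
  · intro h
    refine (invariant_of_sameCycle
      (g := fun z => (toPerm n (u.extend 0)).SameCycle (u.root p) (u.root z))
      (fun z hz => ?_) h).mp (Perm.SameCycle.refl _ _)
    have := z.modNat.2
    rcases Nat.lt_or_ge ((z.modNat : ℕ) + 1) k with h | h
    · rwa [(u.nablaPerm_of_lt h).1]
    · rw [(u.nablaPerm_of_eq (by omega)).1]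
      exact hz.trans (sameCycle_apply _ _)
  · have up : ∀ (m : ℕ) (p q : Fin (2 * n * k)), u.root p = u.root q →
        (q.modNat : ℕ) = p.modNat + m → u.nablaPerm.SameCycle p q := by
      intro m
      induction m with
      | zero =>
        intro p q h1 h2
        have : p = q := u.rootEquiv.injective (Prod.ext h1 (Fin.ext h2.symm))
        rw [this]
      | succ m ih =>
        intro p q h1 h2
        have := q.modNat.2
        have h3 := u.nablaPerm_of_lt (p := p) (by omega)
        exact (sameCycle_apply _ p).trans (ih _ q (h3.1.trans h1) (by omega))
    have same : ∀ p q : Fin (2 * n * k), u.root p = u.root q → u.nablaPerm.SameCycle p q := by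
      intro p q h
      rcases le_total (p.modNat : ℕ) q.modNat with h' | h'
      · exact up (q.modNat - p.modNat) p q h (by omega)
      · exact (up (p.modNat - q.modNat) q p h.symm (by omega)).symm
    intro h
    have key := invariant_of_sameCycle
      (g := fun x => ∃ z, u.root z = x ∧ u.nablaPerm.SameCycle p z) (fun x hx => ?_) h
    · obtain ⟨z, hz, hpz⟩ := key.mp ⟨p, rfl, Perm.SameCycle.refl _ _⟩
      exact hpz.trans (same z q hz)
    · obtain ⟨z, hz, hpz⟩ := hx
      -- The point of the last residue over `x` is the one whose next step changes the root.
      set z' := u.rootEquiv.symm (x, ⟨k - 1, by omega⟩) with hz'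
      have e : u.rootEquiv z' = (x, ⟨k - 1, by omega⟩) := u.rootEquiv.apply_symm_apply _
      have e1 : u.root z' = x := congrArg Prod.fst e
      have e2 : (z'.modNat : ℕ) = k - 1 := congrArg Fin.val (congrArg Prod.snd e)
      refine ⟨u.nablaPerm z', ?_, (hpz.trans (same z z' (hz.trans e1.symm))).trans
        (sameCycle_apply _ _)⟩
      rw [(u.nablaPerm_of_eq (by omega)).1, e1]

theorem root_antipode (u : NCChain n k) (p : Fin (2 * n * k)) :
    u.root (antipode p) = antipode (u.root p) := by
  rw [root, modNat_antipode (even_two_mul n), divNat_antipode (even_two_mul n), toPerm_antipode]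
  rfl

theorem numCycles_nablaPerm [NeZero k] (u : NCChain n k) :
    numCycles u.nablaPerm = numCycles (toPerm n (u.extend 0)) := by
  refine Nat.card_congr (Equiv.ofBijective (Quotient.lift
    (fun p => Quotient.mk (Perm.SameCycle.setoid (toPerm n (u.extend 0))) (u.root p))
    fun p q h => Quotient.sound (u.sameCycle_nablaPerm_iff.mp h)) ⟨?_, ?_⟩)
  · intro x y
    induction x using Quotient.inductionOn with
    | h p =>
    induction y using Quotient.inductionOn with
    | h q => exact fun h => Quotient.sound (u.sameCycle_nablaPerm_iff.mpr (Quotient.exact h))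
  · intro x
    induction x using Quotient.inductionOn with
    | h a =>
    refine ⟨Quotient.mk _ (u.rootEquiv.symm (a, ⟨0, NeZero.pos k⟩)), ?_⟩
    have : u.root (u.rootEquiv.symm (a, ⟨0, NeZero.pos k⟩)) = a :=
      congrArg Prod.fst (u.rootEquiv.apply_symm_apply (a, ⟨0, NeZero.pos k⟩))
    rw [Quotient.lift_mk, this]

/-- The shuffle has at least `2nk - 2 ∑ ℓ_T(w_i)` cycles, and `nablaPerm` as many as `u_1`, at least
`2n - 2 ℓ_T(u_1)`. Additivity of the lengths makes the total at least `2nk + 2n - 2 ℓ_T(c) ≥ 2nk`.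
-/
theorem isClockwise [NeZero n] [NeZero k] (u : NCChain n k) :
    IsClockwise u.shuffled ∧ IsClockwise u.nablaPerm := by
  have hn := NeZero.pos n
  refine isClockwise_of_le_numCycles (Nat.mul_pos (by omega) (NeZero.pos k)) u.nablaPerm_mul ?_
  have h1 := sum_numCycles_le fun i => toPerm n (u.factor i)
  have h2 : ∑ i, 2 * n ≤ ∑ i, (numCycles (toPerm n (u.factor i)) + 2 * reflLength (u.factor i)) :=
    Finset.sum_le_sum fun i _ => le_numCycles_add (u.factor i)
  rw [Finset.sum_add_distrib, Finset.sum_const, Finset.card_univ, Fintype.card_fin, smul_eq_mul,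
    mul_comm k, ← Finset.mul_sum] at h2
  have h3 := u.sum_reflLength_factor
  have h4 := reflLength_coxeter_le (n := n)
  have h5 := le_numCycles_add (u.extend 0)
  rw [numCycles_nablaPerm, shuffled]
  omega

theorem isSymmNC [NeZero n] [NeZero k] (u : NCChain n k) : IsSymmNC (cycles u.nablaPerm) := by
  refine isSymmNC_of_mul_eq (by rw [mul_assoc]; exact even_two_mul _) u.nablaPerm_mul
    u.isClockwise.1 u.isClockwise.2 fun {a b} h => ?_
  rw [sameCycle_nablaPerm_iff] at h ⊢
  rw [root_antipode, root_antipode]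
  exact sameCycle_antipode h

end NCChain

/-- `Omega` undoes the passage to flats and `delta` yields the factors; the Kreweras complement of
the cycles of their shuffle is then given by `kreweras_cycles`. -/
theorem nabla_toFlat [NeZero n] [NeZero k] (u : NCChain n k) : nabla u.toFlat =
    Setoid.comap ((pos (n * k)).trans (finCongr (mul_assoc 2 n k).symm)) (cycles u.nablaPerm) := by
  rw [nabla, ← kreweras_cycles u.nablaPerm_mul
    (isNoncrossing_of_isClockwise u.nablaPerm_mul u.isClockwise.1 u.isClockwise.2),
    NCChain.shuffled, cycles_shufflePerm]
  congr 3
  funext i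
  congr 1
  have h : ∀ j, Omega (Setoid.comap (pos n).symm (flatPartition (u.toFlat.1 j))) =
      toPerm n (u.1 j) := fun j => (u.2.1 j).Omega_flatPartition
  simp only [delta, h, NCChain.factor, map_mul, map_inv, NCChain.extend, i.2, dif_pos]
  congr 1
  split_ifs
  · rfl
  · exact toPerm_coxeter.symm

end Hyperoct

/-! ### The vector of openers of a noncrossing multichain -/

namespace Hyperoct

open SignedIdx CirclePartition Equiv

variable {n k : ℕ}

/-- The identification of `±[kn]` with the positions on the circle. -/
def circlePos (n k : ℕ) : SignedIdx (n * k) ≃ Fin (2 * n * k) :=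
  (pos (n * k)).trans (finCongr (mul_assoc 2 n k).symm)

theorem circlePos_neg (a : SignedIdx (n * k)) :
    circlePos n k (neg a) = antipode (circlePos n k a) := by
  apply Fin.ext
  change ((pos (n * k) (neg a) : Fin _) : ℕ) = ((pos (n * k) a : Fin _) + 2 * n * k / 2) % (2 * n * k)
  rw [pos_neg, show 2 * n * k / 2 = n * k by rw [mul_assoc, Nat.mul_div_cancel_left _ two_pos]]
  exact congrArg (_ % ·) (mul_assoc 2 n k).symm

theorem cdist_cast {M M' : ℕ} (h : M = M') (p q : Fin M) :
    cdist (Fin.cast h p) (Fin.cast h q) = cdist p q := by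
  subst h; rfl

theorem cdist_eq_val_sub {M : ℕ} (p q : Fin M) : cdist p q = ((q - p : Fin M) : ℕ) := by
  have := p.2; have := q.2
  rw [Fin.sub_def, cdist]
  dsimp only
  split_ifs
  · rw [Nat.mod_eq_sub_mod (by omega), Nat.mod_eq_of_lt (by omega)]; omega
  · rw [Nat.mod_eq_of_lt (by omega)]; omega

theorem cdist_circlePos (a b : SignedIdx (n * k)) :
    cdist (circlePos n k a) (circlePos n k b) = clockwiseDist a b := by
  rw [clockwiseDist, ← cdist_eq_val_sub]
  exact cdist_cast (mul_assoc 2 n k).symm _ _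

/-- The position of the vertex of `±[kn]` corresponding to an element of `±[n]`. -/
def vertexPos (k : ℕ) [NeZero k] (a : SignedIdx n) : Fin (2 * n * k) :=
  finProdFinEquiv (pos n a, ⟨0, NeZero.pos k⟩)

theorem circlePos_vertex [NeZero k] (a : SignedIdx n) :
    circlePos n k (vertex a) = vertexPos k a := by
  apply Fin.ext
  change ((pos (n * k) (vertex a) : Fin _) : ℕ) = (0 + k * ((pos n a : Fin _) : ℕ))
  rcases a with i | i
  · change ((pos (n * k) (Sum.inl _) : Fin _) : ℕ) = _
    rw [pos_inl, pos_inl, zero_add]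
    exact mul_comm _ _
  · change ((pos (n * k) (Sum.inr _) : Fin _) : ℕ) = _
    rw [pos_inr, pos_inr, zero_add, mul_add, mul_comm k, mul_comm k]

theorem vertexPos_neg [NeZero k] (a : SignedIdx n) :
    vertexPos k (neg a) = antipode (vertexPos k a) := by
  rw [← finProdFinEquiv_divNat_modNat (antipode (vertexPos k a)),
    modNat_antipode (even_two_mul n), divNat_antipode (even_two_mul n), vertexPos, vertexPos,
    divNat_finProdFinEquiv, modNat_finProdFinEquiv, pos_neg_eq_antipode]

theorem pow_half_eq_neg_one [NeZero n] [NeZero k] {ω : ℂ} (hω : IsPrimitiveRoot ω (2 * n * k)) :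
    ω ^ (n * k) = -1 := by
  have hpos : 0 < n * k := Nat.mul_pos (NeZero.pos n) (NeZero.pos k)
  have h1 : (ω ^ (n * k)) ^ 2 = 1 := by
    rw [← pow_mul, ← hω.pow_eq_one]
    congr 1
    ring
  rcases mul_self_eq_one_iff.mp ((pow_two _).symm.trans h1) with h | h
  · exfalso
    have := Nat.le_of_dvd hpos (hω.dvd_of_pow_eq_one _ h)
    rw [mul_assoc] at this
    omega
  · exact h

/-- This merges the openers `+j` and `-j` of `CoordRule` into the one formula `ω^(position + 1)`,
positions being counted from zero. -/
theorem pow_antipode [NeZero n] [NeZero k] {ω : ℂ} (hω : IsPrimitiveRoot ω (2 * n * k))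
    (p : Fin (2 * n * k)) : ω ^ ((antipode p : ℕ) + 1) = -ω ^ ((p : ℕ) + 1) := by
  have h1 := pow_half_eq_neg_one hω
  have h2 : ∀ m, ω ^ (m % (2 * n * k)) = ω ^ m := fun m => by
    conv_rhs => rw [← Nat.div_add_mod m (2 * n * k)]
    rw [pow_add, pow_mul, hω.pow_eq_one, one_pow, one_mul]
  rw [pow_succ]
  simp only [antipode]
  rw [h2, pow_add, show 2 * n * k / 2 = n * k by
    rw [mul_assoc, Nat.mul_div_cancel_left _ two_pos], h1]
  ring

theorem pow_injective_fin {ω : ℂ} (hω : IsPrimitiveRoot ω (2 * n * k)) {p q : Fin (2 * n * k)}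
    (h : ω ^ ((p : ℕ) + 1) = ω ^ ((q : ℕ) + 1)) : p = q := by
  have h0 : ω ≠ 0 := hω.ne_zero (by have := p.2; omega)
  rw [pow_succ, pow_succ] at h
  exact Fin.ext (hω.pow_inj p.2 q.2 (mul_right_cancel₀ h0 h))

namespace NCChain

variable [NeZero n] [NeZero k]

open scoped Classical in
/-- The value attached to the block of `p`: a power of `ω` given by the opener of the block, and
zero if there is none. -/
noncomputable def blockValue (ω : ℂ) (u : NCChain n k) (p : Fin (2 * n * k)) : ℂ :=
  if h : ∃ o, IsOpener (cycles u.nablaPerm) o ∧ u.nablaPerm.SameCycle o p then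
    ω ^ ((h.choose : ℕ) + 1) else 0

variable {ω : ℂ} (u : NCChain n k)

theorem blockValue_of_opener {o p : Fin (2 * n * k)} (ho : IsOpener (cycles u.nablaPerm) o)
    (h : u.nablaPerm.SameCycle o p) : u.blockValue ω p = ω ^ ((o : ℕ) + 1) := by
  have hex : ∃ o, IsOpener (cycles u.nablaPerm) o ∧ u.nablaPerm.SameCycle o p := ⟨o, ho, h⟩
  have h1 := hex.choose_spec
  rw [blockValue, dif_pos hex, h1.1.unique ho (h1.2.trans h.symm)]

theorem blockValue_of_antipode {p : Fin (2 * n * k)}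
    (h : u.nablaPerm.SameCycle p (antipode p)) : u.blockValue ω p = 0 := by
  rw [blockValue, dif_neg]
  rintro ⟨o, ho, hp⟩
  exact ho.not_antipode u.isSymmNC.even hp h

theorem blockValue_cases (ω : ℂ) (p : Fin (2 * n * k)) :
    (u.nablaPerm.SameCycle p (antipode p) ∧ u.blockValue ω p = 0) ∨
      ∃ o, IsOpener (cycles u.nablaPerm) o ∧ u.nablaPerm.SameCycle o p ∧
        u.blockValue ω p = ω ^ ((o : ℕ) + 1) := by
  by_cases h : u.nablaPerm.SameCycle p (antipode p)
  · exact Or.inl ⟨h, u.blockValue_of_antipode h⟩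
  · obtain ⟨o, h1, h2⟩ := u.isSymmNC.exists_opener h
    have h1' : u.nablaPerm.SameCycle o p := Perm.SameCycle.symm h1
    exact Or.inr ⟨o, h2, h1', u.blockValue_of_opener h2 h1'⟩

theorem blockValue_congr {p q : Fin (2 * n * k)} (h : u.nablaPerm.SameCycle p q) :
    u.blockValue ω p = u.blockValue ω q := by
  rcases u.blockValue_cases ω p with ⟨h1, h2⟩ | ⟨o, h1, h2, h3⟩
  · have h4 : u.nablaPerm.SameCycle (antipode p) (antipode q) := u.isSymmNC.symm h
    rw [h2, u.blockValue_of_antipode (h.symm.trans (h1.trans h4))]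
  · rw [h3, u.blockValue_of_opener h1 (h2.trans h)]

theorem blockValue_eq_zero_iff (hω : IsPrimitiveRoot ω (2 * n * k)) {p : Fin (2 * n * k)} :
    u.blockValue ω p = 0 ↔ u.nablaPerm.SameCycle p (antipode p) := by
  refine ⟨fun h => ?_, u.blockValue_of_antipode⟩
  rcases u.blockValue_cases ω p with ⟨h1, h2⟩ | ⟨o, h1, h2, h3⟩
  · exact h1
  · rw [h] at h3
    exact absurd h3.symm (pow_ne_zero _ (hω.ne_zero (by have := p.2; omega)))

theorem blockValue_eq_pow_iff (hω : IsPrimitiveRoot ω (2 * n * k)) {p q : Fin (2 * n * k)} :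
    u.blockValue ω p = ω ^ ((q : ℕ) + 1) ↔
      IsOpener (cycles u.nablaPerm) q ∧ u.nablaPerm.SameCycle q p := by
  refine ⟨fun h => ?_, fun h => u.blockValue_of_opener h.1 h.2⟩
  rcases u.blockValue_cases ω p with ⟨h1, h2⟩ | ⟨o, h1, h2, h3⟩
  · rw [h] at h2
    exact absurd h2 (pow_ne_zero _ (hω.ne_zero (by have := p.2; omega)))
  · obtain rfl := pow_injective_fin hω (h.symm.trans h3)
    exact ⟨h1, h2⟩

theorem isOpener_antipode {π : Setoid (Fin (2 * n * k))} (hπ : IsSymmNC π) {o : Fin (2 * n * k)}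
    (ho : IsOpener π o) : IsOpener π (antipode o) := by
  intro q hq
  have h1 := hπ.symm hq
  rw [antipode_antipode hπ.even] at h1
  have := ho _ h1
  rwa [← cdist_antipode_antipode hπ.even, antipode_antipode hπ.even] at this

theorem blockValue_antipode (hω : IsPrimitiveRoot ω (2 * n * k)) (p : Fin (2 * n * k)) :
    u.blockValue ω (antipode p) = -u.blockValue ω p := by
  rcases u.blockValue_cases ω p with ⟨h1, h2⟩ | ⟨o, h1, h2, h3⟩
  · rw [h2, u.blockValue_of_antipode (u.isSymmNC.symm h1), neg_zero]
  · rw [h3, u.blockValue_of_opener (isOpener_antipode u.isSymmNC h1) (u.isSymmNC.symm h2),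
      pow_antipode hω]

theorem blockValue_pow (hω : IsPrimitiveRoot ω (2 * n * k)) (p : Fin (2 * n * k)) :
    u.blockValue ω p ^ (2 * n * k + 1) = u.blockValue ω p := by
  rcases u.blockValue_cases ω p with ⟨h1, h2⟩ | ⟨o, h1, h2, h3⟩
  · rw [h2, zero_pow (by omega)]
  · rw [h3, ← pow_mul, mul_comm, pow_mul, pow_succ ω, hω.pow_eq_one, one_mul]

/-- A nonzero value names its opener, and there is at most one zero block. -/
theorem sameCycle_of_blockValue_eq (hω : IsPrimitiveRoot ω (2 * n * k)) {p q : Fin (2 * n * k)}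
    (h : u.blockValue ω p = u.blockValue ω q) : u.nablaPerm.SameCycle p q := by
  rcases u.blockValue_cases ω p with ⟨h1, h2⟩ | ⟨o, h1, h2, h3⟩
  · rw [h2] at h
    exact u.isSymmNC.zero_unique h1 ((u.blockValue_eq_zero_iff hω).mp h.symm)
  · rw [h3] at h
    exact h2.symm.trans ((u.blockValue_eq_pow_iff hω).mp h.symm).2

theorem root_vertexPos (a : SignedIdx n) :
    u.root (vertexPos k a) = toPerm n (u.extend 0) (pos n a) := u.root_finProdFinEquiv _ _

theorem sameCycle_vertexPos_iff {p : Fin (2 * n * k)} {a : SignedIdx n} :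
    u.nablaPerm.SameCycle p (vertexPos k a) ↔
      (toPerm n (u.extend 0)).SameCycle (u.root p) (pos n a) := by
  rw [sameCycle_nablaPerm_iff, root_vertexPos, Perm.sameCycle_apply_right]

/-- The vector attached to the class `[1, X]`. -/
noncomputable def openerVector (ω : ℂ) (u : NCChain n k) (i : Fin n) : ℂ :=
  u.blockValue ω (vertexPos k (Sum.inl i))

theorem coord_openerVector (hω : IsPrimitiveRoot ω (2 * n * k)) (a : SignedIdx n) :
    coord (u.openerVector ω) a = u.blockValue ω (vertexPos k a) := by
  rcases a with i | i
  · rfl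
  · change -u.blockValue ω (vertexPos k (Sum.inl i)) = u.blockValue ω (vertexPos k (neg (Sum.inl i)))
    rw [vertexPos_neg, u.blockValue_antipode hω]

theorem openerVector_mem_fixedSpace (hω : IsPrimitiveRoot ω (2 * n * k)) :
    u.openerVector ω ∈ fixedSpace (u.extend 0) := by
  rw [mem_fixedSpace_iff]
  intro a
  rw [u.coord_openerVector hω, u.coord_openerVector hω]
  refine u.blockValue_congr ?_
  rw [sameCycle_vertexPos_iff, root_vertexPos, ← toPerm_pos, Perm.sameCycle_apply_left,
    Perm.sameCycle_apply_left]

theorem openerVector_mem_locus (hω : IsPrimitiveRoot ω (2 * n * k)) (w : Hyperoct n) :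
    reflRep n w (u.openerVector ω) ∈ AlgPark.locus (AlgPark.powerTheta n k) := by
  rw [AlgPark.mem_locus]
  intro i
  rw [AlgPark.powerTheta, map_pow, MvPolynomial.eval_X]
  change coord _ (Sum.inl i) ^ _ = coord _ (Sum.inl i)
  rw [coord_reflRep, u.coord_openerVector hω, u.blockValue_pow hω]

theorem extend_zero : u.extend 0 = u.1 0 := u.extend_of_lt (NeZero.pos k)

/-- Equal values mean equal blocks, so `x` moves every index within its `u_1`-cycle and fixes
`V^{u_1}` pointwise. Hence the stabiliser of the vector is no larger than `W_{X_1}`. -/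
theorem mem_isotropy_of_reflRep_eq (hω : IsPrimitiveRoot ω (2 * n * k)) {x : Hyperoct n}
    (hx : reflRep n x (u.openerVector ω) = u.openerVector ω) :
    x ∈ isotropy (u.toFlat.1 0) := by
  intro v hv
  have hv' : v ∈ fixedSpace (u.extend 0) := by rw [extend_zero]; exact hv
  refine (mem_fixedSpace x v).mp ((mem_fixedSpace_iff x v).mpr fun a => ?_)
  have h1 := (mem_fixedSpace_iff x _).mp ((mem_fixedSpace x _).mpr hx) a
  rw [u.coord_openerVector hω, u.coord_openerVector hω] at h1
  have h2 := u.sameCycle_of_blockValue_eq hω h1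
  rw [sameCycle_vertexPos_iff, root_vertexPos, Perm.sameCycle_apply_left] at h2
  exact coord_eq_of_sameCycle hv' h2

/-! ### Recovering the multichain from the sizes of blocks -/

/-- The block opened by `p` has `k` points over each element of one cycle of `u_1`, and this cycle
indexes the signed coordinates with value `ω^(p+1)`. -/
theorem openSize_eq (hω : IsPrimitiveRoot ω (2 * n * k)) (p : Fin (2 * n * k)) :
    openSize (cycles u.nablaPerm) p =
      k * Nat.card {a : SignedIdx n // coord (u.openerVector ω) a = ω ^ ((p : ℕ) + 1)} := by
  classical
  simp only [u.coord_openerVector hω, u.blockValue_eq_pow_iff hω]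
  unfold openSize
  split_ifs with h
  · simp only [h, true_and, sameCycle_vertexPos_iff]
    rw [← Fintype.card_coe, ← Nat.card_eq_fintype_card]
    have h1 : Nat.card {a : SignedIdx n // (toPerm n (u.extend 0)).SameCycle (u.root p) (pos n a)} =
        Nat.card {x : Fin (2 * n) // (toPerm n (u.extend 0)).SameCycle (u.root p) x} :=
      Nat.card_congr ((pos n).subtypeEquiv fun a => Iff.rfl)
    have h2 : Nat.card {x : Fin (2 * n) // (toPerm n (u.extend 0)).SameCycle (u.root p) x} * k =
        Nat.card ({x : Fin (2 * n) // (toPerm n (u.extend 0)).SameCycle (u.root p) x} × Fin k) := by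
      rw [Nat.card_prod, Nat.card_fin]
    rw [h1, mul_comm k, h2]
    refine Nat.card_congr ((u.rootEquiv.subtypeEquiv (q := fun x =>
      (toPerm n (u.extend 0)).SameCycle (u.root p) x.1) fun q => ?_).trans
        (Equiv.prodSubtypeFstEquivSubtypeProd ..))
    simp only [Finset.mem_filter, Finset.mem_univ, true_and]
    exact u.sameCycle_nablaPerm_iff
  · simp [h]

/-- The factors are read off the shuffle, and the multichain then follows by descending from its end
`c`. -/
theorem eq_of_nablaPerm_eq {u u' : NCChain n k} (h : u.nablaPerm = u'.nablaPerm) : u = u' := by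
  have h1 : u.shuffled = u'.shuffled := by
    have := mul_left_cancel h
    exact inv_injective this
  have h2 : ∀ i, u.factor i = u'.factor i := by
    intro i
    refine toPerm_injective (Equiv.ext fun a => ?_)
    have h3 := congrArg (fun f => f (finProdFinEquiv (a, i))) h1
    simp only [shuffled, shufflePerm_apply, divNat_finProdFinEquiv, modNat_finProdFinEquiv] at h3
    exact congrArg Prod.fst (finProdFinEquiv.injective h3)
  have h3 : ∀ m, m ≤ k → u.extend (k - m) = u'.extend (k - m) := by
    intro m
    induction m with
    | zero => intro _; rw [u.extend_of_le (by omega), u'.extend_of_le (by omega)]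
    | succ m ih =>
      intro hm
      have h4 := h2 ⟨k - (m + 1), by omega⟩
      have h5 := ih (by omega)
      simp only [factor] at h4
      rw [show k - (m + 1) + 1 = k - m by omega, h5] at h4
      exact inv_injective (mul_right_cancel h4)
  refine Subtype.ext (funext fun i => ?_)
  have h4 := h3 (k - i) (by omega)
  have := i.2
  rwa [show k - (k - (i : ℕ)) = i by omega, u.extend_of_lt i.2, u'.extend_of_lt i.2] at h4

/-- How often a value occurs among the signed coordinates is invariant under `W`, and this gives the
sizes of all blocks by their openers. -/
theorem eq_of_reflRep_eq (hω : IsPrimitiveRoot ω (2 * n * k)) {u u' : NCChain n k}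
    {w w' : Hyperoct n}
    (h : reflRep n w (u.openerVector ω) = reflRep n w' (u'.openerVector ω)) : u = u' := by
  refine eq_of_nablaPerm_eq (eq_of_cycles_eq u.isClockwise.2 u'.isClockwise.2
    (u.isSymmNC.eq_of_openSize_eq u'.isSymmNC fun p => ?_))
  rw [u.openSize_eq hω, u'.openSize_eq hω]
  congr 1
  have key : ∀ (u : NCChain n k) (w : Hyperoct n),
      Nat.card {a : SignedIdx n // coord (u.openerVector ω) a = ω ^ ((p : ℕ) + 1)} =
        Nat.card {a : SignedIdx n //
          coord (reflRep n w (u.openerVector ω)) a = ω ^ ((p : ℕ) + 1)} := by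
    intro u w
    refine Nat.card_congr (w.1.subtypeEquiv fun a => ?_)
    rw [coord_reflRep, inv_apply_self]
  rw [key u w, key u' w', h]

/-! ### The labelled partition -/

/-- The label `i` belongs to one block only, that of the vertex of `w⁻¹(i)`. The equivalence
therefore contains both the existence and the uniqueness of the value prescribed by `CoordRule`. -/
theorem coordRule_iff (hω : IsPrimitiveRoot ω (2 * n * k)) (w : Hyperoct n) (i : Fin n) (z : ℂ) :
    CoordRule ω (nabla u.toFlat) (label w) i z ↔
      z = reflRep n w (u.openerVector ω) i := by
  have hval : reflRep n w (u.openerVector ω) i =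
      u.blockValue ω (vertexPos k (w⁻¹.1 (Sum.inl i))) := by
    rw [← u.coord_openerVector hω, ← coord_reflRep]; rfl
  rw [hval, nabla_toFlat]
  set a := w⁻¹.1 (Sum.inl i) with ha
  set π : Setoid (SignedIdx (n * k)) := Setoid.comap ((pos (n * k)).trans
    (finCongr (mul_assoc 2 n k).symm)) (cycles u.nablaPerm) with hπ
  have hrel : ∀ x y, π x y ↔ u.nablaPerm.SameCycle (circlePos n k x) (circlePos n k y) :=
    fun x y => Iff.rfl
  have hclass : ∀ B ∈ π.classes, Sum.inl i ∈ label w B →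
      ∀ x, x ∈ B ↔ u.nablaPerm.SameCycle (vertexPos k a) (circlePos n k x) := by
    rintro _ ⟨y, rfl⟩ ⟨b, hb, hbi⟩ x
    have hba : b = a := by rw [ha, ← hbi, inv_apply_self]
    subst hba
    have hb' : π (vertex a) y := hb
    rw [hrel, circlePos_vertex] at hb'
    change π x y ↔ _
    rw [hrel]
    exact ⟨fun h => hb'.trans h.symm, fun h => h.symm.trans hb'⟩
  have hmem : ∀ B : Set (SignedIdx (n * k)), (∀ x, x ∈ B ↔
      u.nablaPerm.SameCycle (vertexPos k a) (circlePos n k x)) →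
        B ∈ π.classes ∧ Sum.inl i ∈ label w B := by
    intro B hB
    refine ⟨⟨vertex a, ?_⟩, a, ?_, ?_⟩
    · ext x
      rw [hB]
      change _ ↔ π x (vertex a)
      rw [hrel, circlePos_vertex]
      exact Perm.sameCycle_comm
    · change vertex a ∈ B
      rw [hB, circlePos_vertex]
    · rw [ha, apply_inv_self]
  have hneg : ∀ B : Set (SignedIdx (n * k)), (∀ x, x ∈ B ↔
      u.nablaPerm.SameCycle (vertexPos k a) (circlePos n k x)) →
        (neg '' B = B ↔ u.nablaPerm.SameCycle (vertexPos k a) (antipode (vertexPos k a))) := by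
    intro B hB
    constructor
    · intro h
      rw [← circlePos_vertex, ← circlePos_neg, circlePos_vertex, ← hB, ← h]
      refine ⟨_, ?_, rfl⟩
      rw [hB, circlePos_vertex]
    · intro h
      ext x
      have hx : x ∈ neg '' B ↔ neg x ∈ B :=
        ⟨by rintro ⟨y, hy, rfl⟩; rwa [SignedIdx.neg_neg], fun h => ⟨_, h, SignedIdx.neg_neg x⟩⟩
      rw [hx, hB, hB, circlePos_neg]
      refine ⟨fun h' => ?_, fun h' => h.trans (u.isSymmNC.symm h')⟩
      have h2 : u.nablaPerm.SameCycle (antipode (vertexPos k a))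
        (antipode (antipode (circlePos n k x))) := u.isSymmNC.symm h'
      rw [antipode_antipode u.isSymmNC.even] at h2
      exact h.trans h2
  have hopen : ∀ B : Set (SignedIdx (n * k)), (∀ x, x ∈ B ↔
      u.nablaPerm.SameCycle (vertexPos k a) (circlePos n k x)) → ∀ j, Opens j B ↔
        IsOpener (cycles u.nablaPerm) (circlePos n k j) ∧
          u.nablaPerm.SameCycle (circlePos n k j) (vertexPos k a) := by
    intro B hB j
    have hM := u.isSymmNC.even
    have hdist : ∀ b b', clockwiseDist j b < clockwiseDist j (neg b') ↔
        cdist (circlePos n k j) (circlePos n k b) <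
          cdist (circlePos n k j) (antipode (circlePos n k b')) := fun b b' => by
      rw [← cdist_circlePos, ← cdist_circlePos, circlePos_neg]
    constructor
    · rintro ⟨h1, h2⟩
      rw [hB] at h1
      refine ⟨fun q hq => ?_, h1.symm⟩
      obtain ⟨b, rfl⟩ := (circlePos n k).surjective q
      have hb : b ∈ B := by rw [hB]; exact h1.trans hq
      -- Being met before its own opposite already places `b` in the half circle starting at `j`.
      have := (hdist b b).mp (h2 b hb b hb)
      rw [cdist_antipode hM] at this
      split_ifs at this with h3
      · exact h3
      · omega
    · rintro ⟨h1, h2⟩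
      refine ⟨(hB j).mpr h2.symm, fun b hb b' hb' => ?_⟩
      rw [hdist, cdist_antipode hM]
      have h3 := h1 _ (h2.trans ((hB b).mp hb))
      have h4 := h1 _ (h2.trans ((hB b').mp hb'))
      rw [if_pos h4]
      omega
  have hinl : ∀ j : Fin (n * k), ((circlePos n k (Sum.inl j) : Fin _) : ℕ) = j := fun j => pos_inl j
  have hinr : ∀ j : Fin (n * k), circlePos n k (Sum.inr j) = antipode (circlePos n k (Sum.inl j)) :=
    fun j => circlePos_neg (Sum.inl j)
  constructor
  · rintro (⟨B, hB, h1, h2, rfl⟩ | ⟨B, hB, h1, h2, j, h3, rfl⟩ | ⟨B, hB, h1, h2, j, h3, rfl⟩)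
    · rw [u.blockValue_of_antipode ((hneg B (hclass B hB h2)).mp h1)]
    · obtain ⟨h4, h5⟩ := (hopen B (hclass B hB h2) _).mp h3
      rw [u.blockValue_of_opener h4 h5, hinl]
    · obtain ⟨h4, h5⟩ := (hopen B (hclass B hB h2) _).mp h3
      rw [u.blockValue_of_opener h4 h5, hinr, pow_antipode hω, hinl]
  · rintro rfl
    have hB : ∀ x, x ∈ {x | u.nablaPerm.SameCycle (vertexPos k a) (circlePos n k x)} ↔
      u.nablaPerm.SameCycle (vertexPos k a) (circlePos n k x) := fun x => Iff.rfl
    obtain ⟨hB1, hB2⟩ := hmem _ hB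
    rcases u.blockValue_cases ω (vertexPos k a) with ⟨h1, h2⟩ | ⟨o, h1, h2, h3⟩
    · exact Or.inl ⟨_, hB1, (hneg _ hB).mpr h1, hB2, h2⟩
    · obtain ⟨j, rfl⟩ := (circlePos n k).surjective o
      have hn : neg '' {x | u.nablaPerm.SameCycle (vertexPos k a) (circlePos n k x)} ≠
          {x | u.nablaPerm.SameCycle (vertexPos k a) (circlePos n k x)} := fun e =>
        h1.not_antipode u.isSymmNC.even h2 ((hneg _ hB).mp e)
      rcases j with j | j
      · exact Or.inr (Or.inl ⟨_, hB1, hn, hB2, j, (hopen _ hB _).mpr ⟨h1, h2⟩, by rw [h3, hinl]⟩)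
      · exact Or.inr (Or.inr ⟨_, hB1, hn, hB2, j, (hopen _ hB _).mpr ⟨h1, h2⟩, by
          rw [h3, hinr, pow_antipode hω, hinl]⟩)

end NCChain

end Hyperoct

/-! ### Rotation -/

namespace Hyperoct

open SignedIdx CirclePartition Equiv

variable {n k : ℕ} [NeZero n] [NeZero k]

/-- The action of the distinguished generator on multichains. -/
def NCChain.rotate (u : NCChain n k) : NCChain n k := integral (rotFact (boundary u))

theorem NCFlat.rot_toFlat (u : NCChain n k) : u.toFlat.rot = u.rotate.toFlat := by
  change (integral (rotFact (boundary u.toFlat.elements))).toFlat = _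
  rw [u.elements_toFlat]
  rfl

theorem getElem_quotients_succ (a : Hyperoct n) (u : List (Hyperoct n)) (b : Hyperoct n) (i : ℕ)
    (hi : i < u.length) :
    (quotients a u b)[i + 1]'(by rw [length_quotients]; omega) =
      u[i]⁻¹ * (u ++ [b])[i + 1]'(by simp; omega) := by
  simp [quotients]

namespace NCChain

variable (u : NCChain n k)

theorem getElem_boundary (i : Fin k) :
    (boundary u).1[(i : ℕ) + 1]'(by rw [(boundary u).2.1]; have := i.2; omega) = u.factor i := by
  have hi := i.2
  refine (getElem_quotients_succ 1 (List.ofFn u.1) (coxeter n) i (by simp)).trans ?_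
  rw [factor, u.extend_of_lt hi, List.getElem_append]
  congr 1
  · simp
  · simp only [extend, List.length_ofFn, List.getElem_ofFn, List.getElem_singleton]

theorem extend_integral (l : NCFact n k) {j : ℕ} (hj : j ≤ k) :
    (integral l).extend j = (l.1.take (j + 1)).prod := by
  rcases hj.lt_or_eq with h | rfl
  · rw [extend_of_lt _ h]; rfl
  · rw [extend_of_le _ le_rfl, List.take_of_length_le l.2.1.le, l.2.2.1]

theorem factor_integral (l : NCFact n k) (i : Fin k) :
    (integral l).factor i = l.1[(i : ℕ) + 1]'(by rw [l.2.1]; have := i.2; omega) := by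
  have hi := i.2
  rw [factor, extend_integral l hi.le, extend_integral l hi,
    List.prod_take_succ _ ((i : ℕ) + 1) (by rw [l.2.1]; omega), inv_mul_cancel_left]

theorem factor_rotate_zero : u.rotate.factor ⟨0, NeZero.pos k⟩ =
    coxeter n * u.factor (lastIdx k) * (coxeter n)⁻¹ := by
  rw [rotate, factor_integral]
  have h : (boundary u).1.getLastD 1 = u.factor (lastIdx k) := by
    have hl : (boundary u).1.length = k + 1 := (boundary u).2.1
    have hk := NeZero.pos k
    rw [← getElem_boundary, List.getLastD_eq_getLast?, List.getLast?_eq_getElem?,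
      List.getElem?_eq_getElem (by omega), Option.getD_some]
    exact getElem_congr_idx (by change _ = k - 1 + 1; omega)
  change (rotList (boundary u).1)[1]'_ = _
  simp only [rotList, h, List.getElem_cons_succ, List.getElem_cons_zero]

theorem factor_rotate_succ {i : ℕ} (hi : i + 1 < k) :
    u.rotate.factor ⟨i + 1, hi⟩ = u.factor ⟨i, by omega⟩ := by
  rw [rotate, factor_integral, ← getElem_boundary]
  change (rotList (boundary u).1)[i + 1 + 1]'_ = _
  simp only [rotList, List.getElem_cons_succ, List.getElem_dropLast, List.getElem_tail]

/-- One step on the big circle raises the residue, and takes the last residue to the first with a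
shift of `a` by `c`. This is exactly the passage from `(w_1, …, w_k)` to `(c w_k c⁻¹, w_1, …,
w_{k-1})`. -/
theorem shuffled_rotate : u.rotate.shuffled =
    finRotate (2 * n * k) * u.shuffled * (finRotate (2 * n * k))⁻¹ := by
  rw [eq_mul_inv_iff_mul_eq]
  refine Equiv.ext fun p => ?_
  obtain ⟨⟨a, i⟩, rfl⟩ := finProdFinEquiv.surjective p
  rw [Perm.mul_apply, Perm.mul_apply]
  have hi := i.2
  rcases Nat.lt_or_ge ((i : ℕ) + 1) k with h | h
  · rw [finRotate_finProdFinEquiv_of_lt a h, shuffled, shuffled, shufflePerm_apply,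
      shufflePerm_apply, divNat_finProdFinEquiv, modNat_finProdFinEquiv, divNat_finProdFinEquiv,
      modNat_finProdFinEquiv, finRotate_finProdFinEquiv_of_lt _ h, factor_rotate_succ]
  · have hk : (i : ℕ) + 1 = k := by omega
    have hlast : i = lastIdx k := Fin.ext (show (i : ℕ) = k - 1 by omega)
    rw [finRotate_finProdFinEquiv_of_eq a hk, shuffled, shuffled, shufflePerm_apply,
      shufflePerm_apply, divNat_finProdFinEquiv, modNat_finProdFinEquiv, divNat_finProdFinEquiv,
      modNat_finProdFinEquiv, finRotate_finProdFinEquiv_of_eq _ hk, factor_rotate_zero, map_mul,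
      map_mul, map_inv, toPerm_coxeter, Perm.mul_apply, Perm.mul_apply, perm_inv_apply_self]
    change _ = finProdFinEquiv (finRotate (2 * n) (toPerm n (u.factor i) a), (⟨0, NeZero.pos k⟩ : Fin k))
    rw [congrArg u.factor hlast]

theorem nablaPerm_rotate : u.rotate.nablaPerm =
    finRotate (2 * n * k) * u.nablaPerm * (finRotate (2 * n * k))⁻¹ := by
  rw [nablaPerm, nablaPerm, shuffled_rotate]
  group

theorem sameCycle_nablaPerm_rotate {p q : Fin (2 * n * k)} :
    u.rotate.nablaPerm.SameCycle (finRotate _ p) (finRotate _ q) ↔ u.nablaPerm.SameCycle p q := by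
  rw [nablaPerm_rotate, sameCycle_conj_finRotate]

theorem pow_finRotate {ω : ℂ} (hω : IsPrimitiveRoot ω (2 * n * k)) (p : Fin (2 * n * k)) :
    ω ^ ((finRotate _ p : Fin (2 * n * k)) + 1 : ℕ) = ω * ω ^ ((p : ℕ) + 1) := by
  rw [val_finRotate]
  split_ifs with h
  · rw [h, hω.pow_eq_one, zero_add, pow_one, mul_one]
  · rw [← pow_succ']

theorem antipode_finRotate {M : ℕ} (hM : Even M) (p : Fin M) :
    antipode (finRotate M p) = finRotate M (antipode p) := by
  have := p.2
  obtain ⟨m, hm⟩ := id hM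
  apply Fin.ext
  simp only [val_antipode hM, val_finRotate]
  split_ifs <;> omega

theorem blockValue_rotate {ω : ℂ} (hω : IsPrimitiveRoot ω (2 * n * k)) (p : Fin (2 * n * k)) :
    u.rotate.blockValue ω (finRotate _ p) = ω * u.blockValue ω p := by
  rcases u.blockValue_cases ω p with ⟨h1, h2⟩ | ⟨o, h1, h2, h3⟩
  · rw [h2, mul_zero, u.rotate.blockValue_of_antipode]
    rw [antipode_finRotate u.isSymmNC.even, sameCycle_nablaPerm_rotate]
    exact h1
  · rw [h3, ← pow_finRotate hω]
    refine u.rotate.blockValue_of_opener (fun q hq => ?_) (u.sameCycle_nablaPerm_rotate.mpr h2)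
    obtain ⟨q, rfl⟩ := (finRotate (2 * n * k)).surjective q
    rw [cdist_finRotate_finRotate]
    exact h1 q (u.sameCycle_nablaPerm_rotate.mp hq)

theorem reflRep_openerVector_rotate {ω : ℂ} (hω : IsPrimitiveRoot ω (2 * n * k))
    (w : Hyperoct n) :
    reflRep n (w * u.1 (lastIdx k) * (coxeter n)⁻¹) (u.rotate.openerVector ω) =
      ω • reflRep n w (u.openerVector ω) := by
  have key : reflRep n (u.1 (lastIdx k) * (coxeter n)⁻¹) (u.rotate.openerVector ω) =
      ω • u.openerVector ω := by
    refine coord_injective fun a => ?_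
    rw [coord_reflRep, coord_smul, u.rotate.coord_openerVector hω, u.coord_openerVector hω]
    -- `p` is the point of the last residue with root `a`, so it lies in the block of the vertex of
    -- `a`. One step takes it to the vertex of `c u_k⁻¹ a`, which explains the twist by `u_k c⁻¹`.
    set p : Fin (2 * n * k) :=
      finProdFinEquiv (toPerm n (u.1 (lastIdx k))⁻¹ (pos n a), lastIdx k) with hp
    have hlast : u.extend (lastIdx k) = u.1 (lastIdx k) := u.extend_of_lt (lastIdx k).2
    have h1 : finRotate (2 * n * k) p =
        vertexPos k ((u.1 (lastIdx k) * (coxeter n)⁻¹)⁻¹.1 a) := by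
      have hk := NeZero.pos k
      rw [hp, finRotate_finProdFinEquiv_of_eq _ (show k - 1 + 1 = k by omega), vertexPos,
        mul_inv_rev, inv_inv, ← toPerm_pos, map_mul, toPerm_coxeter, Perm.mul_apply]
    rw [← h1, u.blockValue_rotate hω]
    congr 1
    refine u.blockValue_congr ?_
    rw [sameCycle_vertexPos_iff, hp, root_finProdFinEquiv, hlast, ← Perm.mul_apply, ← map_mul,
      mul_inv_cancel, map_one]
    exact Perm.SameCycle.refl _ _
  rw [mul_assoc, map_mul, Module.End.mul_apply, key, map_smul]

end NCChain

end Hyperoct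

/-! ### Counting coordinates up to the action of `W` -/

/-! ### The cycle lemma, and iterates along a clockwise cycle. -/

namespace CirclePartition

open Equiv

variable {M : ℕ}

/-- The excess of a window, sum minus length, is a difference of values of the potential `∑_{r < p}
s r - p`; a window wrapping past position zero adds the total excess. -/
theorem sum_window_erase_of_lt (s : Fin M → ℕ) (p q : Fin M) :
    (∑ r ∈ (window q p).erase p, (s r : ℤ)) - cdist q p =
      ((∑ r ∈ Finset.univ.filter (· < p), (s r : ℤ)) - (p : ℕ)) -
        ((∑ r ∈ Finset.univ.filter (· < q), (s r : ℤ)) - (q : ℕ)) +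
        if p < q then (∑ r, (s r : ℤ)) - M else 0 := by
  have hsum : ∀ P : Fin M → Prop, ∀ [DecidablePred P],
      ∑ r ∈ Finset.univ.filter P, (s r : ℤ) = ∑ r, if P r then (s r : ℤ) else 0 := fun P _ =>
    Finset.sum_filter _ _
  have herase : (window q p).erase p = Finset.univ.filter fun r => r ≠ p ∧ cdist q r ≤ cdist q p := by
    ext r; simp [mem_window]
  have hp := p.2
  have hq := q.2
  rw [herase, hsum, hsum, hsum]
  have hcd : (cdist q p : ℤ) = (p : ℕ) - (q : ℕ) + if p < q then (M : ℤ) else 0 := by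
    simp only [cdist, Fin.lt_def]
    split_ifs <;> omega
  have hterm : ∑ r, (if r ≠ p ∧ cdist q r ≤ cdist q p then (s r : ℤ) else 0) =
      (∑ r, if r < p then (s r : ℤ) else 0) - (∑ r, if r < q then (s r : ℤ) else 0) +
        if p < q then ∑ r, (s r : ℤ) else 0 := by
    have : (if p < q then ∑ r, (s r : ℤ) else 0) = ∑ r, if p < q then (s r : ℤ) else 0 := by
      split_ifs <;> simp
    rw [this, ← Finset.sum_sub_distrib, ← Finset.sum_add_distrib]
    refine Finset.sum_congr rfl fun r _ => ?_
    have hr := r.2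
    have h1 : r ≠ p ∧ cdist q r ≤ cdist q p ↔
        (r : ℕ) ≠ p ∧ ((q : ℕ) ≤ p ∧ (q : ℕ) ≤ r ∧ (r : ℕ) < p ∨
          (p : ℕ) < q ∧ ((q : ℕ) ≤ r ∨ (r : ℕ) < p)) := by
      rw [ne_eq, Fin.ext_iff]
      simp only [cdist]
      split_ifs <;> omega
    rw [if_congr h1 rfl rfl]
    simp only [Fin.lt_def]
    split_ifs <;> omega
  rw [hterm, hcd]
  split_ifs <;> ring

/-- A cyclic sequence of `M` natural numbers with sum at most `M`, not all zero, has a positive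
entry such that each window ending just before it has sum at most its length. -/
theorem exists_record (s : Fin M → ℕ) (hs : ∑ p, s p ≤ M) {p₀ : Fin M} (hp₀ : 0 < s p₀) :
    ∃ p, 0 < s p ∧ ∀ q, ∑ r ∈ (window q p).erase p, s r ≤ cdist q p := by
  classical
  suffices H : ∀ s : Fin M → ℕ, ∑ p, s p = M →
      ∃ p, 0 < s p ∧ ∀ q, ∑ r ∈ (window q p).erase p, s r ≤ cdist q p by
    -- Padding at `p₀` brings the total up to `M`. As `s p₀` is already positive, no new positive
    -- entry appears.
    obtain ⟨p, hp, h⟩ := H (s + Pi.single p₀ (M - ∑ p, s p)) (by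
      simp only [Pi.add_apply, Finset.sum_add_distrib, Finset.sum_pi_single', Finset.mem_univ,
        if_true]
      omega)
    refine ⟨p, ?_, fun q => (Finset.sum_le_sum fun r _ => ?_).trans (h q)⟩
    · by_cases hpp : p = p₀
      · rwa [hpp]
      · simpa [hpp] using hp
    · exact Nat.le_add_right _ _
  intro s hs
  have hsum : ∑ r, (s r : ℤ) = M := by exact_mod_cast hs
  -- A window ending at a minimum of the potential has no positive excess.
  obtain ⟨p, -, hmin⟩ := Finset.exists_min_image Finset.univ
    (fun p : Fin M => (∑ r ∈ Finset.univ.filter (· < p), (s r : ℤ)) - (p : ℕ)) ⟨p₀, by simp⟩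
  have hle : ∀ q, ∑ r ∈ (window q p).erase p, s r ≤ cdist q p := by
    intro q
    have h1 := sum_window_erase_of_lt s p q
    rw [hsum, sub_self, ite_self, add_zero] at h1
    have h2 := hmin q (Finset.mem_univ q)
    zify
    linarith
  refine ⟨p, Nat.pos_of_ne_zero fun h0 => ?_, hle⟩
  have hM : 0 < M := by have := p.2; omega
  -- If `s p` were zero, the other `M - 1` positions would carry the whole sum `M`.
  have h1 := hle (finRotate M p)
  have h2 : cdist (finRotate M p) p + 1 = M := by
    have := cdist_finRotate_add p p
    rwa [cdist_self, add_zero] at this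
  have h3 : (window (finRotate M p) p).erase p = Finset.univ.erase p := by
    congr 1
    ext r
    have := cdist_lt (finRotate M p) r
    simp only [mem_window, Finset.mem_univ, iff_true]
    omega
  rw [h3] at h1
  have h4 := Finset.add_sum_erase Finset.univ s (Finset.mem_univ p)
  omega

/-- No step of a clockwise cycle passes over a point of the cycle, so the distance from `p` grows
until the first return to `p`. -/
theorem IsClockwise.cdist_pow_lt {f : Perm (Fin M)} (hf : IsClockwise f) {p : Fin M} {L : ℕ}
    (hL : ∀ i, 0 < i → i ≤ L → (f ^ i) p ≠ p) {i : ℕ} (hi : i < L) :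
    cdist p ((f ^ i) p) < cdist p ((f ^ L) p) := by
  have step : ∀ j, j < L → cdist p ((f ^ j) p) < cdist p ((f ^ (j + 1)) p) := by
    intro j hj
    have hne := hL (j + 1) (by omega) hj
    have hsc : f.SameCycle ((f ^ j) p) p := (Perm.sameCycle_pow_left.mpr (Perm.SameCycle.refl f p))
    rw [pow_succ', Perm.mul_apply] at hne ⊢
    rcases Nat.eq_zero_or_pos j with rfl | hj0
    · rw [pow_zero, Perm.one_apply, cdist_self]
      rw [pow_zero, Perm.one_apply] at hne
      exact Nat.pos_of_ne_zero fun h => hne (cdist_eq_zero.mp h).symm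
    · have h1 := hf _ _ hsc (hL j hj0 hj.le).symm
      generalize (f ^ j) p = z at *
      have h2 := hL j hj0 hj.le
      have h3 := hne
      have a1 : ((f z : Fin M) : ℕ) ≠ p := fun h => h3 (Fin.ext h)
      have a2 : f z ≠ z := fun h => by
        rw [h, cdist_self] at h1
        have hfix := hsc
        obtain ⟨i, rfl⟩ := hfix
        exact hne (by rw [h]; exact (Perm.zpow_apply_eq_self_of_apply_eq_self h i).symm)
      have a3 : ((f z : Fin M) : ℕ) ≠ z := fun h => a2 (Fin.ext h)
      have := p.2; have := z.2; have := (f z).2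
      simp only [cdist] at *
      split_ifs at * <;> omega
  obtain ⟨d, rfl⟩ := Nat.exists_eq_add_of_lt hi
  induction d with
  | zero => exact step i (by omega)
  | succ d ih =>
    exact (ih (fun i h0 h => hL i h0 (by omega)) (by omega) fun j hj => step j (by omega)).trans
      (step (i + d + 1) (by omega))

end CirclePartition

/-! ### Orbits of signed coordinate vectors under `W`. -/

namespace Hyperoct

open SignedIdx CirclePartition Equiv

variable {n k : ℕ}

/-- `V^u ∩ V^(u⁻¹ v)` lies in `V^v`, and additivity of the codimensions forces equality. -/
theorem AbsLE.fixedSpace_le {u v : Hyperoct n} (h : AbsLE u v) : fixedSpace v ≤ fixedSpace u := by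
  have h1 := finrank_add_reflLength u
  have h2 := finrank_add_reflLength v
  have h3 := finrank_add_reflLength (u⁻¹ * v)
  have h4 := Submodule.finrank_sup_add_finrank_inf_eq (fixedSpace u) (fixedSpace (u⁻¹ * v))
  have h5 : Module.finrank ℂ ↥(fixedSpace u ⊔ fixedSpace (u⁻¹ * v)) ≤ n := by
    simpa using Submodule.finrank_le (fixedSpace u ⊔ fixedSpace (u⁻¹ * v))
  have h6 : fixedSpace u ⊓ fixedSpace (u⁻¹ * v) ≤ fixedSpace v := fun x hx => by
    have := mem_fixedSpace_mul hx.1 hx.2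
    rwa [mul_inv_cancel_left] at this
  have h7 : reflLength v = reflLength u + reflLength (u⁻¹ * v) := h
  rw [← Submodule.eq_of_le_of_finrank_le h6 (by omega)]
  exact inf_le_left

theorem card_coord_reflRep (w : Hyperoct n) (v : Fin n → ℂ) (z : ℂ) :
    Nat.card {a // coord (reflRep n w v) a = z} = Nat.card {a // coord v a = z} :=
  Nat.card_congr (w⁻¹.1.subtypeEquiv fun a => by rw [coord_reflRep])

theorem card_coord_neg (v : Fin n → ℂ) (z : ℂ) :
    Nat.card {a // coord v a = -z} = Nat.card {a // coord v a = z} :=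
  Nat.card_congr ((Equiv.ofBijective neg ⟨neg_injective, fun a => ⟨neg a, by simp⟩⟩).subtypeEquiv
    fun a => by
      change _ ↔ coord v (neg a) = z
      rw [coord_neg, neg_eq_iff_eq_neg])

theorem card_fiber_eq {ι : Type*} [Finite ι] {f g : ι → ℂ}
    (h : ∀ z ≠ 0, Nat.card {a // f a = z} = Nat.card {a // g a = z}) (z : ℂ) :
    Nat.card {a // f a = z} = Nat.card {a // g a = z} := by
  by_cases hz : z = 0
  · subst hz
    have e : {a // f a ≠ 0} ≃ {a // g a ≠ 0} := by
      refine Equiv.ofFiberEquiv (γ := ℂ) (f := fun a => f a.1) (g := fun a => g a.1) fun z => ?_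
      by_cases hz : z = 0
      · have h1 : IsEmpty {a : {a // f a ≠ 0} // f a.1 = z} := ⟨fun a => a.1.2 (a.2.trans hz)⟩
        have h2 : IsEmpty {a : {a // g a ≠ 0} // g a.1 = z} := ⟨fun a => a.1.2 (a.2.trans hz)⟩
        exact Equiv.equivOfIsEmpty _ _
      · have key : ∀ f : ι → ℂ, {a : {a // f a ≠ 0} // f a.1 = z} ≃ {a // f a = z} := fun f =>
          Equiv.subtypeSubtypeEquivSubtype fun {a} (ha : f a = z) => ha ▸ hz
        exact (key f).trans ((Finite.card_eq.mp (h z hz)).some.trans (key g).symm)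
    have h1 := Nat.card_congr (Equiv.sumCompl fun a => f a = 0)
    have h2 := Nat.card_congr (Equiv.sumCompl fun a => g a = 0)
    have h3 := Nat.card_congr e
    rw [Nat.card_sum] at h1 h2
    simp only [ne_eq] at h3
    omega
  · exact h z hz

/-- The element of `W` changing the signs of the coordinates in a set. -/
def signFlip (s : Fin n → Bool) : Hyperoct n where
  val := Function.Involutive.toPerm (fun a => if s (absIdx a) then neg a else a) fun a => by
    dsimp only
    cases h : s (absIdx a) <;> simp [h, absIdx_neg]
  property := fun a => by
    change (if s (absIdx (neg a)) then neg (neg a) else neg a) =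
      neg (if s (absIdx a) then neg a else a)
    rw [absIdx_neg]
    split_ifs <;> rfl

/-- The element of `W` permuting the coordinates. -/
def permCoord (σ : Perm (Fin n)) : Hyperoct n where
  val := Equiv.sumCongr σ σ
  property := by rintro (i | i) <;> rfl

/-- A choice of one out of each pair of opposite nonzero complex numbers. -/
def IsPos (z : ℂ) : Prop := 0 < z.re ∨ z.re = 0 ∧ 0 < z.im

theorem isPos_neg {z : ℂ} (hz : z ≠ 0) : IsPos (-z) ↔ ¬ IsPos z := by
  unfold IsPos
  rw [ne_eq, Complex.ext_iff] at hz
  simp only [Complex.neg_re, Complex.neg_im, Complex.zero_re, Complex.zero_im] at *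
  grind

theorem exists_reflRep_pos (v : Fin n → ℂ) :
    ∃ w, ∀ i, reflRep n w v i = 0 ∨ IsPos (reflRep n w v i) := by
  classical
  refine ⟨(signFlip fun i => decide (¬ IsPos (v i)))⁻¹, fun i => ?_⟩
  have : reflRep n (signFlip fun i => decide (¬ IsPos (v i)))⁻¹ v i =
      if ¬ IsPos (v i) then - v i else v i := by
    change coord v ((signFlip fun i => decide (¬ IsPos (v i)))⁻¹⁻¹.1 (Sum.inl i)) = _
    rw [inv_inv]
    change coord v (if decide (¬ IsPos (v i)) then neg (Sum.inl i) else Sum.inl i) = _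
    simp only [decide_eq_true_eq]
    split_ifs
    · rfl
    · rfl
  rw [this]
  by_cases h0 : v i = 0
  · left; simp [h0]
  · right
    split_ifs with h
    · exact h
    · exact (isPos_neg h0).mpr h

open scoped Classical in
theorem card_fiber_of_pos {v : Fin n → ℂ} (hv : ∀ i, v i = 0 ∨ IsPos (v i)) (z : ℂ) (hz : z ≠ 0) :
    Nat.card {i // v i = z} = if IsPos z then Nat.card {a // coord v a = z} else 0 := by
  split_ifs with h
  · refine Nat.card_congr (Equiv.ofBijective (fun i => ⟨Sum.inl i.1, i.2⟩) ⟨fun i j hij => ?_, ?_⟩)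
    · simpa [Subtype.ext_iff] using hij
    · rintro ⟨a | a, ha⟩
      · exact ⟨⟨a, ha⟩, rfl⟩
      · exfalso
        have ha : -v a = z := ha
        have h1 : v a ≠ 0 := fun h0 => hz (by rw [← ha, h0, neg_zero])
        rw [← ha, isPos_neg h1] at h
        exact h ((hv a).resolve_left h1)
  · have : IsEmpty {i // v i = z} := ⟨fun i => h (by
      rw [← i.2]
      exact (hv i).resolve_left fun h0 => hz (by rw [← i.2, h0]))⟩
    exact Nat.card_of_isEmpty

/-- Two vectors are conjugate under `W` if they have the same nonzero signed coordinates. -/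
theorem exists_reflRep_eq {u v : Fin n → ℂ}
    (h : ∀ z ≠ 0, Nat.card {a // coord u a = z} = Nat.card {a // coord v a = z}) :
    ∃ w, reflRep n w u = v := by
  -- Once sign changes have brought all nonzero coordinates into `IsPos`, counting signed
  -- coordinates amounts to counting coordinates, and a permutation matches the two vectors.
  obtain ⟨w₁, h₁⟩ := exists_reflRep_pos u
  obtain ⟨w₂, h₂⟩ := exists_reflRep_pos v
  classical
  have key := card_fiber_eq (f := reflRep n w₂ v) (g := reflRep n w₁ u) fun z hz => by
    rw [card_fiber_of_pos h₁ z hz, card_fiber_of_pos h₂ z hz, card_coord_reflRep,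
      card_coord_reflRep, h z hz]
  let σ : Perm (Fin n) := Equiv.ofFiberEquiv fun z => (Finite.card_eq.mp (key z)).some
  have hσ : ∀ i, reflRep n w₁ u (σ i) = reflRep n w₂ v i := Equiv.ofFiberEquiv_map _
  refine ⟨w₂⁻¹ * ((permCoord σ)⁻¹ * w₁), ?_⟩
  have h3 : reflRep n (permCoord σ)⁻¹ (reflRep n w₁ u) = reflRep n w₂ v := by
    funext i
    rw [← hσ]
    change coord (reflRep n w₁ u) ((permCoord σ)⁻¹⁻¹.1 (Sum.inl i)) = _
    rw [inv_inv]
    rfl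
  rw [map_mul, map_mul, Module.End.mul_apply, Module.End.mul_apply, h3, ← Module.End.mul_apply,
    ← map_mul, inv_mul_cancel, map_one, Module.End.one_apply]

end Hyperoct

/-! ### Splitting the zero block of a multichain -/

namespace Hyperoct

open SignedIdx CirclePartition Equiv

variable {n k : ℕ}

theorem sameCycle_toPerm (w : Hyperoct n) {a b : SignedIdx n} :
    (toPerm n w).SameCycle (pos n a) (pos n b) ↔ w.1.SameCycle a b := by
  refine exists_congr fun i => ?_
  rw [← map_zpow, toPerm_pos, (pos n).injective.eq_iff]
  rfl

theorem sameCycle_neg (w : Hyperoct n) {a b : SignedIdx n} (h : w.1.SameCycle a b) :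
    w.1.SameCycle (neg a) (neg b) := by
  rw [← sameCycle_toPerm, pos_neg_eq_antipode, pos_neg_eq_antipode]
  exact sameCycle_antipode ((sameCycle_toPerm w).mpr h)

theorem pow_apply_neg (w : Hyperoct n) (i : ℕ) (a : SignedIdx n) :
    (w.1 ^ i) (neg a) = neg ((w.1 ^ i) a) := apply_neg (w ^ i) a

theorem reflLength_reflPerm_mul_inv_mul_le {a b : SignedIdx n} (h : a ≠ b) (w c : Hyperoct n) :
    reflLength ((reflPerm a b * w)⁻¹ * c) ≤ reflLength (w⁻¹ * c) + 1 := by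
  have h1 : (reflPerm a b * w)⁻¹ * c = w⁻¹ * c * (c⁻¹ * reflPerm a b * c⁻¹⁻¹) := by
    rw [mul_inv_rev, reflPerm_inv]; group
  have h2 : reflLength (reflPerm a b) ≤ 1 := by
    simpa using reflLength_le [reflPerm a b] (by simpa using isRefl_reflPerm h)
  rw [h1]
  exact (reflLength_mul_le _ _).trans (Nat.add_le_add_left (by rwa [reflLength_conj]) _)

/-- Passing from `u` to `t u` lowers the length by one, while the complement `(t u)⁻¹ c` gains at
most one. -/
theorem absLE_reflPerm_mul {a b : SignedIdx n} (h : a ≠ b) {u c : Hyperoct n} (huc : AbsLE u c)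
    (hu : fixedSpace u ≤ fixedSpace (reflPerm a b)) : AbsLE (reflPerm a b * u) c := by
  have h1 := reflLength_reflPerm_mul h hu
  have h2 := reflLength_reflPerm_mul_inv_mul_le h u c
  have h3 := reflLength_mul_le (reflPerm a b * u) ((reflPerm a b * u)⁻¹ * c)
  rw [mul_inv_cancel_left] at h3
  unfold AbsLE at *
  omega

/-- The quotient `u⁻¹ v` is unchanged and both lengths drop by one. -/
theorem absLE_reflPerm_mul_reflPerm_mul {a b : SignedIdx n} (h : a ≠ b) {u v : Hyperoct n}
    (huv : AbsLE u v) (hu : fixedSpace u ≤ fixedSpace (reflPerm a b)) :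
    AbsLE (reflPerm a b * u) (reflPerm a b * v) := by
  have h1 := reflLength_reflPerm_mul h hu
  have h2 := reflLength_reflPerm_mul h (huv.fixedSpace_le.trans hu)
  unfold AbsLE at *
  rw [show (reflPerm a b * u)⁻¹ * (reflPerm a b * v) = u⁻¹ * v by group]
  omega

namespace NCChain

variable [NeZero n] [NeZero k]

/-- The multichain `(t u_1, …, t u_k)` for a reflection `t` fixing `V^{u_1}`. -/
def reflect (u : NCChain n k) {a b : SignedIdx n} (h : a ≠ b)
    (hu : fixedSpace (u.1 0) ≤ fixedSpace (reflPerm a b)) : NCChain n k :=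
  have hle : ∀ i, fixedSpace (u.1 i) ≤ fixedSpace (reflPerm a b) := fun i =>
    (u.2.2 0 i (Fin.zero_le i)).fixedSpace_le.trans hu
  ⟨fun i => reflPerm a b * u.1 i, fun i => absLE_reflPerm_mul h (u.2.1 i) (hle i),
    fun i j hij => absLE_reflPerm_mul_reflPerm_mul h (u.2.2 i j hij) (hle i)⟩

theorem root_reflect (u : NCChain n k) {a b : SignedIdx n} (h : a ≠ b)
    (hu : fixedSpace (u.1 0) ≤ fixedSpace (reflPerm a b)) (p : Fin (2 * n * k)) :
    (u.reflect h hu).root p = toPerm n (reflPerm a b) (u.root p) := by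
  rw [root, root, extend_of_lt _ p.modNat.2, extend_of_lt _ p.modNat.2, ← Perm.mul_apply,
    ← map_mul]
  rfl

/-- The element of `±[n]` that a point of the circle `±[kn]` stands for. -/
def signedRoot (u : NCChain n k) (p : Fin (2 * n * k)) : SignedIdx n := (pos n).symm (u.root p)

variable (u : NCChain n k)

theorem pos_signedRoot (p : Fin (2 * n * k)) : pos n (u.signedRoot p) = u.root p :=
  (pos n).apply_symm_apply _

theorem signedRoot_vertexPos (a : SignedIdx n) :
    u.signedRoot (vertexPos k a) = (u.1 0).1 a := by
  rw [signedRoot, root_vertexPos, extend_zero, toPerm_pos, Equiv.symm_apply_apply]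

theorem signedRoot_reflect {a b : SignedIdx n} (h : a ≠ b)
    (hu : fixedSpace (u.1 0) ≤ fixedSpace (reflPerm a b)) (p : Fin (2 * n * k)) :
    (u.reflect h hu).signedRoot p = (reflPerm a b).1 (u.signedRoot p) := by
  apply (pos n).injective
  rw [pos_signedRoot, root_reflect, ← pos_signedRoot, toPerm_pos]

theorem eq_of_signedRoot_eq {p q : Fin (2 * n * k)} (h : u.signedRoot p = u.signedRoot q)
    (h' : p.modNat = q.modNat) : p = q :=
  u.rootEquiv.injective (Prod.ext ((pos n).symm.injective h) h')

theorem sameCycle_nablaPerm_iff_signedRoot {p q : Fin (2 * n * k)} :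
    u.nablaPerm.SameCycle p q ↔ (u.1 0).1.SameCycle (u.signedRoot p) (u.signedRoot q) := by
  rw [sameCycle_nablaPerm_iff, ← pos_signedRoot, ← pos_signedRoot, sameCycle_toPerm, extend_zero]

theorem sameCycle_vertexPos_iff_signedRoot {p : Fin (2 * n * k)} {a : SignedIdx n} :
    u.nablaPerm.SameCycle (vertexPos k a) p ↔ (u.1 0).1.SameCycle a (u.signedRoot p) := by
  rw [sameCycle_nablaPerm_iff_signedRoot, signedRoot_vertexPos, Perm.sameCycle_apply_left]

theorem modNat_vertexPos (a : SignedIdx n) : ((vertexPos k a).modNat : ℕ) = 0 := by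
  rw [vertexPos, modNat_finProdFinEquiv]

theorem nablaPerm_pow_vertexPos_of_lt (a : SignedIdx n) {l : ℕ} (hl : l < k) :
    u.signedRoot ((u.nablaPerm ^ l) (vertexPos k a)) = (u.1 0).1 a ∧
      (((u.nablaPerm ^ l) (vertexPos k a)).modNat : ℕ) = l := by
  induction l with
  | zero => exact ⟨u.signedRoot_vertexPos a, modNat_vertexPos a⟩
  | succ l ih =>
    obtain ⟨h1, h2⟩ := ih (by omega)
    have h3 := u.nablaPerm_of_lt (p := (u.nablaPerm ^ l) (vertexPos k a)) (by omega)
    rw [pow_succ', Perm.mul_apply, signedRoot, h3.1, h3.2, h2]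
    exact ⟨h1, rfl⟩

theorem nablaPerm_pow_vertexPos (a : SignedIdx n) :
    (u.nablaPerm ^ k) (vertexPos k a) = vertexPos k ((u.1 0).1 a) := by
  obtain ⟨l, hl⟩ : ∃ l, k = l + 1 := ⟨k - 1, by have := NeZero.pos k; omega⟩
  obtain ⟨h1, h2⟩ := u.nablaPerm_pow_vertexPos_of_lt a (l := l) (by omega)
  have h3 := u.nablaPerm_of_eq (p := (u.nablaPerm ^ l) (vertexPos k a)) (by omega)
  have h4 : (u.nablaPerm ^ k) (vertexPos k a) =
      u.nablaPerm ((u.nablaPerm ^ l) (vertexPos k a)) := by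
    rw [← Perm.mul_apply, ← pow_succ', ← hl]
  rw [h4]
  refine u.eq_of_signedRoot_eq ?_ (Fin.ext ?_)
  · rw [signedRoot_vertexPos, signedRoot, h3.1, ← pos_signedRoot, h1, extend_zero, toPerm_pos,
      Equiv.symm_apply_apply]
  · rw [h3.2, modNat_vertexPos]

theorem nablaPerm_pow_mul_vertexPos (a : SignedIdx n) (j : ℕ) :
    (u.nablaPerm ^ (k * j)) (vertexPos k a) = vertexPos k (((u.1 0).1 ^ j) a) := by
  induction j with
  | zero => rfl
  | succ j ih =>
    rw [mul_add, mul_one, add_comm, pow_add, Perm.mul_apply, ih, nablaPerm_pow_vertexPos, pow_succ',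
      Perm.mul_apply]

/-- The exponent is `j + 1` because the vertex of `a` has root `u_1(a)` rather than `a`. -/
theorem nablaPerm_pow_add_vertexPos (a : SignedIdx n) (j : ℕ) {l : ℕ} (hl : l < k) :
    u.signedRoot ((u.nablaPerm ^ (k * j + l)) (vertexPos k a)) = ((u.1 0).1 ^ (j + 1)) a ∧
      (((u.nablaPerm ^ (k * j + l)) (vertexPos k a)).modNat : ℕ) = l := by
  rw [add_comm, pow_add, Perm.mul_apply, nablaPerm_pow_mul_vertexPos, pow_succ', Perm.mul_apply]
  exact u.nablaPerm_pow_vertexPos_of_lt _ hl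

end NCChain

/-! The cycle of `a` under an element `x` of `W`, when it contains `-a` as its `r`-th element. -/

section zeroCycle

variable {x : Hyperoct n} {a : SignedIdx n} {r m : ℕ}

/-- The cycle of `a` has length `2 r`: an earlier return to `a` would produce `-a` before step `r`.
-/
theorem pow_apply_ne_self (hr : (x.1 ^ r) a = neg a)
    (hmin : ∀ j < r, (x.1 ^ j) a ≠ neg a)
    {d : ℕ} (h0 : 0 < d) (hd : d < 2 * r) : (x.1 ^ d) a ≠ a := by
  intro h
  rcases lt_trichotomy d r with h1 | rfl | h1
  · refine hmin (r - d) (by omega) ?_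
    conv_lhs => rw [← h]
    rw [← Perm.mul_apply, ← pow_add, Nat.sub_add_cancel h1.le, hr]
  · exact neg_ne_self a (hr.symm.trans h)
  · refine hmin (d - r) (by omega) ?_
    rw [← neg_eq_iff, ← pow_apply_neg, ← hr, ← Perm.mul_apply, ← pow_add,
      Nat.sub_add_cancel h1.le, h]

theorem pow_apply_injOn (hr : (x.1 ^ r) a = neg a)
    (hmin : ∀ j < r, (x.1 ^ j) a ≠ neg a) {i j : ℕ} (hi : i < 2 * r) (hj : j < 2 * r)
    (h : (x.1 ^ i) a = (x.1 ^ j) a) : i = j := by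
  have key : ∀ {i j : ℕ}, j < 2 * r → i < j → (x.1 ^ i) a ≠ (x.1 ^ j) a := by
    intro i j hj hij h
    refine pow_apply_ne_self hr hmin (d := j - i) (by omega) (by omega)
      ((x.1 ^ i).injective ?_)
    rw [← Perm.mul_apply, ← pow_add, Nat.add_sub_cancel' hij.le, h]
  rcases lt_trichotomy i j with h1 | h1 | h1
  · exact absurd h (key hj h1)
  · exact h1
  · exact absurd h.symm (key hi h1)

theorem neg_pow_apply (hr : (x.1 ^ r) a = neg a) (i : ℕ) :
    neg ((x.1 ^ i) a) = (x.1 ^ (i + r)) a := by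
  rw [← pow_apply_neg, ← hr, ← Perm.mul_apply, ← pow_add]

theorem reflPerm_pow_apply (hr : (x.1 ^ r) a = neg a)
    (hmin : ∀ j < r, (x.1 ^ j) a ≠ neg a) (hm0 : 0 < m) (hmr : m ≤ r)
    {i : ℕ} (hi0 : 0 < i) (hir : i < r) (him : i ≠ m) :
    (reflPerm a ((x.1 ^ m) a)).1 ((x.1 ^ i) a) = (x.1 ^ i) a := by
  have inj := fun {i j : ℕ} => pow_apply_injOn hr hmin (i := i) (j := j)
  rw [reflPerm_apply, if_neg, if_neg, if_neg, if_neg]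
  · rcases hmr.lt_or_eq with h1 | rfl
    · rw [neg_pow_apply hr]
      exact fun h => by have := inj (by omega) (by omega) h; omega
    · rw [hr, SignedIdx.neg_neg]
      exact pow_apply_ne_self hr hmin hi0 (by omega)
  · rw [← hr]
    exact fun h => by have := inj (by omega) (by omega) h; omega
  · exact fun h => him (inj (by omega) (by omega) h)
  · exact pow_apply_ne_self hr hmin hi0 (by omega)

theorem reflPerm_pow_apply_self (hr : (x.1 ^ r) a = neg a)
    (hmin : ∀ j < r, (x.1 ^ j) a ≠ neg a) (hm0 : 0 < m) (hmr : m ≤ r) : (reflPerm a ((x.1 ^ m) a)).1 ((x.1 ^ m) a) = a := by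
  rw [reflPerm_apply, if_neg (pow_apply_ne_self hr hmin hm0 (by omega)), if_pos rfl]

theorem reflPerm_neg_apply (hr : (x.1 ^ r) a = neg a)
    (hmin : ∀ j < r, (x.1 ^ j) a ≠ neg a) (hm0 : 0 < m) (h : m < r) :
    (reflPerm a ((x.1 ^ m) a)).1 ((x.1 ^ r) a) = neg ((x.1 ^ m) a) := by
  rw [reflPerm_apply, if_neg (pow_apply_ne_self hr hmin (by omega) (by omega)), if_neg, if_pos hr]
  exact fun h => by have := pow_apply_injOn hr hmin (by omega) (by omega) h; omega

/-- The product follows `x` from `a` to `x^(m-1) a`, and then the reflection sends `x^m a` back to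
`a`. For `m = r` it exchanges `a` and `-a`, and nothing of the zero cycle is left. -/
theorem sameCycle_reflPerm_mul_iff (hr : (x.1 ^ r) a = neg a)
    (hmin : ∀ j < r, (x.1 ^ j) a ≠ neg a) (hm0 : 0 < m) (hmr : m ≤ r) {z : SignedIdx n} :
    (reflPerm a ((x.1 ^ m) a) * x).1.SameCycle a z ↔ ∃ j < m, z = (x.1 ^ j) a := by
  have happ : ∀ j, (reflPerm a ((x.1 ^ m) a) * x).1 ((x.1 ^ j) a) =
      (reflPerm a ((x.1 ^ m) a)).1 ((x.1 ^ (j + 1)) a) := fun j => by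
    rw [pow_succ']; rfl
  have hstep : ∀ j, j + 1 < m → (reflPerm a ((x.1 ^ m) a) * x).1 ((x.1 ^ j) a) =
      (x.1 ^ (j + 1)) a := fun j hj => by
    rw [happ, reflPerm_pow_apply hr hmin hm0 hmr (by omega) (by omega) (by omega)]
  constructor
  · intro h
    refine (invariant_of_sameCycle (g := fun z => ∃ j < m, z = (x.1 ^ j) a) ?_ h).mp ⟨0, hm0, rfl⟩
    rintro _ ⟨j, hj, rfl⟩
    rcases Nat.lt_or_ge (j + 1) m with h1 | h1
    · exact ⟨j + 1, h1, hstep j h1⟩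
    · obtain rfl : m = j + 1 := by omega
      exact ⟨0, hm0, (happ j).trans (reflPerm_pow_apply_self hr hmin hm0 hmr)⟩
  · rintro ⟨j, hj, rfl⟩
    induction j with
    | zero => exact Perm.SameCycle.refl _ _
    | succ j ih =>
      rw [← hstep j hj]
      exact (ih (by omega)).trans (sameCycle_apply _ _)

/-- The remaining part from `x^m a` to `x^(r-1) a` is continued by `-x^m a`, since the reflection
sends `-a` there; so it closes up into a self-opposite cycle. -/
theorem sameCycle_reflPerm_mul_neg (hr : (x.1 ^ r) a = neg a)
    (hmin : ∀ j < r, (x.1 ^ j) a ≠ neg a) (hm0 : 0 < m) (hmr : m ≤ r)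
    {i : ℕ} (hmi : m ≤ i) (hir : i < r) :
    (reflPerm a ((x.1 ^ m) a) * x).1.SameCycle ((x.1 ^ i) a) (neg ((x.1 ^ i) a)) := by
  have happ : ∀ j, (reflPerm a ((x.1 ^ m) a) * x).1 ((x.1 ^ j) a) =
      (reflPerm a ((x.1 ^ m) a)).1 ((x.1 ^ (j + 1)) a) := fun j => by
    rw [pow_succ']; rfl
  have h1 : ∀ i, m ≤ i → i < r →
      (reflPerm a ((x.1 ^ m) a) * x).1.SameCycle ((x.1 ^ m) a) ((x.1 ^ i) a) := by
    intro i hmi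
    induction i, hmi using Nat.le_induction with
    | base => exact fun _ => Perm.SameCycle.refl _ _
    | succ i hmi ih =>
      intro hi
      refine (ih (by omega)).trans ?_
      have h2 := happ i
      rw [reflPerm_pow_apply hr hmin hm0 hmr (by omega) (by omega) (by omega)] at h2
      rw [← h2]
      exact sameCycle_apply _ _
  have h2 : (reflPerm a ((x.1 ^ m) a) * x).1.SameCycle ((x.1 ^ m) a) (neg ((x.1 ^ m) a)) := by
    refine (h1 (r - 1) (by omega) (by omega)).trans ?_
    have h3 := happ (r - 1)
    rw [Nat.sub_add_cancel (by omega), reflPerm_neg_apply hr hmin hm0 (by omega)] at h3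
    rw [← h3]
    exact sameCycle_apply _ _
  exact (h1 i hmi hir).symm.trans (h2.trans (sameCycle_neg _ (h1 i hmi hir)))

theorem sameCycle_reflPerm_apply (m : ℕ) (z : SignedIdx n) :
    x.1.SameCycle z ((reflPerm a ((x.1 ^ m) a)).1 z) := by
  have h : x.1.SameCycle a ((x.1 ^ m) a) := Perm.sameCycle_pow_right.mpr (Perm.SameCycle.refl _ _)
  rw [reflPerm_apply]
  split_ifs with h1 h2 h3 h4
  · rwa [h1]
  · rw [h2]; exact h.symm
  · rw [h3]; exact sameCycle_neg x h
  · rw [h4]; exact sameCycle_neg x h.symm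
  · exact Perm.SameCycle.refl _ _

theorem reflPerm_apply_of_not_sameCycle (hr : (x.1 ^ r) a = neg a) (m : ℕ) {z : SignedIdx n} (hz : ¬ x.1.SameCycle a z) :
    (reflPerm a ((x.1 ^ m) a)).1 z = z := by
  have h : x.1.SameCycle a ((x.1 ^ m) a) := Perm.sameCycle_pow_right.mpr (Perm.SameCycle.refl _ _)
  have hneg : x.1.SameCycle a (neg a) := by
    rw [← hr]; exact Perm.sameCycle_pow_right.mpr (Perm.SameCycle.refl _ _)
  rw [reflPerm_apply, if_neg, if_neg, if_neg, if_neg]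
  · rintro rfl; exact hz (hneg.trans (sameCycle_neg x h))
  · rintro rfl; exact hz hneg
  · rintro rfl; exact hz h
  · rintro rfl; exact hz (Perm.SameCycle.refl _ _)

theorem sameCycle_reflPerm_mul_of_not (hr : (x.1 ^ r) a = neg a) (m : ℕ) {z z' : SignedIdx n} (hz : ¬ x.1.SameCycle a z) :
    (reflPerm a ((x.1 ^ m) a) * x).1.SameCycle z z' ↔ x.1.SameCycle z z' := by
  have happ : ∀ y, x.1.SameCycle z y → (reflPerm a ((x.1 ^ m) a) * x).1 y = x.1 y := fun y hy =>
    reflPerm_apply_of_not_sameCycle hr m fun h =>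
      hz (h.trans ((hy.trans (sameCycle_apply _ _)).symm))
  constructor
  · intro h
    refine (invariant_of_sameCycle (g := fun y => x.1.SameCycle z y) (fun y hy => ?_) h).mp
      (Perm.SameCycle.refl _ _)
    rw [happ y hy]
    exact hy.trans (sameCycle_apply _ _)
  · intro h
    refine ((invariant_of_sameCycle (g := fun y => x.1.SameCycle z y ∧
      (reflPerm a ((x.1 ^ m) a) * x).1.SameCycle z y) (fun y hy => ?_) h).mp
      ⟨Perm.SameCycle.refl _ _, Perm.SameCycle.refl _ _⟩).2
    refine ⟨hy.1.trans (sameCycle_apply _ _), hy.2.trans ?_⟩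
    rw [← happ y hy.1]
    exact sameCycle_apply _ _

theorem fixedSpace_le_reflPerm (m : ℕ) :
    fixedSpace x ≤ fixedSpace (reflPerm a ((x.1 ^ m) a)) := fun _ hv =>
  mem_fixedSpace_reflPerm (coord_eq_of_sameCycle hv ((sameCycle_toPerm x).mpr
    (Perm.sameCycle_pow_right.mpr (Perm.SameCycle.refl _ _))))

end zeroCycle

end Hyperoct

/-! ### Surjectivity -/

namespace Hyperoct

open SignedIdx CirclePartition Equiv

variable {n k : ℕ}

theorem exists_eq_pow_or_neg {x : Hyperoct n} {a b : SignedIdx n} {r : ℕ}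
    (hr : (x.1 ^ r) a = neg a) (hr0 : 0 < r) (h : x.1.SameCycle a b) :
    ∃ i < r, b = (x.1 ^ i) a ∨ b = neg ((x.1 ^ i) a) := by
  refine (invariant_of_sameCycle (g := fun b => ∃ i < r, b = (x.1 ^ i) a ∨ b = neg ((x.1 ^ i) a))
    ?_ h).mp ⟨0, hr0, Or.inl rfl⟩
  have hstep : ∀ i < r, ∃ j < r,
      x.1 ((x.1 ^ i) a) = (x.1 ^ j) a ∨ x.1 ((x.1 ^ i) a) = neg ((x.1 ^ j) a) := by
    intro i hi
    rw [← Perm.mul_apply, ← pow_succ']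
    rcases Nat.lt_or_ge (i + 1) r with h1 | h1
    · exact ⟨i + 1, h1, Or.inl rfl⟩
    · obtain rfl : r = i + 1 := by omega
      exact ⟨0, hr0, Or.inr hr⟩
  rintro _ ⟨i, hi, rfl | rfl⟩
  · exact hstep i hi
  · obtain ⟨j, hj, h⟩ := hstep i hi
    refine ⟨j, hj, ?_⟩
    rw [apply_neg]
    rcases h with h | h
    · exact Or.inr (by rw [h])
    · exact Or.inl (by rw [h, SignedIdx.neg_neg])

namespace NCChain

variable [NeZero n] [NeZero k] (u : NCChain n k) {a : SignedIdx n} {r m : ℕ} {ω : ℂ}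

/-- The cycle of the vertex of `a` reaches the antipode after `k * r` steps. Being clockwise and not
having returned before, it keeps to the half circle until then. -/
theorem cdist_nablaPerm_pow_lt (hr : ((u.1 0).1 ^ r) a = neg a)
    (hmin : ∀ j < r, ((u.1 0).1 ^ j) a ≠ neg a) {i : ℕ} (hi : i < k * r) :
    cdist (vertexPos k a) ((u.nablaPerm ^ i) (vertexPos k a)) < 2 * n * k / 2 := by
  have h1 : (u.nablaPerm ^ (k * r)) (vertexPos k a) = antipode (vertexPos k a) := by
    rw [nablaPerm_pow_mul_vertexPos, hr, vertexPos_neg]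
  have h2 : cdist (vertexPos k a) (antipode (vertexPos k a)) = 2 * n * k / 2 := by
    have := (vertexPos k a).2
    rw [cdist_antipode u.isSymmNC.even, cdist_self, if_pos (by
      obtain ⟨m, hm⟩ := u.isSymmNC.even; omega), zero_add]
  rw [← h2, ← h1]
  refine u.isClockwise.2.cdist_pow_lt (fun i hi0 hi h => ?_) hi
  have hk := NeZero.pos k
  have h3 : k * (i / k) + i % k = i := Nat.div_add_mod i k
  have h4 := (u.nablaPerm_pow_add_vertexPos a (i / k) (Nat.mod_lt i hk)).2
  rw [h3, h, modNat_vertexPos] at h4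
  have h5 := h
  rw [← h3, ← h4, add_zero, nablaPerm_pow_mul_vertexPos] at h5
  have h6 : ((u.1 0).1 ^ (i / k)) a = a := by
    simpa [vertexPos] using h5
  have h7 : i / k ≤ r := Nat.div_le_of_le_mul hi
  have h8 : 0 < i / k := Nat.pos_of_ne_zero fun h0 => by rw [h0] at h3; omega
  exact pow_apply_ne_self hr hmin h8 (by omega) h6

/-- In terms of the original multichain, the new block consists of the first `k * m` points of the
`nablaPerm`-cycle starting at the vertex of `a`, all in one half circle. -/
theorem isOpener_reflect (hr : ((u.1 0).1 ^ r) a = neg a)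
    (hmin : ∀ j < r, ((u.1 0).1 ^ j) a ≠ neg a) (hm0 : 0 < m) (hmr : m ≤ r)
    (hne : a ≠ ((u.1 0).1 ^ m) a) :
    IsOpener (cycles (u.reflect hne (fixedSpace_le_reflPerm m)).nablaPerm) (vertexPos k a) := by
  intro q hq
  have hq' := (sameCycle_vertexPos_iff_signedRoot _).mp hq
  rw [signedRoot_reflect] at hq'
  obtain ⟨j, hj, h⟩ := (sameCycle_reflPerm_mul_iff hr hmin hm0 hmr).mp hq'
  -- Undoing the reflection turns the exponents `0, …, m - 1` into `1, …, m`: `a` becomes `x^m a`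
  -- and the other powers stay.
  have h1 : ∃ j < m, u.signedRoot q = ((u.1 0).1 ^ (j + 1)) a := by
    have h2 : u.signedRoot q = (reflPerm a (((u.1 0).1 ^ m) a)).1 (((u.1 0).1 ^ j) a) := by
      have h3 : (reflPerm a (((u.1 0).1 ^ m) a)).1 ((reflPerm a (((u.1 0).1 ^ m) a)).1
          (u.signedRoot q)) = u.signedRoot q :=
        congrArg (fun w : Hyperoct n => w.1 (u.signedRoot q)) (reflPerm_mul_self a _)
      rw [← h, h3]
    rcases Nat.eq_zero_or_pos j with rfl | hj0
    · refine ⟨m - 1, by omega, ?_⟩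
      rw [h2, Nat.sub_add_cancel hm0, pow_zero, Perm.one_apply, reflPerm_apply, if_pos rfl]
    · refine ⟨j - 1, by omega, ?_⟩
      rw [h2, Nat.sub_add_cancel hj0, reflPerm_pow_apply hr hmin hm0 hmr hj0 (by omega) (by omega)]
  obtain ⟨j, hj, h1⟩ := h1
  have h2 := u.nablaPerm_pow_add_vertexPos a j q.modNat.2
  have h3 : (u.nablaPerm ^ (k * j + q.modNat)) (vertexPos k a) = q :=
    u.eq_of_signedRoot_eq (h2.1.trans h1.symm) (Fin.ext h2.2)
  rw [← h3]
  refine u.cdist_nablaPerm_pow_lt hr hmin ?_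
  have h4 : k * (j + 1) ≤ k * r := Nat.mul_le_mul_left k (by omega)
  have := q.modNat.2
  rw [mul_add, mul_one] at h4
  omega

theorem sameCycle_vertexPos_vertexPos_iff {a b : SignedIdx n} :
    u.nablaPerm.SameCycle (vertexPos k a) (vertexPos k b) ↔ (u.1 0).1.SameCycle a b := by
  rw [sameCycle_vertexPos_iff_signedRoot, signedRoot_vertexPos, Perm.sameCycle_apply_right]

theorem blockValue_reflect_of_lt (hr : ((u.1 0).1 ^ r) a = neg a)
    (hmin : ∀ j < r, ((u.1 0).1 ^ j) a ≠ neg a) (hm0 : 0 < m) (hmr : m ≤ r)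
    (hne : a ≠ ((u.1 0).1 ^ m) a) {j : ℕ} (hj : j < m) :
    (u.reflect hne (fixedSpace_le_reflPerm m)).blockValue ω (vertexPos k (((u.1 0).1 ^ j) a)) =
      ω ^ ((vertexPos k a : ℕ) + 1) := by
  refine blockValue_of_opener _ (u.isOpener_reflect hr hmin hm0 hmr hne) ?_
  rw [sameCycle_vertexPos_vertexPos_iff]
  exact (sameCycle_reflPerm_mul_iff hr hmin hm0 hmr).mpr ⟨j, hj, rfl⟩

theorem blockValue_reflect_of_ge (hr : ((u.1 0).1 ^ r) a = neg a)
    (hmin : ∀ j < r, ((u.1 0).1 ^ j) a ≠ neg a) (hm0 : 0 < m) (hmr : m ≤ r)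
    (hne : a ≠ ((u.1 0).1 ^ m) a) {i : ℕ} (hmi : m ≤ i) (hir : i < r) :
    (u.reflect hne (fixedSpace_le_reflPerm m)).blockValue ω (vertexPos k (((u.1 0).1 ^ i) a)) =
      0 := by
  refine blockValue_of_antipode _ ?_
  rw [← vertexPos_neg, sameCycle_vertexPos_vertexPos_iff]
  exact sameCycle_reflPerm_mul_neg hr hmin hm0 hmr hmi hir

/-- The reflection moves only elements of the zero cycle, so every other block keeps its points and
its opener. -/
theorem blockValue_reflect_of_not_sameCycle (hr : ((u.1 0).1 ^ r) a = neg a)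
    (hne : a ≠ ((u.1 0).1 ^ m) a) {b : SignedIdx n} (hb : ¬ (u.1 0).1.SameCycle a b) :
    (u.reflect hne (fixedSpace_le_reflPerm m)).blockValue ω (vertexPos k b) =
      u.blockValue ω (vertexPos k b) := by
  have hz : u.nablaPerm.SameCycle (vertexPos k a) (antipode (vertexPos k a)) := by
    rw [← vertexPos_neg, sameCycle_vertexPos_vertexPos_iff, ← hr]
    exact Perm.sameCycle_pow_right.mpr (Perm.SameCycle.refl _ _)
  have key : ∀ {p q : Fin (2 * n * k)}, ¬ u.nablaPerm.SameCycle (vertexPos k a) p →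
      ((u.reflect hne (fixedSpace_le_reflPerm m)).nablaPerm.SameCycle p q ↔
        u.nablaPerm.SameCycle p q) := by
    intro p q hp
    rw [sameCycle_vertexPos_iff_signedRoot] at hp
    rw [sameCycle_nablaPerm_iff_signedRoot, sameCycle_nablaPerm_iff_signedRoot,
      signedRoot_reflect, signedRoot_reflect, reflPerm_apply_of_not_sameCycle hr m hp]
    refine (sameCycle_reflPerm_mul_of_not hr m hp).trans ⟨fun h => ?_, fun h => ?_⟩
    · exact h.trans (sameCycle_reflPerm_apply m _).symm
    · exact h.trans (sameCycle_reflPerm_apply m _)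
  rw [← sameCycle_vertexPos_vertexPos_iff (k := k)] at hb
  rcases u.blockValue_cases ω (vertexPos k b) with ⟨h1, h2⟩ | ⟨o, h1, h2, h3⟩
  · exact absurd (u.isSymmNC.zero_unique hz h1) hb
  · have ho : ¬ u.nablaPerm.SameCycle (vertexPos k a) o := fun h =>
      h1.not_antipode u.isSymmNC.even h.symm hz
    rw [h3]
    exact blockValue_of_opener _ (fun q hq => h1 q ((key ho).mp hq)) ((key ho).mpr h2)

/-- A block of prescribed size can be split off from the zero block. -/
theorem exists_split (hω : IsPrimitiveRoot ω (2 * n * k)) (ha : coord (u.openerVector ω) a = 0)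
    (hm0 : 0 < m) (hm : 2 * m ≤ Nat.card {b // coord (u.openerVector ω) b = 0}) :
    ∃ u' : NCChain n k,
      (∀ b, coord (u.openerVector ω) b ≠ 0 →
        coord (u'.openerVector ω) b = coord (u.openerVector ω) b) ∧
      (∀ b, coord (u.openerVector ω) b = 0 → coord (u'.openerVector ω) b = 0 ∨
        coord (u'.openerVector ω) b = ω ^ ((vertexPos k a : ℕ) + 1) ∨
        coord (u'.openerVector ω) b = -ω ^ ((vertexPos k a : ℕ) + 1)) ∧
      Nat.card {b // coord (u.openerVector ω) b = 0 ∧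
        coord (u'.openerVector ω) b = ω ^ ((vertexPos k a : ℕ) + 1)} = m := by
  classical
  set x := u.1 0 with hx
  have hzero : ∀ b, coord (u.openerVector ω) b = 0 ↔ x.1.SameCycle a b := by
    intro b
    rw [u.coord_openerVector hω, u.blockValue_eq_zero_iff hω] at ha
    rw [u.coord_openerVector hω, u.blockValue_eq_zero_iff hω,
      ← sameCycle_vertexPos_vertexPos_iff (k := k)]
    exact ⟨fun h => u.isSymmNC.zero_unique ha h, fun h => h.symm.trans (ha.trans (u.isSymmNC.symm h))⟩
  have hex : ∃ r, (x.1 ^ r) a = neg a := by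
    have : x.1.SameCycle a (neg a) := (hzero _).mp (by rw [coord_neg, ha, neg_zero])
    obtain ⟨r, -, h⟩ := this.exists_pow_eq'
    exact ⟨r, h⟩
  obtain ⟨r, hr, hmin⟩ : ∃ r, (x.1 ^ r) a = neg a ∧ ∀ j < r, (x.1 ^ j) a ≠ neg a :=
    ⟨Nat.find hex, Nat.find_spec hex, fun j hj => Nat.find_min hex hj⟩
  have hr0 : 0 < r := Nat.pos_of_ne_zero (by rintro rfl; exact neg_ne_self a hr.symm)
  have hcyc := fun b (h : coord (u.openerVector ω) b = 0) =>
    exists_eq_pow_or_neg hr hr0 ((hzero b).mp h)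
  -- The vanishing signed coordinates are among the `±x^i a` with `i < r`, so there are at most `2
  -- r` of them.
  have hmr : m ≤ r := by
    have h1 : Nat.card {b // coord (u.openerVector ω) b = 0} ≤ Nat.card (Fin r ⊕ Fin r) := by
      refine Nat.card_le_card_of_surjective (fun i => ⟨Sum.elim (fun i : Fin r => (x.1 ^ (i : ℕ)) a)
        (fun i : Fin r => neg ((x.1 ^ (i : ℕ)) a)) i, ?_⟩) ?_
      · rw [hzero]
        have h2 : ∀ i : ℕ, x.1.SameCycle a ((x.1 ^ i) a) := fun i =>
          Perm.sameCycle_pow_right.mpr (Perm.SameCycle.refl _ _)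
        rcases i with i | i
        · exact h2 i
        · change x.1.SameCycle a (neg _)
          rw [neg_pow_apply hr]
          exact h2 _
      · rintro ⟨b, hb⟩
        obtain ⟨i, hi, h | h⟩ := hcyc b hb
        · exact ⟨Sum.inl ⟨i, hi⟩, Subtype.ext h.symm⟩
        · exact ⟨Sum.inr ⟨i, hi⟩, Subtype.ext h.symm⟩
    rw [Nat.card_sum, Nat.card_fin] at h1
    omega
  have hne : a ≠ (x.1 ^ m) a := (pow_apply_ne_self hr hmin hm0 (by omega)).symm
  have hv1 := fun {j : ℕ} => u.blockValue_reflect_of_lt (ω := ω) hr hmin hm0 hmr hne (j := j)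
  have hv2 := fun {j : ℕ} => u.blockValue_reflect_of_ge (ω := ω) hr hmin hm0 hmr hne (i := j)
  have hv3 := fun {b} => u.blockValue_reflect_of_not_sameCycle (ω := ω) hr hne (b := b)
  have hΩ : ω ^ ((vertexPos k a : ℕ) + 1) ≠ 0 :=
    pow_ne_zero _ (hω.ne_zero (by have := (vertexPos k a).2; omega))
  set u' := u.reflect hne (fixedSpace_le_reflPerm m) with hu'
  have hpos : ∀ i < r, coord (u'.openerVector ω) ((x.1 ^ i) a) =
      if i < m then ω ^ ((vertexPos k a : ℕ) + 1) else 0 := by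
    intro i hi
    rw [u'.coord_openerVector hω]
    split_ifs with h
    · exact hv1 h
    · exact hv2 (by omega) hi
  refine ⟨u', fun b hb => ?_, fun b hb => ?_, ?_⟩
  · rw [u'.coord_openerVector hω, u.coord_openerVector hω]
    exact hv3 fun h => hb ((hzero b).mpr h)
  · obtain ⟨i, hi, rfl | rfl⟩ := hcyc b hb
    · rw [hpos i hi]; split_ifs <;> simp
    · rw [coord_neg, hpos i hi]; split_ifs <;> simp
  · rw [← Nat.card_fin m]
    have hmem : ∀ i : Fin m, coord (u.openerVector ω) ((x.1 ^ (i : ℕ)) a) = 0 ∧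
        coord (u'.openerVector ω) ((x.1 ^ (i : ℕ)) a) = ω ^ ((vertexPos k a : ℕ) + 1) := fun i =>
      ⟨(hzero _).mpr (Perm.sameCycle_pow_right.mpr (Perm.SameCycle.refl _ _)), by
        rw [hpos i (i.2.trans_le hmr), if_pos i.2]⟩
    refine (Nat.card_congr (Equiv.ofBijective (fun i : Fin m => ⟨(x.1 ^ (i : ℕ)) a, hmem i⟩)
      ⟨fun i j h => ?_, ?_⟩)).symm
    · have := i.2; have := j.2
      exact Fin.ext (pow_apply_injOn hr hmin (by omega) (by omega) (congrArg Subtype.val h))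
    · rintro ⟨b, hb, hb'⟩
      obtain ⟨i, hi, rfl | rfl⟩ := hcyc b hb
      · rw [hpos i hi] at hb'
        by_cases h : i < m
        · exact ⟨⟨i, h⟩, rfl⟩
        · rw [if_neg h] at hb'
          exact absurd hb'.symm hΩ
      · rw [coord_neg, hpos i hi] at hb'
        split_ifs at hb'
        · exact absurd (self_eq_neg.mp hb'.symm) hΩ
        · rw [neg_zero] at hb'
          exact absurd hb'.symm hΩ

end NCChain

end Hyperoct

/-! ### Every point of the locus comes from a parking function. -/

namespace Hyperoct

open SignedIdx CirclePartition Equiv AlgPark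

variable {n k : ℕ} [NeZero n] [NeZero k] {ω : ℂ}

theorem mem_locus_powerTheta {v : Fin n → ℂ} :
    v ∈ locus (powerTheta n k) ↔ ∀ i, v i ^ (2 * n * k + 1) = v i := by
  simp [mem_locus, powerTheta]

theorem pow_add_one_eq_self_iff {N : ℕ} {z : ℂ} : z ^ (N + 1) = z ↔ z = 0 ∨ z ^ N = 1 := by
  rw [pow_succ]
  by_cases h : z = 0
  · simp [h]
  · rw [mul_eq_right₀ h]
    simp [h]

theorem exists_eq_pow {M : ℕ} (hω : IsPrimitiveRoot ω M) (hM : 0 < M) {z : ℂ}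
    (hz : z ^ M = 1) : ∃ p : Fin M, z = ω ^ ((p : ℕ) + 1) := by
  have h0 : ω ≠ 0 := hω.ne_zero hM.ne'
  have : NeZero M := ⟨hM.ne'⟩
  obtain ⟨j, hj, h⟩ := hω.eq_pow_of_pow_eq_one (ξ := z * ω⁻¹) (by
    rw [mul_pow, hz, inv_pow, hω.pow_eq_one, inv_one, mul_one])
  exact ⟨⟨j, hj⟩, by rw [pow_succ, h, inv_mul_cancel_right₀ h0]⟩

variable (ω k) in
/-- The size of the block opened by `p` for the labelled partition corresponding to `v`. -/
noncomputable def openCount (v : Fin n → ℂ) (p : Fin (2 * n * k)) : ℕ :=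
  k * Nat.card {a : SignedIdx n // coord v a = ω ^ ((p : ℕ) + 1)}

theorem sum_openCount_le (hω : IsPrimitiveRoot ω (2 * n * k)) (v : Fin n → ℂ) :
    ∑ p, openCount k ω v p ≤ 2 * n * k := by
  unfold openCount
  rw [← Finset.mul_sum, mul_comm k, ← Nat.card_sigma]
  refine Nat.mul_le_mul_right k ?_
  have h1 : Nat.card (SignedIdx n) = 2 * n := by rw [Nat.card_sum, Nat.card_fin, two_mul]
  refine (Nat.card_le_card_of_injective (fun x => x.2.1) ?_).trans h1.le
  rintro ⟨p, a, ha⟩ ⟨q, b, hb⟩ h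
  dsimp only at h
  subst h
  obtain rfl := pow_injective_fin hω (ha.symm.trans hb)
  rfl

variable (k ω) in
/-- The vectors attached to noncrossing parking functions. -/
def IsParkVector (v : Fin n → ℂ) : Prop :=
  ∃ (w : Hyperoct n) (u : NCChain n k), reflRep n w (u.openerVector ω) = v

theorem IsParkVector.smul (hω : IsPrimitiveRoot ω (2 * n * k)) {v : Fin n → ℂ}
    (h : IsParkVector k ω v) : IsParkVector k ω (ω • v) := by
  obtain ⟨w, u, rfl⟩ := h
  exact ⟨_, _, u.reflRep_openerVector_rotate hω w⟩

/-- `c` is a single cycle on `±[n]`, so the constant multichain `c` has only the zero block. -/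
theorem isParkVector_zero (hω : IsPrimitiveRoot ω (2 * n * k)) :
    IsParkVector k ω (0 : Fin n → ℂ) := by
  let u : NCChain n k := ⟨fun _ => coxeter n, fun _ => AbsLE.refl _, fun _ _ _ => AbsLE.refl _⟩
  refine ⟨1, u, coord_injective fun a => ?_⟩
  rw [coord_reflRep, u.coord_openerVector hω, u.blockValue_of_antipode]
  · rcases a with i | i <;> simp [coord]
  · have h0 : u.extend 0 = coxeter n := u.extend_zero
    rw [NCChain.sameCycle_nablaPerm_iff, h0, toPerm_coxeter]
    obtain ⟨m, hm⟩ : ∃ m, 2 * n = m + 2 := ⟨2 * n - 2, by have := NeZero.pos n; omega⟩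
    generalize u.root _ = p, u.root _ = q
    revert p q
    rw [hm]
    intro p q
    refine (isCycle_finRotate (n := m)).sameCycle ?_ ?_ <;>
      · rw [finRotate_apply]; simp

/-- Erasing the coordinates equal to `±Ω`. -/
theorem exists_erase (v : Fin n → ℂ) (Ω : ℂ) : ∃ v' : Fin n → ℂ,
    (∀ a, coord v a = Ω ∨ coord v a = -Ω → coord v' a = 0) ∧
    ∀ a, ¬ (coord v a = Ω ∨ coord v a = -Ω) → coord v' a = coord v a := by
  classical
  refine ⟨fun i => if v i = Ω ∨ v i = -Ω then 0 else v i, ?_, ?_⟩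
  · rintro (i | i) h
    · exact if_pos h
    · have h' : v i = Ω ∨ v i = -Ω := by
        rcases h with h | h
        · exact Or.inr (neg_eq_iff_eq_neg.mp h)
        · exact Or.inl (_root_.neg_injective h)
      change -(if v i = Ω ∨ v i = -Ω then 0 else v i) = 0
      rw [if_pos h', neg_zero]
  · rintro (i | i) h
    · exact if_neg h
    · have h' : ¬ (v i = Ω ∨ v i = -Ω) := by
        rintro (h' | h')
        · exact h (Or.inr (congrArg Neg.neg h'))
        · exact h (Or.inl (neg_eq_iff_eq_neg.mpr h'))
      change -(if v i = Ω ∨ v i = -Ω then 0 else v i) = -v i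
      rw [if_neg h']

/-- The coordinates `±Ω` are erased, the rest is realised by induction, and a block opened by the
vertex of `a` is split off the zero block. It suffices to match the number of occurrences of each
value, since this decides conjugacy under `W`. -/
theorem isParkVector_of_record_vertexPos (hω : IsPrimitiveRoot ω (2 * n * k)) {v : Fin n → ℂ}
    (hv : v ∈ locus (powerTheta n k)) (a : SignedIdx n)
    (hpos : 0 < openCount k ω v (vertexPos k a))
    (hrec : ∀ q, ∑ r ∈ (window q (vertexPos k a)).erase (vertexPos k a), openCount k ω v r ≤
      cdist q (vertexPos k a))
    (ih : ∀ v' ∈ locus (powerTheta n k),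
      Nat.card {i // v' i ≠ 0} < Nat.card {i // v i ≠ 0} → IsParkVector k ω v') :
    IsParkVector k ω v := by
  classical
  set Ω := ω ^ ((vertexPos k a : ℕ) + 1) with hΩdef
  have hω0 : ω ≠ 0 := hω.ne_zero (by have := (vertexPos k a).2; omega)
  have hΩ : Ω ≠ 0 := pow_ne_zero _ hω0
  obtain ⟨v', h0, h1⟩ := exists_erase v Ω
  have hle : ∀ b, coord v' b ≠ 0 → coord v b = coord v' b := fun b hb =>
    (h1 b fun h => hb (h0 b h)).symm
  have hv' : v' ∈ locus (powerTheta n k) := by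
    rw [mem_locus_powerTheta] at hv ⊢
    intro i
    by_cases h : v' i = 0
    · rw [h, zero_pow (by omega)]
    · have : v i = v' i := hle (Sum.inl i) h
      rw [← this, hv]
  have hm0 : 0 < Nat.card {b // coord v b = Ω} := Nat.pos_of_mul_pos_left hpos
  obtain ⟨w, u, hu⟩ := ih v' hv' (by
    rw [Nat.card_eq_fintype_card, Nat.card_eq_fintype_card, Fintype.card_subtype,
      Fintype.card_subtype]
    refine Finset.card_lt_card ((Finset.ssubset_iff_of_subset fun i hi => ?_).mpr ?_)
    · simp only [Finset.mem_filter, Finset.mem_univ, true_and] at hi ⊢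
      have : v i = v' i := hle (Sum.inl i) hi
      rwa [this]
    · obtain ⟨⟨b, hb⟩⟩ := (Nat.card_pos_iff.mp hm0).1
      rcases b with i | i
      · refine ⟨i, by simpa [show v i = Ω from hb] using hΩ, ?_⟩
        have h2 : v' i = 0 := h0 (Sum.inl i) (Or.inl hb)
        simpa using h2
      · have hb' : v i = -Ω := neg_eq_iff_eq_neg.mp hb
        refine ⟨i, by simpa [hb'] using hΩ, ?_⟩
        have h2 : v' i = 0 := h0 (Sum.inl i) (Or.inr hb')
        simpa using h2)
  have hcard : ∀ z, Nat.card {b // coord (u.openerVector ω) b = z} =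
      Nat.card {b // coord v' b = z} := fun z => by rw [← hu, card_coord_reflRep]
  have hΩ' : ∀ b, coord v' b ≠ Ω := fun b hb => by
    have h2 := hle b (by rw [hb]; exact hΩ)
    have h3 := h0 b (Or.inl (h2.trans hb))
    exact hΩ (hb.symm.trans h3)
  have hcard0 : Nat.card {b // coord (u.openerVector ω) b = Ω} = 0 := by
    rw [hcard]
    have : IsEmpty {b // coord v' b = Ω} := ⟨fun b => hΩ' b.1 b.2⟩
    exact Nat.card_of_isEmpty
  have hfΩ : ∀ b, coord (u.openerVector ω) b ≠ Ω := fun b hb => by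
    have := Finite.card_eq_zero_iff.mp hcard0
    exact this.false ⟨b, hb⟩
  have hsize : ∀ q, openSize (cycles u.nablaPerm) q ≤ openCount k ω v q := fun q => by
    rw [u.openSize_eq hω, hcard]
    refine Nat.mul_le_mul_left k (Nat.card_le_card_of_injective
      (fun b => ⟨b.1, (hle b.1 (by rw [b.2]; exact pow_ne_zero _ hω0)).trans b.2⟩) fun b c h => ?_)
    exact Subtype.ext (congrArg (fun x => x.1) h)
  -- If the vertex of `a` were in a block opened by `o`, the blocks opened from `o` to this vertex
  -- would fill the window. But after the erasure the vertex opens nothing, and the record condition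
  -- keeps the other sizes one short.
  have hfa : coord (u.openerVector ω) a = 0 := by
    rw [u.coord_openerVector hω]
    rcases u.blockValue_cases ω (vertexPos k a) with ⟨-, h2⟩ | ⟨o, h2, h3, -⟩
    · exact h2
    · exfalso
      have h4 := u.isSymmNC.le_sum_window h2 h3
      rw [← Finset.add_sum_erase _ _ (mem_window.mpr le_rfl : vertexPos k a ∈ window o _),
        u.openSize_eq hω, hcard0, mul_zero, zero_add] at h4
      have h5 := (Finset.sum_le_sum fun q _ => hsize q).trans (hrec o)
      omega
  -- The erased values `Ω` and `-Ω` occur equally often, so the zero block has room for the new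
  -- block and its opposite.
  obtain ⟨u', hu1, hu2, hu3⟩ := u.exists_split hω hfa hm0 (by
    rw [hcard, two_mul]
    nth_rewrite 2 [← card_coord_neg]
    rw [← Nat.card_sum]
    refine Nat.card_le_card_of_injective (Sum.elim (fun b => ⟨b.1, h0 b.1 (Or.inl b.2)⟩)
      fun b => ⟨b.1, h0 b.1 (Or.inr b.2)⟩) ?_
    have hdis : ∀ b : SignedIdx n, coord v b = Ω → coord v b ≠ -Ω := fun b hb hb' =>
      hΩ (self_eq_neg.mp (hb.symm.trans hb'))
    rintro (⟨b, hb⟩ | ⟨b, hb⟩) (⟨c, hc⟩ | ⟨c, hc⟩) h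
    · obtain rfl : b = c := congrArg Subtype.val h
      rfl
    · obtain rfl : b = c := congrArg Subtype.val h
      exact absurd hc (hdis b hb)
    · obtain rfl : b = c := congrArg Subtype.val h
      exact absurd hb (hdis b hc)
    · obtain rfl : b = c := congrArg Subtype.val h
      rfl)
  have hcardΩ : Nat.card {b // coord (u'.openerVector ω) b = Ω} =
      Nat.card {b // coord v b = Ω} := by
    rw [← hu3]
    refine Nat.card_congr (Equiv.subtypeEquivRight fun b => ⟨fun h => ⟨?_, h⟩, fun h => h.2⟩)
    by_contra hb
    exact hfΩ b ((hu1 b hb).symm.trans h)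
  obtain ⟨w', hw'⟩ := exists_reflRep_eq (u := u'.openerVector ω) (v := v) fun z hz => by
    by_cases hz1 : z = Ω
    · rw [hz1, hcardΩ]
    by_cases hz2 : z = -Ω
    · rw [hz2, card_coord_neg, card_coord_neg, hcardΩ]
    have e1 : Nat.card {b // coord (u'.openerVector ω) b = z} =
        Nat.card {b // coord (u.openerVector ω) b = z} := by
      refine Nat.card_congr (Equiv.subtypeEquivRight fun b => ?_)
      by_cases hb : coord (u.openerVector ω) b = 0
      · rw [hb]
        refine iff_of_false (fun h => ?_) (Ne.symm hz)
        rcases hu2 b hb with h' | h' | h'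
        · exact hz (h.symm.trans h')
        · exact hz1 (h.symm.trans h')
        · exact hz2 (h.symm.trans h')
      · rw [hu1 b hb]
    rw [e1, hcard]
    refine Nat.card_congr (Equiv.subtypeEquivRight fun b => ?_)
    by_cases hb : coord v b = Ω ∨ coord v b = -Ω
    · rw [h0 b hb]
      refine iff_of_false (Ne.symm hz) fun h => ?_
      rcases hb with hb | hb
      · exact hz1 (h.symm.trans hb)
      · exact hz2 (h.symm.trans hb)
    · rw [h1 b hb]
  exact ⟨w', u', hw'⟩

theorem smul_mem_locus (hω : IsPrimitiveRoot ω (2 * n * k)) {v : Fin n → ℂ}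
    (hv : v ∈ locus (powerTheta n k)) : ω⁻¹ • v ∈ locus (powerTheta n k) := by
  rw [mem_locus_powerTheta] at hv ⊢
  intro i
  rw [Pi.smul_apply, smul_eq_mul, mul_pow, hv, pow_succ, inv_pow, hω.pow_eq_one, inv_one, one_mul]

theorem openCount_smul (hω : IsPrimitiveRoot ω (2 * n * k)) (v : Fin n → ℂ)
    (p : Fin (2 * n * k)) :
    openCount k ω (ω⁻¹ • v) p = openCount k ω v (finRotate _ p) := by
  have h0 : ω ≠ 0 := hω.ne_zero (by have := p.2; omega)
  unfold openCount
  congr 2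
  refine congrArg _ (funext fun a => ?_)
  rw [coord_smul, NCChain.pow_finRotate hω, inv_mul_eq_iff_eq_mul₀ h0]

/-- Scaling by `ω⁻¹` turns the circle back by one step, so the record can be moved to position zero,
which is a vertex. -/
theorem isParkVector_of_record (hω : IsPrimitiveRoot ω (2 * n * k)) (m : ℕ) :
    ∀ {v : Fin n → ℂ}, v ∈ locus (powerTheta n k) → ∀ p : Fin (2 * n * k), (p : ℕ) = m →
    0 < openCount k ω v p →
    (∀ q, ∑ r ∈ (window q p).erase p, openCount k ω v r ≤ cdist q p) →
    (∀ v' ∈ locus (powerTheta n k),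
      Nat.card {i // v' i ≠ 0} < Nat.card {i // v i ≠ 0} → IsParkVector k ω v') →
    IsParkVector k ω v := by
  induction m with
  | zero =>
    intro v hv p hp hpos hrec ih
    have : p = vertexPos k (Sum.inl ⟨0, NeZero.pos n⟩) := by
      apply Fin.ext
      change (p : ℕ) = 0 + k * ((pos n (Sum.inl ⟨0, NeZero.pos n⟩) : Fin (2 * n)) : ℕ)
      rw [pos_inl, hp]
      simp
    subst this
    exact isParkVector_of_record_vertexPos hω hv _ hpos hrec ih
  | succ m IH =>
    intro v hv p hp hpos hrec ih
    have h0 : ω ≠ 0 := hω.ne_zero (by have := p.2; omega)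
    obtain ⟨p', hp'⟩ := (finRotate (2 * n * k)).surjective p
    have hval : (p' : ℕ) = m := by
      have := val_finRotate p'
      rw [hp'] at this
      split_ifs at this <;> omega
    have hmain := IH (smul_mem_locus hω hv) p' hval (by rwa [openCount_smul hω, hp'])
      (fun q => by
        refine le_trans (le_of_eq ?_) ((hrec (finRotate _ q)).trans (le_of_eq ?_))
        · simp only [openCount_smul hω]
          refine Finset.sum_equiv (finRotate (2 * n * k)) (fun r => ?_) fun r _ => rfl
          rw [Finset.mem_erase, Finset.mem_erase, mem_window, mem_window, ← hp',
            cdist_finRotate_finRotate, cdist_finRotate_finRotate, (finRotate _).injective.ne_iff]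
        · rw [← hp', cdist_finRotate_finRotate])
      (fun v' hv' hlt => ih v' hv' (by
        refine hlt.trans_le (le_of_eq (Nat.card_congr (Equiv.subtypeEquivRight fun i => ?_)))
        simp [h0]))
    have := hmain.smul hω
    rwa [smul_inv_smul₀ h0] at this

/-- Each point of the locus comes from a noncrossing parking function. -/
theorem isParkVector_of_mem_locus (hω : IsPrimitiveRoot ω (2 * n * k)) {v : Fin n → ℂ}
    (hv : v ∈ locus (powerTheta n k)) : IsParkVector k ω v := by
  induction hd : Nat.card {i // v i ≠ 0} using Nat.strong_induction_on generalizing v with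
  | _ d IH =>
    by_cases h : v = 0
    · rw [h]; exact isParkVector_zero hω
    obtain ⟨i, hi⟩ := Function.ne_iff.mp h
    have hM : 0 < 2 * n * k := Nat.mul_pos (Nat.mul_pos two_pos (NeZero.pos n)) (NeZero.pos k)
    obtain ⟨p₀, hp₀⟩ := exists_eq_pow hω hM
      ((pow_add_one_eq_self_iff.mp (mem_locus_powerTheta.mp hv i)).resolve_left hi)
    obtain ⟨p, hp, hrec⟩ := exists_record (openCount k ω v) (sum_openCount_le hω v) (p₀ := p₀)
      (Nat.mul_pos (NeZero.pos k) (Nat.card_pos_iff.mpr ⟨⟨Sum.inl i, hp₀⟩, inferInstance⟩))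
    exact isParkVector_of_record hω p hv p rfl hp hrec fun v' hv' hlt =>
      IH _ (hd ▸ hlt) hv' rfl

end Hyperoct

/-! ### The Coxeter number, the system of parameters and the algebraic parking space -/

theorem Hyperoct.orderOf_coxeter (n : ℕ) [NeZero n] : orderOf (Hyperoct.coxeter n) = 2 * n := by
  rw [← orderOf_injective (Hyperoct.toPerm n) Hyperoct.toPerm_injective, Hyperoct.toPerm_coxeter]
  obtain ⟨m, hm⟩ : ∃ m, 2 * n = m + 2 := ⟨2 * n - 2, by have := NeZero.pos n; omega⟩
  rw [hm, isCycle_finRotate.orderOf, support_finRotate, Finset.card_univ, Fintype.card_fin]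

namespace AlgPark

open SignedIdx MvPolynomial

variable {n k : ℕ}

theorem isHSOP_powerTheta (n k : ℕ) : IsHSOP (2 * n * k + 1) (powerTheta n k) := by
  refine ⟨fun i => isHomogeneous_X_pow i _, Set.ext fun v => ?_⟩
  simp only [powerTheta, map_pow, eval_X, Set.mem_ofPred_eq, Set.mem_singleton_iff,
    pow_eq_zero_iff (Nat.succ_ne_zero _)]
  exact ⟨fun h => funext h, fun h i => congrFun h i⟩

/-- The exponent is odd, so raising the variables to this power respects signs. -/
theorem polyAct_expand (w : Hyperoct n) (p : MvPolynomial (Fin n) ℂ) :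
    polyAct w (expand (2 * n * k + 1) p) = expand (2 * n * k + 1) (polyAct w p) := by
  have h : (polyAct w).comp (expand (2 * n * k + 1)) =
      (expand (2 * n * k + 1)).comp (polyAct w) := by
    refine algHom_ext fun i => ?_
    simp only [AlgHom.comp_apply, expand_X, map_pow, polyAct, aeval_X]
    rcases w.1 (Sum.inl i) with j | j
    · exact (expand_X (2 * n * k + 1) j).symm
    · change (-X j) ^ (2 * n * k + 1) = expand (2 * n * k + 1) (-X j)
      rw [map_neg, expand_X, Odd.neg_pow ⟨n * k, by ring⟩]
  exact DFunLike.congr_fun h p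

theorem isHomogeneous_polyAct (w : Hyperoct n) {p : MvPolynomial (Fin n) ℂ}
    (hp : p ∈ homogeneousSubmodule (Fin n) ℂ 1) :
    polyAct w p ∈ homogeneousSubmodule (Fin n) ℂ 1 := by
  have hvar : ∀ j : SignedIdx n, var j ∈ homogeneousSubmodule (Fin n) ℂ 1 := by
    rintro (j | j)
    · exact isHomogeneous_X ℂ j
    · exact neg_mem (isHomogeneous_X ℂ j)
  rw [homogeneousSubmodule_one_eq_span_X] at hp
  induction hp using Submodule.span_induction with
  | mem x hx =>
    obtain ⟨i, rfl⟩ := hx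
    rw [polyAct, aeval_X]
    exact hvar _
  | zero => rw [map_zero]; exact zero_mem _
  | add x y _ _ hx hy => rw [map_add]; exact add_mem hx hy
  | smul c x _ hx => rw [map_smul]; exact Submodule.smul_mem _ c hx

/-- The isomorphism is `expand` restricted to linear forms; it commutes with `W`. -/
theorem carriesDual_powerTheta (n k : ℕ) : CarriesDual (powerTheta n k) := by
  have hmap : (homogeneousSubmodule (Fin n) ℂ 1).map (expand (2 * n * k + 1)).toLinearMap =
      Submodule.span ℂ (Set.range (powerTheta n k)) := by
    rw [homogeneousSubmodule_one_eq_span_X, Submodule.map_span, ← Set.range_comp]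
    congr 2
    funext i
    exact expand_X _ i
  have hinj : Function.Injective (expand (R := ℂ) (σ := Fin n) (2 * n * k + 1)).toLinearMap :=
    expand_injective (Nat.succ_pos _)
  refine ⟨fun w p hp => ?_,
    (Submodule.equivMapOfInjective _ hinj _).trans (LinearEquiv.ofEq _ _ hmap), fun i => ?_,
    fun w p q hpq => ?_⟩
  · rw [← hmap] at hp ⊢
    obtain ⟨q, hq, rfl⟩ := hp
    exact ⟨polyAct w q, isHomogeneous_polyAct w hq, (polyAct_expand w q).symm⟩
  · exact expand_X _ i
  · change expand _ (q : MvPolynomial (Fin n) ℂ) = polyAct w (expand _ (p : MvPolynomial (Fin n) ℂ))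
    rw [hpq, polyAct_expand]

/-- The roots of `x^(M + 1) - x`. -/
noncomputable def rootFinset (M : ℕ) : Finset ℂ := insert 0 (Polynomial.nthRootsFinset M (1 : ℂ))

section rootFinset

variable {M : ℕ}

theorem mem_rootFinset (hM : 0 < M) {z : ℂ} : z ∈ rootFinset M ↔ z ^ (M + 1) = z := by
  rw [rootFinset, Finset.mem_insert, Polynomial.mem_nthRootsFinset hM,
    Hyperoct.pow_add_one_eq_self_iff]

theorem zero_notMem_nthRootsFinset (hM : 0 < M) : (0 : ℂ) ∉ Polynomial.nthRootsFinset M (1 : ℂ) := by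
  rw [Polynomial.mem_nthRootsFinset hM, zero_pow hM.ne']
  exact zero_ne_one

theorem card_rootFinset (hM : 0 < M) {ω : ℂ} (hω : IsPrimitiveRoot ω M) :
    (rootFinset M).card = M + 1 := by
  rw [rootFinset, Finset.card_insert_of_notMem (zero_notMem_nthRootsFinset hM),
    hω.card_nthRootsFinset]

theorem prod_rootFinset (hM : 0 < M) {ω : ℂ} (hω : IsPrimitiveRoot ω M) (i : Fin n) :
    ∏ s ∈ rootFinset M, (X i - C s : MvPolynomial (Fin n) ℂ) = X i ^ (M + 1) - X i := by
  rw [rootFinset, Finset.prod_insert (zero_notMem_nthRootsFinset hM), C_0, sub_zero]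
  have h := congrArg (Polynomial.aeval (X i : MvPolynomial (Fin n) ℂ))
    (Polynomial.X_pow_sub_one_eq_prod hM hω)
  simp only [map_sub, map_pow, Polynomial.aeval_X, map_one, map_prod, Polynomial.aeval_C,
    algebraMap_eq] at h
  rw [← h]
  ring

end rootFinset

variable [NeZero n] [NeZero k]

theorem mul_pos_of_neZero (n k : ℕ) [NeZero n] [NeZero k] : 0 < 2 * n * k :=
  Nat.mul_pos (Nat.mul_pos two_pos (NeZero.pos n)) (NeZero.pos k)

theorem mem_locus_iff_rootFinset {v : Fin n → ℂ} :
    v ∈ locus (powerTheta n k) ↔ ∀ i, v i ∈ rootFinset (2 * n * k) := by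
  simp only [mem_rootFinset (mul_pos_of_neZero n k), Hyperoct.mem_locus_powerTheta]

theorem locus_eq_coe (n k : ℕ) [NeZero n] [NeZero k] :
    locus (powerTheta n k) = (Fintype.piFinset fun _ : Fin n => rootFinset (2 * n * k)) := by
  ext v
  rw [mem_locus_iff_rootFinset, Finset.mem_coe, Fintype.mem_piFinset]

instance : Finite (locus (powerTheta n k)) := by
  rw [locus_eq_coe]
  exact Finset.finite_toSet _

theorem ncard_locus {ω : ℂ} (hω : IsPrimitiveRoot ω (2 * n * k)) :
    (locus (powerTheta n k)).ncard = (2 * n * k + 1) ^ n := by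
  rw [locus_eq_coe, Set.ncard_coe_finset, Fintype.card_piFinset, Finset.prod_const,
    card_rootFinset (mul_pos_of_neZero n k) hω, Finset.card_univ, Fintype.card_fin]

theorem pointIdeal_eq_span (v : Fin n → ℂ) :
    pointIdeal v = Ideal.span (Set.range fun i => X i - C (v i)) := by
  refine le_antisymm (fun f hf => ?_) (Ideal.span_le.mpr ?_)
  · set J := Ideal.span (Set.range fun i => (X i - C (v i) : MvPolynomial (Fin n) ℂ)) with hJ
    have h : Ideal.Quotient.mkₐ ℂ J = (Ideal.Quotient.mkₐ ℂ J).comp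
        ((Algebra.ofId ℂ (MvPolynomial (Fin n) ℂ)).comp (aeval v)) := by
      refine algHom_ext fun i => ?_
      simp only [AlgHom.comp_apply, aeval_X]
      exact Ideal.Quotient.eq.mpr (Ideal.subset_span ⟨i, rfl⟩)
    have hf' : aeval v f = 0 := by
      rw [aeval_eq_eval]; exact hf
    have h1 := DFunLike.congr_fun h f
    rw [AlgHom.comp_apply, AlgHom.comp_apply, hf', map_zero, map_zero] at h1
    exact Ideal.Quotient.eq_zero_iff_mem.mp h1
  · rintro _ ⟨i, rfl⟩
    change eval v (X i - C (v i)) = 0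
    simp

/-- Every root of `x^(M+1) - x` is simple: the derivative is `-1` at zero and `M` at the other
roots. -/
theorem exists_mul_sub_eq {M : ℕ} (hM : 0 < M) {z : ℂ} (hz : z ^ (M + 1) = z) (i : Fin n) :
    ∃ g : MvPolynomial (Fin n) ℂ, X i ^ (M + 1) - X i = (X i - C z) * g ∧
      ∀ v : Fin n → ℂ, v i = z → eval v g ≠ 0 := by
  have hroot : (Polynomial.X ^ (M + 1) - Polynomial.X : Polynomial ℂ).IsRoot z := by
    simp [hz]
  obtain ⟨Q, hQ⟩ := Polynomial.dvd_iff_isRoot.mpr hroot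
  refine ⟨Polynomial.aeval (X i) Q, ?_, fun v hv => ?_⟩
  · have := congrArg (Polynomial.aeval (X i : MvPolynomial (Fin n) ℂ)) hQ
    simpa [algebraMap_eq] using this
  · have h1 : eval v (Polynomial.aeval (X i) Q) = Q.eval z := by
      rw [← aeval_eq_eval, ← Polynomial.aeval_algHom_apply, aeval_X, hv,
        Polynomial.coe_aeval_eq_eval]
    have h2 := congrArg (fun P => (Polynomial.derivative P).eval z) hQ
    simp only [Polynomial.derivative_mul, Polynomial.derivative_sub, Polynomial.derivative_X_pow,
      Polynomial.derivative_X, Polynomial.derivative_C, Polynomial.eval_add, Polynomial.eval_mul,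
      Polynomial.eval_sub, Polynomial.eval_X, Polynomial.eval_C, Polynomial.eval_pow,
      Polynomial.eval_one, sub_zero, one_mul, sub_self, zero_mul, add_zero,
      Nat.add_sub_cancel, Polynomial.eval_natCast, map_natCast] at h2
    rw [h1, ← h2]
    rcases Hyperoct.pow_add_one_eq_self_iff.mp hz with rfl | h
    · rw [zero_pow hM.ne', mul_zero, zero_sub]
      exact neg_ne_zero.mpr one_ne_zero
    · rw [h]
      push_cast
      simpa using hM.ne'

/-- The cofactor of `X i - C (v i)` in `θ_i - x_i` is a unit near `v`, so `X i - C (v i)` itself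
lies in the extended ideal. -/
theorem primaryComponent_eq (v : Fin n → ℂ) (hv : v ∈ locus (powerTheta n k)) :
    primaryComponent (deformIdeal (powerTheta n k)) v = pointIdeal v := by
  set A := Localization.AtPrime (pointIdeal v) with hA
  refine le_antisymm ?_ ?_
  · have h1 : deformIdeal (powerTheta n k) ≤ pointIdeal v := fun f hf => hv f hf
    have h2 : (pointIdeal v).map (algebraMap _ A) ≤ IsLocalRing.maximalIdeal A :=
      (Localization.AtPrime.map_eq_maximalIdeal).le
    refine (Ideal.comap_mono ((Ideal.map_mono h1).trans h2)).trans (le_of_eq ?_)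
    exact Localization.AtPrime.under_maximalIdeal
  · conv_lhs => rw [pointIdeal_eq_span]
    refine Ideal.span_le.mpr ?_
    rintro _ ⟨i, rfl⟩
    obtain ⟨g, hg, hg0⟩ := exists_mul_sub_eq (mul_pos_of_neZero n k)
      (Hyperoct.mem_locus_powerTheta.mp hv i) i
    have hunit : IsUnit (algebraMap _ A g) :=
      IsLocalization.map_units A (⟨g, fun h => hg0 v rfl h⟩ : (pointIdeal v).primeCompl)
    change algebraMap (MvPolynomial (Fin n) ℂ) A (X i - C (v i)) ∈
      (deformIdeal (powerTheta n k)).map (algebraMap (MvPolynomial (Fin n) ℂ) A)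
    rw [← Ideal.mul_unit_mem_iff_mem _ hunit, ← map_mul, ← hg]
    exact Ideal.mem_map_of_mem _ (Ideal.subset_span ⟨i, rfl⟩)

theorem multiplicity_eq_one (v : Fin n → ℂ) (hv : v ∈ locus (powerTheta n k)) :
    multiplicity (deformIdeal (powerTheta n k)) v = 1 := by
  rw [multiplicity, primaryComponent_eq v hv]
  have hsurj : Function.Surjective (aeval v : MvPolynomial (Fin n) ℂ →ₐ[ℂ] ℂ) := fun z =>
    ⟨C z, by simp⟩
  have hker : RingHom.ker (aeval v : MvPolynomial (Fin n) ℂ →ₐ[ℂ] ℂ) = pointIdeal v := by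
    rw [pointIdeal, ← coe_aeval_eq_eval]
    rfl
  rw [← hker, (Ideal.quotientKerAlgEquivOfSurjective hsurj).toLinearEquiv.finrank_eq,
    Module.finrank_self]

/-! ### The permutation module of the locus -/

/-- Evaluation of polynomial functions on the locus. -/
noncomputable def evalLocus (n k : ℕ) :
    ParkAlg (powerTheta n k) →ₐ[ℂ] (locus (powerTheta n k) → ℂ) :=
  Ideal.Quotient.liftₐ _ (AlgHom.pi fun v : locus (powerTheta n k) => aeval v.1)
    fun f hf => funext fun v => by
      change aeval v.1 f = 0
      rw [aeval_eq_eval]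
      exact v.2 f hf

theorem evalLocus_mk (f : MvPolynomial (Fin n) ℂ) (v : locus (powerTheta n k)) :
    evalLocus n k (Ideal.Quotient.mk _ f) v = eval v.1 f := by
  change aeval v.1 f = _
  rw [aeval_eq_eval]

/-- The locus is a grid, and `θ_i - x_i` is the product of the `x_i - s` over its side. By the
combinatorial Nullstellensatz a polynomial vanishing on the grid lies in the ideal of these
products. -/
theorem evalLocus_injective {ω : ℂ} (hω : IsPrimitiveRoot ω (2 * n * k)) :
    Function.Injective (evalLocus n k) := by
  rw [injective_iff_map_eq_zero]
  intro F hF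
  obtain ⟨f, rfl⟩ := Ideal.Quotient.mk_surjective F
  rw [Ideal.Quotient.eq_zero_iff_mem]
  obtain ⟨h, -, hf⟩ := combinatorial_nullstellensatz_exists_linearCombination
    (fun _ : Fin n => rootFinset (2 * n * k)) (fun _ => ⟨0, Finset.mem_insert_self _ _⟩) f
    fun x hx => by
      rw [← evalLocus_mk f ⟨x, mem_locus_iff_rootFinset.mpr hx⟩, hF]
      rfl
  rw [hf, Finsupp.linearCombination_apply]
  refine Ideal.sum_mem _ fun i _ => ?_
  dsimp only
  rw [prod_rootFinset (mul_pos_of_neZero n k) hω, smul_eq_mul]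
  exact Ideal.mul_mem_left _ _ (Ideal.subset_span ⟨i, rfl⟩)

/-- Lagrange interpolation, one coordinate at a time. -/
theorem exists_eval_eq_single (S : Finset ℂ) (v : Fin n → ℂ) :
    ∃ f : MvPolynomial (Fin n) ℂ, eval v f = 1 ∧
      ∀ u : Fin n → ℂ, (∀ i, u i ∈ S) → u ≠ v → eval u f = 0 := by
  classical
  refine ⟨∏ i, ∏ s ∈ S.erase (v i), (C (v i - s)⁻¹ * (X i - C s)), ?_, fun u hu hne => ?_⟩
  · rw [map_prod]
    refine Finset.prod_eq_one fun i _ => ?_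
    rw [map_prod]
    refine Finset.prod_eq_one fun s hs => ?_
    have : v i - s ≠ 0 := sub_ne_zero.mpr (Finset.ne_of_mem_erase hs).symm
    simp [inv_mul_cancel₀ this]
  · obtain ⟨i, hi⟩ := Function.ne_iff.mp hne
    rw [map_prod]
    refine Finset.prod_eq_zero (Finset.mem_univ i) ?_
    rw [map_prod]
    refine Finset.prod_eq_zero (Finset.mem_erase.mpr ⟨hi, hu i⟩) ?_
    simp

theorem evalLocus_surjective : Function.Surjective (evalLocus n k) := by
  classical
  have : Fintype (locus (powerTheta n k)) := Fintype.ofFinite _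
  intro φ
  choose f hf1 hf0 using fun v : locus (powerTheta n k) =>
    exists_eval_eq_single (rootFinset (2 * n * k)) v.1
  refine ⟨Ideal.Quotient.mk _ (∑ v, C (φ v) * f v), funext fun u => ?_⟩
  rw [evalLocus_mk, map_sum, Finset.sum_eq_single u]
  · rw [map_mul, hf1, eval_C, mul_one]
  · intro v _ hvu
    rw [map_mul, hf0 v u.1 (mem_locus_iff_rootFinset.mp u.2) fun h => hvu (Subtype.ext h.symm),
      mul_zero]
  · exact fun h => absurd (Finset.mem_univ u) h

end AlgPark

/-! ### Equivariance of evaluation on the locus. -/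

namespace AlgPark

open SignedIdx MvPolynomial

variable {n k : ℕ} [NeZero n] [NeZero k] {ω : ℂ}

theorem pow_expo_mul (hω : IsPrimitiveRoot ω (2 * n * k)) (γ δ : SymGroup n k) :
    ω ^ expo (γ * δ) = ω ^ expo γ * ω ^ expo δ := by
  have hM : NeZero (2 * n * k) := ⟨(mul_pos_of_neZero n k).ne'⟩
  have h : expo (γ * δ) = (expo γ + expo δ) % (2 * n * k) := ZMod.val_add _ _
  rw [h, ← pow_add, hω.eq_orderOf, pow_mod_orderOf]

theorem expo_of_snd_eq_one (w : Hyperoct n) : expo (k := k) (w, 1) = 0 := by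
  have hM : NeZero (2 * n * k) := ⟨(mul_pos_of_neZero n k).ne'⟩
  exact ZMod.val_zero

theorem expo_ofAdd_one (w : Hyperoct n) : expo (k := k) (w, Multiplicative.ofAdd 1) = 1 := by
  have h1 := Nat.mul_pos (NeZero.pos n) (NeZero.pos k)
  have hM : Fact (1 < 2 * n * k) := ⟨by rw [mul_assoc]; omega⟩
  exact ZMod.val_one _

theorem vecAct_one (v : Fin n → ℂ) : vecAct ω (1 : SymGroup n k) v = v := by
  have h : expo (1 : SymGroup n k) = 0 := expo_of_snd_eq_one 1
  rw [vecAct, h, pow_zero, one_smul, Prod.fst_one, map_one, Module.End.one_apply]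

theorem vecAct_mul (hω : IsPrimitiveRoot ω (2 * n * k)) (γ δ : SymGroup n k) (v : Fin n → ℂ) :
    vecAct ω (γ * δ) v = vecAct ω γ (vecAct ω δ v) := by
  rw [vecAct, vecAct, vecAct, pow_expo_mul hω, Prod.fst_mul, map_mul, Module.End.mul_apply,
    map_smul, smul_smul]

/-- The action of `W × ℤ_{kh}` on the locus. -/
noncomputable def locusPerm (hω : IsPrimitiveRoot ω (2 * n * k)) :
    SymGroup n k →* Equiv.Perm (locus (powerTheta n k)) :=
  MonoidHom.toHomPerm
    { toFun := fun γ => (locusAct hω γ : Function.End _)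
      map_one' := funext fun v => Subtype.ext (vecAct_one v.1)
      map_mul' := fun γ δ => funext fun v => Subtype.ext (vecAct_mul hω γ δ v.1) }

theorem locusAct_injective (hω : IsPrimitiveRoot ω (2 * n * k)) (γ : SymGroup n k) :
    Function.Injective (locusAct hω γ) := (locusPerm hω γ).injective

/-- Complex conjugation of vectors. -/
noncomputable def conjVec (v : Fin n → ℂ) : Fin n → ℂ := fun i => starRingEnd ℂ (v i)

theorem coord_conjVec (v : Fin n → ℂ) (a : SignedIdx n) :
    coord (conjVec v) a = starRingEnd ℂ (coord v a) := by
  rcases a with i | i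
  · rfl
  · exact (map_neg (starRingEnd ℂ) (v i)).symm

/-- Complex conjugation on the locus. -/
noncomputable def conjLocus (n k : ℕ) [NeZero n] [NeZero k] : Equiv.Perm (locus (powerTheta n k)) :=
  Function.Involutive.toPerm
    (fun v => ⟨conjVec v.1, Hyperoct.mem_locus_powerTheta.mpr fun i => by
      rw [conjVec, ← map_pow, Hyperoct.mem_locus_powerTheta.mp v.2 i]⟩)
    fun v => Subtype.ext (funext fun i => Complex.conj_conj (v.1 i))

/-- Complex conjugation commutes with the real matrices of `W` and inverts powers of `ω`. -/
theorem vecAct_conjVec (hω : IsPrimitiveRoot ω (2 * n * k)) (γ : SymGroup n k) (v : Fin n → ℂ) :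
    vecAct ω γ (conjVec (Hyperoct.reflRep n γ.1⁻¹ (ω ^ expo γ • v))) = conjVec v := by
  refine Hyperoct.coord_injective fun a => ?_
  have hnorm : ‖ω ^ expo γ‖ = 1 := by
    rw [norm_pow, hω.norm'_eq_one (mul_pos_of_neZero n k).ne', one_pow]
  have h0 : ω ^ expo γ ≠ 0 := norm_ne_zero_iff.mp (by rw [hnorm]; exact one_ne_zero)
  rw [vecAct, coord_smul, Hyperoct.coord_reflRep, coord_conjVec, Hyperoct.coord_reflRep,
    coord_smul, inv_inv, Hyperoct.apply_inv_self, map_mul, ← Complex.inv_eq_conj hnorm,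
    mul_inv_cancel_left₀ h0, coord_conjVec]

theorem eval_scale (a : ℂ) (f : MvPolynomial (Fin n) ℂ) (v : Fin n → ℂ) :
    eval v (scale n a f) = eval (a • v) f := by
  induction f using MvPolynomial.induction_on with
  | C a => simp [scale]
  | add p q hp hq => simp [hp, hq]
  | mul_X p i hp =>
    rw [map_mul, map_mul, map_mul, hp]
    simp [scale]

/-- `W` acts on functions through `w⁻¹`, but scaling by `ω^d` in degree `d` substitutes `ω v` and
not `ω⁻¹ v`. -/
theorem evalLocus_parkAlgAct (hω : IsPrimitiveRoot ω (2 * n * k)) (γ : SymGroup n k)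
    (F : ParkAlg (powerTheta n k)) (v u : locus (powerTheta n k))
    (hu : u.1 = Hyperoct.reflRep n γ.1⁻¹ (ω ^ expo γ • v.1)) :
    evalLocus n k (parkAlgAct hω γ F) v = evalLocus n k F u := by
  obtain ⟨f, rfl⟩ := Ideal.Quotient.mk_surjective F
  have h : parkAlgAct hω γ (Ideal.Quotient.mk _ f) =
      Ideal.Quotient.mk _ (scale n (ω ^ expo γ) (polyAct γ.1 f)) := rfl
  rw [h, evalLocus_mk, evalLocus_mk, eval_scale, eval_polyAct, hu]

theorem reflRep_smul_mem_locus (hω : IsPrimitiveRoot ω (2 * n * k)) (γ : SymGroup n k)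
    {v : Fin n → ℂ} (hv : v ∈ locus (powerTheta n k)) :
    Hyperoct.reflRep n γ.1⁻¹ (ω ^ expo γ • v) ∈ locus (powerTheta n k) := by
  rw [Hyperoct.mem_locus_powerTheta]
  intro i
  have h2 : (ω ^ expo γ) ^ (2 * n * k + 1) = ω ^ expo γ := by
    rw [pow_succ, ← pow_mul, mul_comm (expo γ), pow_mul, hω.pow_eq_one, one_pow, one_mul]
  change coord _ (Sum.inl i) ^ _ = coord _ (Sum.inl i)
  rw [Hyperoct.coord_reflRep, coord_smul, mul_pow, h2, eval_powerTheta_coord v hv]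

/-- The permutation module of the locus is isomorphic to the algebraic parking space. -/
theorem exists_linearEquiv_parkAlg (hω : IsPrimitiveRoot ω (2 * n * k)) :
    ∃ L : (locus (powerTheta n k) →₀ ℂ) ≃ₗ[ℂ] ParkAlg (powerTheta n k),
      ∀ (γ : SymGroup n k) (a : locus (powerTheta n k) →₀ ℂ),
        L (a.mapDomain (locusAct hω γ)) = parkAlgAct hω γ (L a) := by
  let E : ParkAlg (powerTheta n k) ≃ₗ[ℂ] (locus (powerTheta n k) → ℂ) :=
    LinearEquiv.ofBijective (evalLocus n k).toLinearMap
      ⟨evalLocus_injective hω, evalLocus_surjective⟩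
  -- The permutation module pulls functions back along the inverse of `g`, the quotient algebra
  -- along `g` itself; the twist by conjugation makes the two agree without disturbing `W`.
  let K : (locus (powerTheta n k) →₀ ℂ) ≃ₗ[ℂ] (locus (powerTheta n k) → ℂ) :=
    (Finsupp.linearEquivFunOnFinite ℂ ℂ _).trans (LinearEquiv.funCongrLeft ℂ ℂ (conjLocus n k))
  have hE : ∀ (a : locus (powerTheta n k) →₀ ℂ) v,
      evalLocus n k (E.symm (K a)) v = a (conjLocus n k v) := fun a v =>
    congrFun (E.apply_symm_apply (K a)) v
  refine ⟨K.trans E.symm, fun γ a => evalLocus_injective hω (funext fun v => ?_)⟩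
  let u : locus (powerTheta n k) :=
    ⟨Hyperoct.reflRep n γ.1⁻¹ (ω ^ expo γ • v.1), reflRep_smul_mem_locus hω γ v.2⟩
  have hu : locusAct hω γ (conjLocus n k u) = conjLocus n k v :=
    Subtype.ext (vecAct_conjVec hω γ v.1)
  change evalLocus n k (E.symm (K _)) v = evalLocus n k (parkAlgAct hω γ (E.symm (K a))) v
  rw [evalLocus_parkAlgAct hω γ _ v u rfl, hE, hE, ← hu,
    Finsupp.mapDomain_apply (locusAct_injective hω γ)]

end AlgPark

/-! ### The equivariant bijection from parking functions to the locus. -/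

namespace Hyperoct

open SignedIdx CirclePartition Equiv AlgPark

variable {n k : ℕ} [NeZero n] [NeZero k] {ω : ℂ}

theorem reflRep_openerVector_eq_of_mem_isotropy (hω : IsPrimitiveRoot ω (2 * n * k))
    (X : NCFlat n k) {x : Hyperoct n} (hx : x ∈ isotropy (X.1 0)) :
    reflRep n x (X.elements.openerVector ω) = X.elements.openerVector ω := by
  refine hx _ ?_
  have h := X.elements.openerVector_mem_fixedSpace hω
  rw [NCChain.extend_zero] at h
  rw [X.flats_elements]
  exact h

/-- The point of the locus attached to a noncrossing parking function. -/
noncomputable def parkVector (hω : IsPrimitiveRoot ω (2 * n * k)) :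
    ParkNC n k → locus (powerTheta n k) :=
  Quotient.lift (fun p => ⟨reflRep n p.1 (p.2.elements.openerVector ω),
    p.2.elements.openerVector_mem_locus hω p.1⟩) (by
    rintro ⟨w, X⟩ ⟨w', X'⟩ ⟨h, h'⟩
    obtain rfl : X = X' := h
    refine Subtype.ext ?_
    dsimp only at h' ⊢
    conv_lhs => rw [← reflRep_openerVector_eq_of_mem_isotropy hω X h']
    rw [← Module.End.mul_apply, ← map_mul, mul_inv_cancel_left])

theorem parkVector_mk (hω : IsPrimitiveRoot ω (2 * n * k)) (w : Hyperoct n) (X : NCFlat n k) :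
    (parkVector hω (ParkNC.mk w X)).1 = reflRep n w (X.elements.openerVector ω) := rfl

theorem parkVector_bijective (hω : IsPrimitiveRoot ω (2 * n * k)) :
    Function.Bijective (parkVector (n := n) (k := k) hω) := by
  constructor
  · intro p q h
    obtain ⟨⟨w, X⟩, rfl⟩ := Quotient.exists_rep p
    obtain ⟨⟨w', X'⟩, rfl⟩ := Quotient.exists_rep q
    have h1 : reflRep n w (X.elements.openerVector ω) = reflRep n w' (X'.elements.openerVector ω) :=
      congrArg Subtype.val h
    have h2 : X = X' := by
      rw [← X.toFlat_elements, ← X'.toFlat_elements, NCChain.eq_of_reflRep_eq hω h1]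
    subst h2
    refine Quotient.sound ⟨rfl, ?_⟩
    have h3 := X.elements.mem_isotropy_of_reflRep_eq hω (x := w⁻¹ * w') (by
      rw [map_mul, Module.End.mul_apply, ← h1, ← Module.End.mul_apply, ← map_mul, inv_mul_cancel,
        map_one, Module.End.one_apply])
    rwa [X.toFlat_elements] at h3
  · rintro ⟨v, hv⟩
    obtain ⟨w, u, h⟩ := isParkVector_of_mem_locus hω hv
    refine ⟨ParkNC.mk w u.toFlat, Subtype.ext ?_⟩
    rw [parkVector_mk, u.elements_toFlat, h]

theorem parkVector_act (hω : IsPrimitiveRoot ω (2 * n * k)) (v : Hyperoct n) (p : ParkNC n k) :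
    parkVector hω (ParkNC.act v p) = locusAct hω (v, 1) (parkVector hω p) := by
  obtain ⟨⟨w, X⟩, rfl⟩ := Quotient.exists_rep p
  refine Subtype.ext ?_
  change reflRep n (v * w) _ = ω ^ expo (v, 1) • reflRep n v (reflRep n w _)
  rw [expo_of_snd_eq_one, pow_zero, one_smul, map_mul, Module.End.mul_apply]

theorem parkVector_rot (hω : IsPrimitiveRoot ω (2 * n * k)) (p : ParkNC n k) :
    parkVector hω (ParkNC.rot p) =
      locusAct hω (1, Multiplicative.ofAdd 1) (parkVector hω p) := by
  obtain ⟨⟨w, X⟩, rfl⟩ := Quotient.exists_rep p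
  refine Subtype.ext ?_
  change reflRep n (w * X.elements.1 (lastIdx k) * (coxeter n)⁻¹) (X.rot.elements.openerVector ω) =
    ω ^ expo (1, Multiplicative.ofAdd 1) • reflRep n 1 (reflRep n w (X.elements.openerVector ω))
  rw [expo_ofAdd_one, pow_one, map_one, Module.End.one_apply,
    ← NCChain.reflRep_openerVector_rotate _ hω]
  congr 2
  conv_lhs => rw [← X.toFlat_elements]
  rw [NCFlat.rot_toFlat, NCChain.elements_toFlat]

end Hyperoct

theorem mainTheorem2 (n k : ℕ) [NeZero n] [NeZero k] (ω : ℂ)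
    (hω : IsPrimitiveRoot ω (2 * n * k)) :
    -- the Coxeter number is `h = 2n`
    orderOf (Hyperoct.coxeter n) = 2 * n ∧
    -- `θ_i = x_i ^ (kh + 1)` is an hsop of degree `kh + 1` carrying `V^*` through `x_i ↦ θ_i`
    AlgPark.IsHSOP (2 * n * k + 1) (AlgPark.powerTheta n k) ∧
    AlgPark.CarriesDual (AlgPark.powerTheta n k) ∧
    -- `V^Θ` consists of `(kh + 1) ^ n` points of multiplicity one
    AlgPark.locus (AlgPark.powerTheta n k) =
      {v : Fin n → ℂ | ∀ i, v i = 0 ∨ v i ^ (2 * n * k) = 1} ∧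
    (AlgPark.locus (AlgPark.powerTheta n k)).ncard = (2 * n * k + 1) ^ n ∧
    (∀ v ∈ AlgPark.locus (AlgPark.powerTheta n k),
      AlgPark.multiplicity (AlgPark.deformIdeal (AlgPark.powerTheta n k)) v = 1) ∧
    -- the permutation module of `V^Θ` is isomorphic to `Park^alg_W(k)`
    (∃ L : (AlgPark.locus (AlgPark.powerTheta n k) →₀ ℂ) ≃ₗ[ℂ]
        AlgPark.ParkAlg (AlgPark.powerTheta n k),
      ∀ (γ : AlgPark.SymGroup n k) (a : AlgPark.locus (AlgPark.powerTheta n k) →₀ ℂ),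
        L (a.mapDomain (AlgPark.locusAct hω γ)) = AlgPark.parkAlgAct hω γ (L a)) ∧
    -- `W` and the generator `g` define an action of `W × ℤ_{kh}` on `Park^NC_W(k)`, for which the
    -- map given by openers is a well-defined equivariant bijection onto `V^Θ`
    ∃ ρ : AlgPark.SymGroup n k →* Equiv.Perm (Hyperoct.ParkNC n k),
      (∀ v p, ρ (v, 1) p = Hyperoct.ParkNC.act v p) ∧
      (∀ p, ρ (1, Multiplicative.ofAdd 1) p = Hyperoct.ParkNC.rot p) ∧
      ∃ Φ : Hyperoct.ParkNC n k ≃ AlgPark.locus (AlgPark.powerTheta n k),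
        (∀ (w : Hyperoct n) (X : Hyperoct.NCFlat n k) (i : Fin n) (z : ℂ),
          (Φ (Hyperoct.ParkNC.mk w X)).1 i = z ↔
            Hyperoct.CoordRule ω (Hyperoct.nabla X) (Hyperoct.label w) i z) ∧
        ∀ (γ : AlgPark.SymGroup n k) (p : Hyperoct.ParkNC n k),
          Φ (ρ γ p) = AlgPark.locusAct hω γ (Φ p) := by
  refine ⟨Hyperoct.orderOf_coxeter n, AlgPark.isHSOP_powerTheta n k,
    AlgPark.carriesDual_powerTheta n k, Set.ext fun v => ?_, AlgPark.ncard_locus hω,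
    AlgPark.multiplicity_eq_one, AlgPark.exists_linearEquiv_parkAlg hω, ?_⟩
  · rw [Hyperoct.mem_locus_powerTheta]
    exact forall_congr' fun i => Hyperoct.pow_add_one_eq_self_iff
  · let Φ := Equiv.ofBijective _ (Hyperoct.parkVector_bijective (n := n) (k := k) hω)
    -- The action is transported from the locus along `Φ`. As `Φ` intertwines the given formulas
    -- with the action there, relations such as `g^(kh) = 1` and the commutation of `g` with `W` are
    -- automatic.
    refine ⟨Φ.symm.permCongrHom.toMonoidHom.comp (AlgPark.locusPerm hω), fun v p => ?_,
      fun p => ?_, Φ, fun w X i z => ?_, fun γ p => Φ.apply_symm_apply _⟩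
    · exact Φ.symm_apply_eq.mpr (Hyperoct.parkVector_act hω v p).symm
    · exact Φ.symm_apply_eq.mpr (Hyperoct.parkVector_rot hω p).symm
    · have h := X.elements.coordRule_iff hω w i z
      rw [X.toFlat_elements] at h
      rw [h]
      exact eq_comm
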